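/- Let $k$ be a unital commutative ring and work in lower $\mathbb Z$-graded differential graded (dg) $k$-modules, with differentials of degree $-1$ and the Koszul sign rule. Let $\mathcal R,\mathcal S$ be symmetric operads in dg $k$-modules, with differentials $d_{\mathcal R}, d_{\mathcal S}$. Let $\psi\colon\mathcal R\to\mathcal S$ be a morphism of operads, let $\iota\colon\mathcal S\to\mathcal R$ be an arity-wise chain map of degree $0$, and let $\nu\colon\mathcal R\to\mathcal R$ be an arity-wise $k$-linear map of degree $+1$ such that $$\psi\iota=\mathrm{id},\qquad d_{\mathcal R}\nu+\nu d_{\mathcal R}=\mathrm{id}-\iota\psi,\qquad \psi\nu=0$$ ($\iota$ and $\nu$ are not required to be equivariant or compatible with the operadic compositions). Let $U$ be a unital associative algebra in right $\mathcal S$-modules, regarded also as an algebra in right $\mathcal R$-modules by restriction along $\psi$. Let $G=(G(m))_{m\ge 0}$ be a sequence of dg $k$-modules and let $K=G\otimes\Sigma_*$ be the free $\Sigma_*$-module on $G$. For $\mathcal P\in\{\mathcal R,\mathcal S\}$, the object $U\otimes(K\circ\mathcal P)$ is the free left $U$-module in right $\mathcal P$-modules generated by $K$; here $(K\circ\mathcal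 P)=\bigoplus_{m}G(m)\otimes\mathcal P^{\otimes m}$, because $K$ is $\Sigma_*$-free. Let $d$ denote its internal differential, induced by those of $U$, $G$ and $\mathcal P$. An arity-preserving $k$-linear map $f\colon G\to U\otimes(K\circ\mathcal P)$ of degree $-1$ (equivalently, a map of $\Sigma_*$-modules $K\to U\otimes (K\circ\mathcal P)$ of degree $-1$) induces a morphism $\partial_f\colon U\otimes(K\circ\mathcal P)\to U\otimes(K\circ\mathcal P)$ of degree $-1$ of left $U$-modules in right $\mathcal P$-modules, given by $\partial_f\big(u\otimes g(p_1,\dots,p_m)\big)=(-1)^{|u|}\,u\cdot f(g)(p_1,\dots,p_m)$. The map $f$ is called a twisting cochain if $(d+\partial_f)^2=0$. Let $\beta\colon G\to U\otimes(K\circ\mathcal S)$ be a twisting cochain such that in addition $$d\,\beta+\beta\,d_G=0\qquad\text{and}\qquad \partial_\beta\,\beta=0 .$$ If $K$ (that is, every $G(m)$), $U$ and $\mathcal S$ are concentrated in nonnegative degrees, then there is a twisting cochain $\alpha\colon G\to U\otimes(K\circ\mathcal R)$ which lifts $\beta$ along $\psi$, in the sense that $$\big(U\otimes(K\circ\psi)\big)\,\partial_\alpha=\partial_\beta\,\big(U\otimes(K\circ\psi)\big)\colon\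 U\otimes(K\circ\mathcal R)\to U\otimes(K\circ\mathcal S).$$ -/

import Mathlib

open scoped TensorProduct DirectSum

universe u v

namespace OperadLifting

/-! ### Differential graded modules -/

/-- A lower `ℤ`-graded differential graded `k`-module: a `k`-module which is the direct sum of its
homogeneous parts, with a differential that lowers degrees by one. -/
structure DGModule (k : Type u) [CommRing k] where
  carrier : Type v
  [addCommGroup : AddCommGroup carrier]
  [module : Module k carrier]
  grading : ℤ → Submodule k carrier
  [decomposition : DirectSum.Decomposition grading]
  d : carrier →ₗ[k] carrier
  d_mem : ∀ (n : ℤ) (x : carrier), x ∈ grading n → d x ∈ grading (n - 1)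
  d_d : ∀ x : carrier, d (d x) = 0

namespace DGModule

variable {k : Type u} [CommRing k]

instance : CoeSort (DGModule.{u, v} k) (Type v) := ⟨DGModule.carrier⟩

attribute [instance] DGModule.addCommGroup DGModule.module DGModule.decomposition

/-- Nothing in negative degrees. -/
def IsNonneg (M : DGModule.{u, v} k) : Prop := ∀ n : ℤ, n < 0 → M.grading n = ⊥

/-- The degree involution `x ↦ (-1)^|x| x`. -/
noncomputable def invol (M : DGModule.{u, v} k) : M →ₗ[k] M :=
  DirectSum.toModule k ℤ M (fun n => (n.negOnePow : ℤˣ) • (M.grading n).subtype) ∘ₗ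
    (DirectSum.decomposeLinearEquiv M.grading).toLinearMap

/-- The projection onto the even part (`a = 0`) or onto the odd part (`a = 1`). -/
noncomputable def parityPart (M : DGModule.{u, v} k) (a : Fin 2) : M →ₗ[k] M :=
  DirectSum.toModule k ℤ M
      (fun n => if n % 2 = ((a : ℕ) : ℤ) then (M.grading n).subtype else 0) ∘ₗ
    (DirectSum.decomposeLinearEquiv M.grading).toLinearMap

/-- The differential of a tensor product `M 0 ⊗ ⋯ ⊗ M (n - 1)`, with the usual signs:
`d (x₀ ⊗ ⋯) = ∑ j, ± x₀ ⊗ ⋯ ⊗ d xⱼ ⊗ ⋯`, the sign being `(-1)^(|x₀| + ⋯ + |xⱼ₋₁|)`. -/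
noncomputable def tensorD {n : ℕ} (M : Fin n → DGModule.{u, v} k) :
    (⨂[k] i, M i) →ₗ[k] ⨂[k] i, M i :=
  ∑ j : Fin n, PiTensorProduct.map
    (fun i => if i < j then (M i).invol else if i = j then (M i).d else LinearMap.id)

end DGModule

/-! ### Signs and bijections -/

/-- The exponent of the Koszul sign of the reordering
`(b_i)_{i ∈ l}, (c_x)_{x ∈ L}  ⟶  (b_i, (c_x)_{h x = i})_{i ∈ l}`
for graded symbols of degrees `|b_i| = p i` and `|c_x| = q x`, all families being listed in
increasing order of their indices. -/
def shuffleExp {l L : Type} [Fintype l] [LinearOrder l] [Fintype L] [LinearOrder L]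
    (h : L → l) (p : l → ℤ) (q : L → ℤ) : ℤ :=
  (∑ x : L, ∑ y : L, if x < y ∧ h y < h x then q x * q y else 0) +
    ∑ i : l, ∑ x : L, if h x < i then p i * q x else 0

/-- `⊔_i ⊔_{x ∈ h⁻¹(i)} e_x = ⊔_x e_x`. -/
def sigmaFiberSigma {l L : Type} (h : L → l) (e : L → Type) :
    (Σ i : l, Σ x : {x : L // h x = i}, e x.1) ≃ Σ x : L, e x where
  toFun z := ⟨z.2.1.1, z.2.2⟩
  invFun z := ⟨h z.1, ⟨⟨z.1, rfl⟩, z.2⟩⟩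
  left_inv := by rintro ⟨i, ⟨x, rfl⟩, y⟩; rfl
  right_inv := by rintro ⟨x, y⟩; rfl

/-- `h⁻¹(false) ⊔ h⁻¹(true) = L`. -/
def boolFiber {L : Type} (h : L → Bool) :
    {x : L // h x = false} ⊕ {x : L // h x = true} ≃ L where
  toFun := Sum.elim Subtype.val Subtype.val
  invFun x := if hx : h x = false then .inl ⟨x, hx⟩ else .inr ⟨x, by simpa using hx⟩
  left_inv := by
    rintro (⟨x, hx⟩ | ⟨x, hx⟩)
    · simp [hx]
    · simp [hx]
  right_inv x := by
    by_cases hx : h x = false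
    · simp [hx]
    · simp [hx]

/-- `(⊔_{x ∈ h⁻¹(false)} e_x) ⊔ (⊔_{x ∈ h⁻¹(true)} e_x) = ⊔_x e_x`. -/
def boolFiberSigma {L : Type} (h : L → Bool) (e : L → Type) :
    (Σ x : {x : L // h x = false}, e x.1) ⊕ (Σ x : {x : L // h x = true}, e x.1) ≃
      Σ x : L, e x where
  toFun := Sum.elim (fun z => ⟨z.1.1, z.2⟩) (fun z => ⟨z.1.1, z.2⟩)
  invFun z := if hx : h z.1 = false then .inl ⟨⟨z.1, hx⟩, z.2⟩
    else .inr ⟨⟨z.1, by simpa using hx⟩, z.2⟩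
  left_inv := by
    rintro (⟨⟨x, hx⟩, y⟩ | ⟨⟨x, hx⟩, y⟩)
    · simp [hx]
    · simp [hx]
  right_inv z := by
    by_cases hx : h z.1 = false
    · simp [hx]
    · simp [hx]

/-- A bijection `σ : e ≃ e'` restricts to the fibres of `f` and of `f ∘ σ⁻¹`. -/
def fiberRelabel {e e' c : Type} (σ : e ≃ e') (f : e → c) (i : c) :
    {y : e // f y = i} ≃ {y : e' // (f ∘ σ.symm) y = i} where
  toFun y := ⟨σ y.1, by simpa using y.2⟩
  invFun y := ⟨σ.symm y.1, y.2⟩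
  left_inv y := by simp
  right_inv y := by simp

/-- `⊔_{x ∈ h⁻¹(i)} e_x` is the fibre at `i` of the map `⊔_x e_x ⟶ L ⟶ c`. -/
def fiberSigma {L c : Type} (h : L → c) (e : L → Type) (i : c) :
    (Σ x : {x : L // h x = i}, e x.1) ≃ {z : Σ x : L, e x // (h ∘ Sigma.fst) z = i} where
  toFun z := ⟨⟨z.1.1, z.2⟩, z.1.2⟩
  invFun z := ⟨⟨z.1.1, z.2⟩, z.1.2⟩
  left_inv _ := rfl
  right_inv _ := rfl

/-- The fibre at `0` of the map `c ⊔ e ⟶ {0, …, m}` which is `0` on `c` and `f` on `e`. -/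
def fiberSumZero {m : ℕ} (c : Type) {e : Type} (f : e → Fin (m + 1)) :
    c ⊕ {y : e // f y = 0} ≃ {z : c ⊕ e // Sum.elim (fun _ => 0) f z = 0} where
  toFun := Sum.elim (fun x => ⟨.inl x, rfl⟩) (fun y => ⟨.inr y.1, y.2⟩)
  invFun
    | ⟨.inl x, _⟩ => .inl x
    | ⟨.inr y, hy⟩ => .inr ⟨y, hy⟩
  left_inv := by rintro (x | y) <;> rfl
  right_inv := by rintro ⟨x | y, hz⟩ <;> rfl

/-- The fibre at `j + 1` of the map `c ⊔ e ⟶ {0, …, m}` which is `0` on `c` and `f` on `e`. -/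
def fiberSumSucc {m : ℕ} (c : Type) {e : Type} (f : e → Fin (m + 1)) (j : Fin m) :
    {y : e // f y = j.succ} ≃
      {z : c ⊕ e // Sum.elim (fun _ : c => (0 : Fin (m + 1))) f z = j.succ} where
  toFun y := ⟨.inr y.1, y.2⟩
  invFun
    | ⟨.inl _, hx⟩ => absurd hx (Fin.succ_ne_zero j).symm
    | ⟨.inr y, hy⟩ => ⟨y, hy⟩
  left_inv _ := rfl
  right_inv := by
    rintro ⟨x | y, hz⟩
    · exact absurd hz (Fin.succ_ne_zero j).symm
    · rfl

/-- A map `f : e ⟶ {0, …, m}` decomposes `e` as `f⁻¹(0) ⊔ ⊔_j f⁻¹(j + 1)`. -/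
def fiberDecomp {m : ℕ} {e : Type} (f : e → Fin (m + 1)) :
    {y : e // f y = 0} ⊕ (Σ j : Fin m, {y : e // f y = j.succ}) ≃ e where
  toFun := Sum.elim Subtype.val (fun z => z.2.1)
  invFun y := if hy : f y = 0 then .inl ⟨y, hy⟩
    else .inr ⟨(f y).pred hy, ⟨y, (Fin.succ_pred _ hy).symm⟩⟩
  left_inv := by
    rintro (⟨y, hy⟩ | ⟨j, ⟨y, hy⟩⟩)
    · simp [hy]
    · have hne : f y ≠ 0 := by rw [hy]; exact Fin.succ_ne_zero j
      obtain rfl : j = (f y).pred hne := by simp [hy]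
      simp [hne]
  right_inv y := by
    by_cases hy : f y = 0
    · simp [hy]
    · simp [hy]

theorem restrict_update_of_ne {L c : Type} [DecidableEq L] {X : L → Type*} (h : L → c) {i : L}
    {j : c} (hij : h i ≠ j) (s : ∀ i, X i) (z : X i) :
    (fun p : {x : L // h x = j} => Function.update s i z p.1) =
      fun p : {x : L // h x = j} => s p.1 := by
  funext p
  refine Function.update_of_ne (fun hp : p.1 = i => hij ?_) _ _
  rw [← hp]
  exact p.2

theorem restrict_update_of_eq {L c : Type} [DecidableEq L] {X : L → Type*} (h : L → c) {i : L}
    {j : c} (hij : h i = j) (s : ∀ i, X i) (z : X i) :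
    (fun p : {x : L // h x = j} => Function.update s i z p.1) =
      Function.update (fun p : {x : L // h x = j} => s p.1) ⟨i, hij⟩ z := by
  funext p
  by_cases hp : p = ⟨i, hij⟩
  · subst hp
    simp
  · rw [Function.update_of_ne hp, Function.update_of_ne (fun h' => hp (Subtype.ext h'))]

/-! ### `Σ_*`-modules, operads, right modules, algebras in right modules -/

variable {k : Type u} [CommRing k]

/-- A `Σ_*`-module in differential graded `k`-modules, as a functor on the category of finite sets
and bijections. (A contravariant functor is made covariant by inverting the bijections.) -/
structure SigmaModule (k : Type u) [CommRing k] where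
  obj : (e : Type) → [Finite e] → DGModule.{u, v} k
  map : {e e' : Type} → [Finite e] → [Finite e'] → (e ≃ e') → (obj e →ₗ[k] obj e')
  map_refl : ∀ (e : Type) [Finite e] (x : obj e), map (Equiv.refl e) x = x
  map_trans : ∀ {e e' e'' : Type} [Finite e] [Finite e'] [Finite e''] (σ : e ≃ e') (τ : e' ≃ e'')
    (x : obj e), map (σ.trans τ) x = map τ (map σ x)
  map_mem : ∀ {e e' : Type} [Finite e] [Finite e'] (σ : e ≃ e') (n : ℤ) (x : obj e),
    x ∈ (obj e).grading n → map σ x ∈ (obj e').grading n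
  map_d : ∀ {e e' : Type} [Finite e] [Finite e'] (σ : e ≃ e') (x : obj e),
    map σ ((obj e).d x) = (obj e').d (map σ x)

/-- Raw composition operations
`M(l) ⊗ ⨂_{i ∈ l} P(e_i) ⟶ M(⊔_i e_i)`, `a ⊗ b ↦ a(b)`, one for each finite linearly ordered set
`l` and each family of finite sets `(e_i)_{i ∈ l}`. The order of `l` is the order of the factors of
the tensor product. The element `a(b)` is written `comp l e b a`. -/
abbrev CompData (M P : SigmaModule.{u, v} k) :=
  ∀ (l : Type) [Finite l] [LinearOrder l] (e : l → Type) [∀ i, Finite (e i)],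
    MultilinearMap k (fun i => P.obj (e i)) (M.obj l →ₗ[k] M.obj (Σ i, e i))

/-- The laws which a right composition `compM` on `M` has to satisfy with respect to a composition
`compP` on `P`, units excepted. -/
structure IsRightComp {M P : SigmaModule.{u, v} k} (compM : CompData M P) (compP : CompData P P) :
    Prop where
  /-- Composition is homogeneous of degree `0`. -/
  comp_mem : ∀ (l : Type) [Fintype l] [LinearOrder l] (e : l → Type) [∀ i, Finite (e i)]
    (p : ℤ) (q : l → ℤ) (a : M.obj l) (b : ∀ i, P.obj (e i)),
    a ∈ (M.obj l).grading p → (∀ i, b i ∈ (P.obj (e i)).grading (q i)) →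
    compM l e b a ∈ (M.obj (Σ i, e i)).grading (p + ∑ i, q i)
  /-- Composition is a chain map. -/
  comp_d : ∀ (l : Type) [Fintype l] [LinearOrder l] (e : l → Type) [∀ i, Finite (e i)]
    (p : ℤ) (q : l → ℤ) (a : M.obj l) (b : ∀ i, P.obj (e i)),
    a ∈ (M.obj l).grading p → (∀ i, b i ∈ (P.obj (e i)).grading (q i)) →
    (M.obj (Σ i, e i)).d (compM l e b a) =
      compM l e b ((M.obj l).d a) +
        ∑ i, ((p + ∑ j, if j < i then q j else 0).negOnePow : ℤˣ) •
          compM l e (Function.update b i ((P.obj (e i)).d (b i))) a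
  /-- Equivariance with respect to bijections of the sets `e_i`. -/
  comp_map : ∀ (l : Type) [Finite l] [LinearOrder l] (e e' : l → Type) [∀ i, Finite (e i)]
    [∀ i, Finite (e' i)] (τ : ∀ i, e i ≃ e' i) (a : M.obj l) (b : ∀ i, P.obj (e i)),
    compM l e' (fun i => P.map (τ i) (b i)) a =
      M.map (Equiv.sigmaCongrRight τ) (compM l e b a)
  /-- Equivariance with respect to bijections of the set `l`; the factors `b_i` are permuted, which
  produces a Koszul sign. -/
  map_comp : ∀ (l l' : Type) [Fintype l] [LinearOrder l] [Fintype l'] [LinearOrder l']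
    (σ : l ≃ l') (e : l' → Type) [∀ i, Finite (e i)] (q : l' → ℤ)
    (a : M.obj l) (b : ∀ i, P.obj (e i)),
    (∀ i, b i ∈ (P.obj (e i)).grading (q i)) →
    compM l' e b (M.map σ a) =
      ((shuffleExp σ 0 (fun i => q (σ i))).negOnePow : ℤˣ) •
        M.map (Equiv.sigmaCongrLeft σ) (compM l (fun i => e (σ i)) (fun i => b (σ i)) a)
  /-- Associativity: for `h : L ⟶ l`, `a ∈ M(l)`, `b_i ∈ P(h⁻¹(i))` and `c_x ∈ P(e_x)`,
  `a(b)(c) = ± a((b_i((c_x)_{h x = i}))_i)`, with the Koszul sign of the reordering. -/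
  assoc : ∀ (l L : Type) [Fintype l] [LinearOrder l] [Fintype L] [LinearOrder L]
    (h : L → l) (e : L → Type) [∀ x, Finite (e x)] (p : l → ℤ) (q : L → ℤ)
    (a : M.obj l) (b : ∀ i, P.obj {x : L // h x = i}) (c : ∀ x, P.obj (e x)),
    (∀ i, b i ∈ (P.obj {x : L // h x = i}).grading (p i)) →
    (∀ x, c x ∈ (P.obj (e x)).grading (q x)) →
    compM L e c (M.map (Equiv.sigmaFiberEquiv h) (compM l (fun i => {x : L // h x = i}) b a)) =
      ((shuffleExp h p q).negOnePow : ℤˣ) •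
        M.map (sigmaFiberSigma h e)
          (compM l (fun i => Σ x : {x : L // h x = i}, e x.1)
            (fun i => compP {x : L // h x = i} (fun x => e x.1) (fun x => c x.1) (b i)) a)

/-- A symmetric operad in differential graded `k`-modules. -/
structure Operad (k : Type u) [CommRing k] extends SigmaModule.{u, v} k where
  comp : CompData toSigmaModule toSigmaModule
  isRightComp : IsRightComp comp comp
  /-- The operadic unit, an operation on a one-point set. -/
  one : obj Unit
  one_mem : one ∈ (obj Unit).grading 0
  one_d : (obj Unit).d one = 0
  comp_one : ∀ (l : Type) [Finite l] [LinearOrder l] (a : obj l),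
    map (Equiv.sigmaPUnit l) (comp l (fun _ => Unit) (fun _ => one) a) = a
  one_comp : ∀ (e : Type) [Finite e] (b : obj e),
    map (Equiv.uniqueSigma (fun _ : Unit => e)) (comp Unit (fun _ => e) (fun _ => b) one) = b

/-- A morphism of operads. -/
structure OperadHom (R S : Operad.{u, v} k) where
  toFun : (e : Type) → [Finite e] → (R.obj e →ₗ[k] S.obj e)
  toFun_mem : ∀ (e : Type) [Finite e] (n : ℤ) (x : R.obj e),
    x ∈ (R.obj e).grading n → toFun e x ∈ (S.obj e).grading n
  toFun_d : ∀ (e : Type) [Finite e] (x : R.obj e),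
    toFun e ((R.obj e).d x) = (S.obj e).d (toFun e x)
  toFun_map : ∀ {e e' : Type} [Finite e] [Finite e'] (σ : e ≃ e') (x : R.obj e),
    toFun e' (R.map σ x) = S.map σ (toFun e x)
  toFun_comp : ∀ (l : Type) [Finite l] [LinearOrder l] (e : l → Type) [∀ i, Finite (e i)]
    (a : R.obj l) (b : ∀ i, R.obj (e i)),
    toFun (Σ i, e i) (R.comp l e b a) = S.comp l e (fun i => toFun (e i) (b i)) (toFun l a)
  toFun_one : toFun Unit R.one = S.one

/-- The structure of a right module over the operad `P` on the `Σ_*`-module `U`. -/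
structure RightModule (P : Operad.{u, v} k) (U : SigmaModule.{u, v} k) where
  comp : CompData U P.toSigmaModule
  isRightComp : IsRightComp comp P.comp
  comp_one : ∀ (l : Type) [Finite l] [LinearOrder l] (a : U.obj l),
    U.map (Equiv.sigmaPUnit l) (comp l (fun _ => Unit) (fun _ => P.one) a) = a

/-- The structure of a unital associative algebra in right `P`-modules on the `Σ_*`-module `U`:
a right `P`-module with a product `U(c) ⊗ U(e) ⟶ U(c ⊔ e)` and a unit in `U(∅)`. -/
structure RightModuleAlgebra (P : Operad.{u, v} k) (U : SigmaModule.{u, v} k) extends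
    RightModule P U where
  mul : (c e : Type) → [Finite c] → [Finite e] → (U.obj c →ₗ[k] U.obj e →ₗ[k] U.obj (c ⊕ e))
  one : U.obj Empty
  one_mem : one ∈ (U.obj Empty).grading 0
  one_d : (U.obj Empty).d one = 0
  mul_mem : ∀ (c e : Type) [Finite c] [Finite e] (p q : ℤ) (x : U.obj c) (y : U.obj e),
    x ∈ (U.obj c).grading p → y ∈ (U.obj e).grading q →
    mul c e x y ∈ (U.obj (c ⊕ e)).grading (p + q)
  mul_d : ∀ (c e : Type) [Finite c] [Finite e] (p : ℤ) (x : U.obj c) (y : U.obj e),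
    x ∈ (U.obj c).grading p →
    (U.obj (c ⊕ e)).d (mul c e x y) =
      mul c e ((U.obj c).d x) y + (p.negOnePow : ℤˣ) • mul c e x ((U.obj e).d y)
  mul_map : ∀ {c c' e e' : Type} [Finite c] [Finite c'] [Finite e] [Finite e']
    (σ : c ≃ c') (τ : e ≃ e') (x : U.obj c) (y : U.obj e),
    mul c' e' (U.map σ x) (U.map τ y) = U.map (Equiv.sumCongr σ τ) (mul c e x y)
  mul_assoc : ∀ (a b c : Type) [Finite a] [Finite b] [Finite c]
    (x : U.obj a) (y : U.obj b) (z : U.obj c),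
    U.map (Equiv.sumAssoc a b c) (mul (a ⊕ b) c (mul a b x y) z) =
      mul a (b ⊕ c) x (mul b c y z)
  one_mul : ∀ (e : Type) [Finite e] (x : U.obj e),
    U.map (Equiv.emptySum Empty e) (mul Empty e one x) = x
  mul_one : ∀ (e : Type) [Finite e] (x : U.obj e),
    U.map (Equiv.sumEmpty e Empty) (mul e Empty x one) = x
  /-- The product is a morphism of right `P`-modules `U ⊗ U ⟶ U`: for `L = h⁻¹(false) ⊔ h⁻¹(true)`,
  `x ∈ U(h⁻¹(false))`, `y ∈ U(h⁻¹(true))` and `s_i ∈ P(e_i)`,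
  `(x y)(s) = ± x((s_i)_{h i = false}) y((s_i)_{h i = true})`. -/
  mul_comp : ∀ (L : Type) [Fintype L] [LinearOrder L] (h : L → Bool) (e : L → Type)
    [∀ i, Finite (e i)] (r : Bool → ℤ) (q : L → ℤ)
    (x : U.obj {i : L // h i = false}) (y : U.obj {i : L // h i = true}) (s : ∀ i, P.obj (e i)),
    x ∈ (U.obj {i : L // h i = false}).grading (r false) →
    y ∈ (U.obj {i : L // h i = true}).grading (r true) →
    (∀ i, s i ∈ (P.obj (e i)).grading (q i)) →
    comp L e s (U.map (boolFiber h) (mul {i : L // h i = false} {i : L // h i = true} x y)) =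
      ((shuffleExp h r q).negOnePow : ℤˣ) •
        U.map (boolFiberSigma h e)
          (mul (Σ i : {i : L // h i = false}, e i.1) (Σ i : {i : L // h i = true}, e i.1)
            (comp {i : L // h i = false} (fun i => e i.1) (fun i => s i.1) x)
            (comp {i : L // h i = true} (fun i => e i.1) (fun i => s i.1) y))

/-- Restriction of structure along an operad morphism `ψ : R ⟶ S`: an algebra in right `S`-modules
is an algebra in right `R`-modules. -/
def RightModuleAlgebra.restrict {R S : Operad.{u, v} k} {U : SigmaModule.{u, v} k}
    (A : RightModuleAlgebra S U) (ψ : OperadHom R S) : RightModuleAlgebra R U where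
  comp l _ _ e _ := (A.comp l e).compLinearMap (fun i => ψ.toFun (e i))
  isRightComp :=
    { comp_mem := fun l _ _ e _ p q a b ha hb =>
        A.isRightComp.comp_mem l e p q a _ ha (fun i => ψ.toFun_mem _ _ _ (hb i))
      comp_d := fun l _ _ e _ p q a b ha hb => by
        have h := A.isRightComp.comp_d l e p q a (fun i => ψ.toFun (e i) (b i)) ha
          (fun i => ψ.toFun_mem _ _ _ (hb i))
        simp only [MultilinearMap.compLinearMap_apply]
        rw [h]
        congr 1
        refine Finset.sum_congr rfl fun i _ => ?_
        congr 3
        funext j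
        by_cases hj : j = i
        · subst hj
          simp [ψ.toFun_d]
        · simp [hj]
      comp_map := fun l _ _ e e' _ _ τ a b => by
        simp only [MultilinearMap.compLinearMap_apply, ψ.toFun_map]
        exact A.isRightComp.comp_map l e e' τ a _
      map_comp := fun l l' _ _ _ _ σ e _ q a b hb =>
        A.isRightComp.map_comp l l' σ e q a _ (fun i => ψ.toFun_mem _ _ _ (hb i))
      assoc := fun l L _ _ _ _ h e _ p q a b c hb hc => by
        simp only [MultilinearMap.compLinearMap_apply, ψ.toFun_comp]
        exact A.isRightComp.assoc l L h e p q a _ _ (fun i => ψ.toFun_mem _ _ _ (hb i))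
          (fun i => ψ.toFun_mem _ _ _ (hc i)) }
  comp_one l _ _ a := by
    simp only [MultilinearMap.compLinearMap_apply, ψ.toFun_one]
    exact A.comp_one l a
  mul := A.mul
  one := A.one
  one_mem := A.one_mem
  one_d := A.one_d
  mul_mem := A.mul_mem
  mul_d := A.mul_d
  mul_map := A.mul_map
  mul_assoc := A.mul_assoc
  one_mul := A.one_mul
  mul_one := A.mul_one
  mul_comp L _ _ h e _ r q x y s hx hy hs :=
    A.mul_comp L h e r q x y _ hx hy (fun i => ψ.toFun_mem _ _ _ (hs i))

/-! ### The object `U ⊗ (K ∘ P)` for `K = G ⊗ Σ_*` -/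

/-- The summand of `U ⊗ (K ∘ P)` that belongs to `m` and to `f : e ⟶ {0, …, m}`, namely
`U(f⁻¹(0)) ⊗ G(m) ⊗ P(f⁻¹(1)) ⊗ ⋯ ⊗ P(f⁻¹(m))`. -/
abbrev Summand (U : SigmaModule.{u, v} k) (G : ℕ → DGModule.{u, v} k) (P : SigmaModule.{u, v} k)
    (e : Type) [Finite e] (x : Σ m : ℕ, (e → Fin (m + 1))) :=
  U.obj {y : e // x.2 y = 0} ⊗[k]
    (G x.1 ⊗[k] (⨂[k] j : Fin x.1, P.obj {y : e // x.2 y = j.succ}))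

/-- The value at the finite set `e` of the `Σ_*`-module `U ⊗ (K ∘ P)`, for the free `Σ_*`-module
`K = G ⊗ Σ_*`. Since `K` is free, `(K ∘ P)(e) = ⨁_m K(m) ⊗_{Σ_m} P^{⊗ m}(e)` is
`⨁_m G(m) ⊗ P^{⊗ m}(e)`, where `P^{⊗ m}(e)` is the sum of the modules `P(e_1) ⊗ ⋯ ⊗ P(e_m)` over
all decompositions `e = e_1 ⊔ ⋯ ⊔ e_m`; so `(U ⊗ (K ∘ P))(e)` is the sum of the modules
`U(e_0) ⊗ G(m) ⊗ P(e_1) ⊗ ⋯ ⊗ P(e_m)` over all `m` and all decompositions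
`e = e_0 ⊔ e_1 ⊔ ⋯ ⊔ e_m`, that is, over all maps `f : e ⟶ {0, …, m}`. -/
abbrev FreeObj (U : SigmaModule.{u, v} k) (G : ℕ → DGModule.{u, v} k) (P : SigmaModule.{u, v} k)
    (e : Type) [Finite e] :=
  ⨁ x : (Σ m : ℕ, (e → Fin (m + 1))), Summand U G P e x

namespace FreeObj

variable (U : SigmaModule.{u, v} k) (G : ℕ → DGModule.{u, v} k) (P : SigmaModule.{u, v} k)

open Classical in
/-- The inclusion of a summand. -/
noncomputable def incl (e : Type) [Finite e] (x : Σ m : ℕ, (e → Fin (m + 1))) :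
    Summand U G P e x →ₗ[k] FreeObj U G P e :=
  DirectSum.lof k _ (Summand U G P e) x

open Classical in
/-- The linear map given by a family of linear maps on the summands. -/
noncomputable def desc (e : Type) [Finite e] {N : Type*} [AddCommGroup N] [Module k N]
    (φ : ∀ x : (Σ m : ℕ, (e → Fin (m + 1))), Summand U G P e x →ₗ[k] N) :
    FreeObj U G P e →ₗ[k] N :=
  DirectSum.toModule k _ N φ

/-- The homogeneous elements of degree `n`: spanned by the `u ⊗ g ⊗ s_1 ⊗ ⋯ ⊗ s_m` with homogeneous
factors whose degrees add up to `n`. -/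
def grading (e : Type) [Finite e] (n : ℤ) : Submodule k (FreeObj U G P e) :=
  Submodule.span k {z | ∃ (m : ℕ) (f : e → Fin (m + 1)) (p q : ℤ) (r : Fin m → ℤ)
    (a : U.obj {y : e // f y = 0}) (g : G m) (s : ∀ j : Fin m, P.obj {y : e // f y = j.succ}),
    a ∈ (U.obj {y : e // f y = 0}).grading p ∧ g ∈ (G m).grading q ∧
    (∀ j, s j ∈ (P.obj {y : e // f y = j.succ}).grading (r j)) ∧
    p + q + ∑ j, r j = n ∧
    z = incl U G P e ⟨m, f⟩ (a ⊗ₜ (g ⊗ₜ PiTensorProduct.tprod k s))}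

/-- The differential of `U ⊗ (K ∘ P)`, which is induced by those of `U`, `G` and `P`. -/
noncomputable def d (e : Type) [Finite e] : FreeObj U G P e →ₗ[k] FreeObj U G P e :=
  DirectSum.lmap (fun x : (Σ m : ℕ, (e → Fin (m + 1))) =>
    (TensorProduct.map (U.obj {y : e // x.2 y = 0}).d LinearMap.id +
      TensorProduct.map (U.obj {y : e // x.2 y = 0}).invol
        (TensorProduct.map (G x.1).d LinearMap.id +
          TensorProduct.map (G x.1).invol
            (DGModule.tensorD (fun j : Fin x.1 => P.obj {y : e // x.2 y = j.succ}))) :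
      Summand U G P e x →ₗ[k] Summand U G P e x))

/-- The action of bijections on `U ⊗ (K ∘ P)`. -/
noncomputable def map {e e' : Type} [Finite e] [Finite e'] (σ : e ≃ e') :
    FreeObj U G P e →ₗ[k] FreeObj U G P e' :=
  desc U G P e (fun x => incl U G P e' ⟨x.1, x.2 ∘ σ.symm⟩ ∘ₗ
    TensorProduct.map (U.map (fiberRelabel σ x.2 0))
      (TensorProduct.map LinearMap.id
        (PiTensorProduct.map (fun j => P.map (fiberRelabel σ x.2 j.succ)))))

/-- The map `U ⊗ (K ∘ ψ)` for an arity-wise map `ψ : P ⟶ Q`. -/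
noncomputable def mapRight {P Q : SigmaModule.{u, v} k}
    (ψ : (e : Type) → [Finite e] → (P.obj e →ₗ[k] Q.obj e)) (e : Type) [Finite e] :
    FreeObj U G P e →ₗ[k] FreeObj U G Q e :=
  DirectSum.lmap (fun x : (Σ m : ℕ, (e → Fin (m + 1))) =>
    (TensorProduct.map LinearMap.id
      (TensorProduct.map LinearMap.id
        (PiTensorProduct.map (fun j : Fin x.1 => ψ {y : e // x.2 y = j.succ}))) :
      Summand U G P e x →ₗ[k] Summand U G Q e x))

end FreeObj

namespace FreeObj

variable {P : Operad.{u, v} k} {U : SigmaModule.{u, v} k}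
variable (A : RightModuleAlgebra P U) (G : ℕ → DGModule.{u, v} k)

/-- The left action `U(c) ⊗ (U ⊗ (K ∘ P))(e) ⟶ (U ⊗ (K ∘ P))(c ⊔ e)`,
`u · (u' ⊗ g ⊗ s) = (u u') ⊗ g ⊗ s`. -/
noncomputable def mul (c e : Type) [Finite c] [Finite e] (u : U.obj c) :
    FreeObj U G P.toSigmaModule e →ₗ[k] FreeObj U G P.toSigmaModule (c ⊕ e) :=
  desc U G P.toSigmaModule e (fun x =>
    incl U G P.toSigmaModule (c ⊕ e) ⟨x.1, Sum.elim (fun _ => 0) x.2⟩ ∘ₗ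
      TensorProduct.map (U.map (fiberSumZero c x.2) ∘ₗ A.mul c {y : e // x.2 y = 0} u)
        (TensorProduct.map LinearMap.id
          (PiTensorProduct.map (fun j => P.map (fiberSumSucc c x.2 j)))))

theorem desc_add {N : Type*} [AddCommGroup N] [Module k N] (e : Type) [Finite e]
    (φ φ' : ∀ x : (Σ m : ℕ, (e → Fin (m + 1))), Summand U G P.toSigmaModule e x →ₗ[k] N) :
    desc U G P.toSigmaModule e (fun x => φ x + φ' x) =
      desc U G P.toSigmaModule e φ + desc U G P.toSigmaModule e φ' := by
  classical
  refine DirectSum.linearMap_ext k fun x => LinearMap.ext fun y => ?_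
  simp [desc]

theorem desc_smul {N : Type*} [AddCommGroup N] [Module k N] (e : Type) [Finite e] (t : k)
    (φ : ∀ x : (Σ m : ℕ, (e → Fin (m + 1))), Summand U G P.toSigmaModule e x →ₗ[k] N) :
    desc U G P.toSigmaModule e (fun x => t • φ x) = t • desc U G P.toSigmaModule e φ := by
  classical
  refine DirectSum.linearMap_ext k fun x => LinearMap.ext fun y => ?_
  simp [desc]

/-- The left action `mul`, as a linear map in the element of `U(c)`. -/
noncomputable def mulₗ (c e : Type) [Finite c] [Finite e] :
    U.obj c →ₗ[k] FreeObj U G P.toSigmaModule e →ₗ[k] FreeObj U G P.toSigmaModule (c ⊕ e) where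
  toFun := mul A G c e
  map_add' u v := by
    unfold mul
    rw [← desc_add]
    congr 1
    funext x
    rw [map_add, LinearMap.comp_add, TensorProduct.map_add_left, LinearMap.comp_add]
  map_smul' t u := by
    unfold mul
    rw [RingHom.id_apply, ← desc_smul]
    congr 1
    funext x
    rw [map_smul, LinearMap.comp_smul, TensorProduct.map_smul_left, LinearMap.comp_smul]

section RightAction

variable {L : Type} [Fintype L] [LinearOrder L] (e : L → Type) [∀ i, Finite (e i)]

/-- The factor of the right action on `U`: `u ↦ u((s_i)_{h i = 0})`. -/
noncomputable def actZero {m : ℕ} (h : L → Fin (m + 1)) (s : ∀ i, P.obj (e i)) :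
    U.obj {i : L // h i = 0} →ₗ[k] U.obj {z : Σ i, e i // (h ∘ Sigma.fst) z = 0} :=
  U.map (fiberSigma h e 0) ∘ₗ A.comp {i : L // h i = 0} (fun i => e i.1) (fun i => s i.1)

/-- The factor of the right action on the `j`th factor `P`: `t_j ↦ t_j((s_i)_{h i = j + 1})`. -/
noncomputable def actSucc {m : ℕ} (h : L → Fin (m + 1)) (s : ∀ i, P.obj (e i)) (j : Fin m) :
    P.obj {i : L // h i = j.succ} →ₗ[k] P.obj {z : Σ i, e i // (h ∘ Sigma.fst) z = j.succ} :=
  P.map (fiberSigma h e j.succ) ∘ₗ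
    P.comp {i : L // h i = j.succ} (fun i => e i.1) (fun i => s i.1)

theorem actZero_update_of_ne {m : ℕ} (h : L → Fin (m + 1)) (s : ∀ i, P.obj (e i)) {i : L}
    (hi : h i ≠ 0) (z : P.obj (e i)) :
    actZero A e h (Function.update s i z) = actZero A e h s := by
  unfold actZero
  rw [restrict_update_of_ne h hi]

theorem actZero_update_add {m : ℕ} (h : L → Fin (m + 1)) (s : ∀ i, P.obj (e i)) {i : L}
    (hi : h i = 0) (z z' : P.obj (e i)) :
    actZero A e h (Function.update s i (z + z')) =
      actZero A e h (Function.update s i z) + actZero A e h (Function.update s i z') := by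
  unfold actZero
  rw [restrict_update_of_eq h hi, restrict_update_of_eq h hi, restrict_update_of_eq h hi,
    MultilinearMap.map_update_add, LinearMap.comp_add]

theorem actZero_update_smul {m : ℕ} (h : L → Fin (m + 1)) (s : ∀ i, P.obj (e i)) {i : L}
    (hi : h i = 0) (t : k) (z : P.obj (e i)) :
    actZero A e h (Function.update s i (t • z)) =
      t • actZero A e h (Function.update s i z) := by
  unfold actZero
  rw [restrict_update_of_eq h hi, restrict_update_of_eq h hi,
    MultilinearMap.map_update_smul, LinearMap.comp_smul]

theorem actSucc_update_of_ne {m : ℕ} (h : L → Fin (m + 1)) (s : ∀ i, P.obj (e i)) {i : L}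
    {j : Fin m} (hi : h i ≠ j.succ) (z : P.obj (e i)) :
    actSucc e h (Function.update s i z) j = actSucc e h s j := by
  unfold actSucc
  rw [restrict_update_of_ne h hi]

theorem actSucc_update {m : ℕ} (h : L → Fin (m + 1)) (s : ∀ i, P.obj (e i)) {i : L}
    {j : Fin m} (hi : h i = j.succ) (z : P.obj (e i)) :
    actSucc e h (Function.update s i z) =
      Function.update (actSucc e h s) j (actSucc e h (Function.update s i z) j) := by
  funext j'
  by_cases hj : j' = j
  · subst hj
    simp
  · rw [Function.update_of_ne hj]
    exact actSucc_update_of_ne e h s (fun h' => hj (Fin.succ_injective _ (h'.symm.trans hi))) z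

theorem actSucc_update_add {m : ℕ} (h : L → Fin (m + 1)) (s : ∀ i, P.obj (e i)) {i : L}
    {j : Fin m} (hi : h i = j.succ) (z z' : P.obj (e i)) :
    actSucc e h (Function.update s i (z + z')) j =
      actSucc e h (Function.update s i z) j + actSucc e h (Function.update s i z') j := by
  unfold actSucc
  rw [restrict_update_of_eq h hi, restrict_update_of_eq h hi, restrict_update_of_eq h hi,
    MultilinearMap.map_update_add, LinearMap.comp_add]

theorem actSucc_update_smul {m : ℕ} (h : L → Fin (m + 1)) (s : ∀ i, P.obj (e i)) {i : L}
    {j : Fin m} (hi : h i = j.succ) (t : k) (z : P.obj (e i)) :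
    actSucc e h (Function.update s i (t • z)) j =
      t • actSucc e h (Function.update s i z) j := by
  unfold actSucc
  rw [restrict_update_of_eq h hi, restrict_update_of_eq h hi,
    MultilinearMap.map_update_smul, LinearMap.comp_smul]

/-- The right action of `s = (s_i)_{i ∈ L}`, up to signs:
`u ⊗ g ⊗ (t_j)_j ↦ u((s_i)_{h i = 0}) ⊗ g ⊗ (t_j((s_i)_{h i = j + 1}))_j`. -/
noncomputable def actUnsigned {m : ℕ} (h : L → Fin (m + 1)) :
    MultilinearMap k (fun i => P.obj (e i))
      (Summand U G P.toSigmaModule L ⟨m, h⟩ →ₗ[k]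
        Summand U G P.toSigmaModule (Σ i, e i) ⟨m, h ∘ Sigma.fst⟩) :=
  MultilinearMap.mk'
    (fun s => TensorProduct.map (actZero A e h s)
      (TensorProduct.map LinearMap.id (PiTensorProduct.map (actSucc e h s))))
    (by
      intro s i z z'
      rcases Fin.eq_zero_or_eq_succ (h i) with hi | ⟨j, hi⟩
      · have hne : ∀ j : Fin m, h i ≠ j.succ := fun j => hi ▸ (Fin.succ_ne_zero j).symm
        have hs : ∀ w, actSucc e h (Function.update s i w) = actSucc e h s := fun w =>
          funext fun j => actSucc_update_of_ne e h s (hne j) w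
        rw [hs, hs, hs, actZero_update_add A e h s hi, TensorProduct.map_add_left]
      · have hne : h i ≠ 0 := hi ▸ Fin.succ_ne_zero j
        rw [actZero_update_of_ne A e h s hne, actZero_update_of_ne A e h s hne,
          actZero_update_of_ne A e h s hne, actSucc_update e h s hi (z + z'),
          actSucc_update_add e h s hi, PiTensorProduct.map_update_add,
          ← actSucc_update e h s hi, ← actSucc_update e h s hi,
          TensorProduct.map_add_right, TensorProduct.map_add_right])
    (by
      intro s i t z
      rcases Fin.eq_zero_or_eq_succ (h i) with hi | ⟨j, hi⟩
      · have hne : ∀ j : Fin m, h i ≠ j.succ := fun j => hi ▸ (Fin.succ_ne_zero j).symm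
        have hs : ∀ w, actSucc e h (Function.update s i w) = actSucc e h s := fun w =>
          funext fun j => actSucc_update_of_ne e h s (hne j) w
        rw [hs, hs, actZero_update_smul A e h s hi, TensorProduct.map_smul_left]
      · have hne : h i ≠ 0 := hi ▸ Fin.succ_ne_zero j
        rw [actZero_update_of_ne A e h s hne, actZero_update_of_ne A e h s hne,
          actSucc_update e h s hi (t • z), actSucc_update_smul e h s hi,
          PiTensorProduct.map_update_smul, ← actSucc_update e h s hi,
          TensorProduct.map_smul_right, TensorProduct.map_smul_right])

/-- The right action of `s = (s_i)_{i ∈ L}` on a summand, with its sign. A homogeneous element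
`u ⊗ g ⊗ t_1 ⊗ ⋯ ⊗ t_m` is sent to `u((s_i)_{h i = 0}) ⊗ g ⊗ (t_j((s_i)_{h i = j + 1}))_j`, with the
Koszul sign of the reordering
`u, g, (t_j)_j, (s_i)_i ⟶ u, (s_i)_{h i = 0}, g, (t_j, (s_i)_{h i = j + 1})_j`.
The sign only depends on parities: the sum runs over the parities `a`, `b`, `c` of `g`, of the `t_j`
and of the `s_i`, and splits each argument in its even and its odd part. -/
noncomputable def actSigned {m : ℕ} (h : L → Fin (m + 1)) :
    MultilinearMap k (fun i => P.obj (e i))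
      (Summand U G P.toSigmaModule L ⟨m, h⟩ →ₗ[k]
        Summand U G P.toSigmaModule (Σ i, e i) ⟨m, h ∘ Sigma.fst⟩) :=
  ∑ a : Fin 2, ∑ b : Fin m → Fin 2, ∑ c : L → Fin 2,
    ((shuffleExp h (Fin.cons 0 (fun j => ((b j : ℕ) : ℤ))) (fun i => ((c i : ℕ) : ℤ)) +
        ∑ i : L, if h i = 0 then ((a : ℕ) : ℤ) * ((c i : ℕ) : ℤ) else 0).negOnePow : ℤˣ) •
      (LinearMap.lcomp k (Summand U G P.toSigmaModule (Σ i, e i) ⟨m, h ∘ Sigma.fst⟩)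
        (TensorProduct.map LinearMap.id
          (TensorProduct.map ((G m).parityPart a)
            (PiTensorProduct.map (fun j => (P.obj {i : L // h i = j.succ}).parityPart (b j)))) :
          Summand U G P.toSigmaModule L ⟨m, h⟩ →ₗ[k]
            Summand U G P.toSigmaModule L ⟨m, h⟩)).compMultilinearMap
        ((actUnsigned A G e h).compLinearMap (fun i => (P.obj (e i)).parityPart (c i)))

/-- The right `P`-module structure of `U ⊗ (K ∘ P)`: `act s z` is `z(s)`. -/
noncomputable def act :
    MultilinearMap k (fun i => P.obj (e i))
      (FreeObj U G P.toSigmaModule L →ₗ[k] FreeObj U G P.toSigmaModule (Σ i, e i)) :=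
  (DFinsupp.lsum k : (∀ x : (Σ m : ℕ, (L → Fin (m + 1))), Summand U G P.toSigmaModule L x →ₗ[k]
      FreeObj U G P.toSigmaModule (Σ i, e i)) ≃ₗ[k] _).toLinearMap.compMultilinearMap
    (MultilinearMap.pi fun x =>
      (LinearMap.llcomp k _ _ _
        (incl U G P.toSigmaModule (Σ i, e i) ⟨x.1, x.2 ∘ Sigma.fst⟩)).compMultilinearMap
          (actSigned A G e x.2))

end RightAction

/-- For maps `β : G(m) ⟶ (U ⊗ (K ∘ P))(m)` of degree `-1`, the morphism
`∂_β : U ⊗ (K ∘ P) ⟶ U ⊗ (K ∘ P)` of left `U`-modules in right `P`-modules that `β` induces on the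
free object `U ⊗ (K ∘ P)`: `∂_β (u ⊗ g ⊗ s) = (-1)^|u| u · β(g)(s)`. -/
noncomputable def induced (β : ∀ m : ℕ, G m →ₗ[k] FreeObj U G P.toSigmaModule (Fin m))
    (e : Type) [Finite e] :
    FreeObj U G P.toSigmaModule e →ₗ[k] FreeObj U G P.toSigmaModule e :=
  desc U G P.toSigmaModule e (fun x =>
    map U G P.toSigmaModule (fiberDecomp x.2) ∘ₗ
      TensorProduct.lift
        ((mulₗ A G {y : e // x.2 y = 0} (Σ j : Fin x.1, {y : e // x.2 y = j.succ}) ∘ₗ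
            (U.obj {y : e // x.2 y = 0}).invol).compl₂
          (TensorProduct.lift
            ((PiTensorProduct.lift (act A G (fun j : Fin x.1 => {y : e // x.2 y = j.succ}))).flip ∘ₗ
              β x.1))))

/-- `β` is a twisting cochain: it is homogeneous of degree `-1`, and the sum of the differential of
`U ⊗ (K ∘ P)` and of `∂_β` has square zero. -/
def IsTwistingCochain (β : ∀ m : ℕ, G m →ₗ[k] FreeObj U G P.toSigmaModule (Fin m)) : Prop :=
  (∀ (m : ℕ) (n : ℤ) (g : G m), g ∈ (G m).grading n →
    β m g ∈ grading U G P.toSigmaModule (Fin m) (n - 1)) ∧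
  ∀ (e : Type) [Finite e],
    (d U G P.toSigmaModule e + induced A G β e) ∘ₗ (d U G P.toSigmaModule e + induced A G β e) = 0

end FreeObj

end OperadLifting

open OperadLifting

namespace OperadLifting

/-! ### Signs -/

/-! Since $K=G\otimes\Sigma_*$ is free, $U\otimes(K\circ\mathcal P)$ is a sum of modules $U\otimes
G(m)\otimes\mathcal P^{\otimes m}$. Thus $\iota$ and $\nu$, although neither equivariant nor
multiplicative, still act: $\iota$ factor by factor, and $\nu$ through the tensor homotopy $\sum_j
\pm\,\pi^{\otimes(j-1)}\otimes\nu\otimes\mathrm{id}$ with $\pi=\iota\psi$. The resulting homotopy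
$H$ satisfies $dH+Hd=\mathrm{id}-\pi$ and $\psi H=0$ (`d_homotopy_add`, `mapRight_homotopy`).

The lift is the solution of the fixed point equation $\alpha=\iota\beta-H\,\partial_\alpha\alpha$.
It exists because of the filtration by the degree of the generator in $G$. As $U$ and $\mathcal S$
are nonnegative, $\beta$ lowers this degree by at least one, and so does $\iota\beta$; $H$ does not
raise it, so $H\partial_\alpha\alpha$ lowers it by at least two. As $G$ is nonnegative, the iterates
stabilise on each degree (`exists_eq_sub_homotopy`). Negative degrees of $\mathcal R$ do no harm.
Applying $\psi$ to the equation gives $\psi\alpha=\beta$.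

Consider the curvature $\omega=d\alpha+\alpha d+\partial_\alpha\alpha$. The equation for $\alpha$,
the homotopy formula, $d\beta+\beta d=0$ and $\psi\partial_\alpha\alpha=\partial_\beta\beta=0$ give
$\omega=H(d\,\partial_\alpha\alpha-\partial_\alpha\alpha\,d)$. Write $\hat\omega$ for the unsigned
extension of $\omega$ to the free module, so that $\hat\omega=(d+\partial_\alpha)^2$. Then
$\omega=H(\hat\omega\alpha-\partial_\alpha\omega)$ (`curvature_eq_homotopy`). Each use of this
identity improves the filtration level of $\omega$ by one, hence $\omega=0$
(`eq_zero_of_eq_homotopy`).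

All this relies on $\partial_f$ being a morphism of left $U$-modules in right $\mathcal P$-modules
and on $d$ being a derivation for both actions (`induced_mul`, `induced_act`, `d_mul`, `d_act`):
then $\partial_f^2$ and $d\partial_f+\partial_f d$ are determined by their values on $G$
(`induced_induced`, `d_induced_add`). The long part of the work is the Koszul sign of the right
action; its coherence is the identity modulo two in `core_exp`. -/

/-- Sign comparisons are moved to `ZMod 2`, where they become polynomial identities in the degrees.
-/
theorem negOnePow_eq_of_cast_eq {a b : ℤ} (h : (a : ZMod 2) = b) : a.negOnePow = b.negOnePow := by
  rw [Int.negOnePow_eq_iff, even_iff_two_dvd]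
  exact_mod_cast (ZMod.intCast_zmod_eq_zero_iff_dvd (a - b) 2).1 (by rw [Int.cast_sub, h, sub_self])

theorem multilinear_units_smul {k : Type*} [CommRing k] {ι : Type*} [Fintype ι]
    {X : ι → Type*} [∀ i, AddCommGroup (X i)] [∀ i, Module k (X i)] {N : Type*} [AddCommGroup N]
    [Module k N] (f : MultilinearMap k X N) (ε : ι → ℤˣ) (x : ∀ i, X i) :
    f (fun i => ε i • x i) = (∏ i, ε i) • f x := by
  have h' : (fun i => ε i • x i) = fun i => (((ε i : ℤˣ) : ℤ) : k) • x i := by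
    funext i
    rw [Units.smul_def, Int.cast_smul_eq_zsmul]
  rw [h', f.map_smul_univ, Units.smul_def, ← Int.cast_smul_eq_zsmul k, Units.coe_prod, Int.cast_prod]

/-! ### Reduction to homogeneous elements, and the degree involution -/

namespace DGModule

variable {k : Type u} [CommRing k]

theorem hom_ext {M : DGModule.{u, v} k} {N : Type*} [AddCommGroup N] [Module k N]
    {f g : M →ₗ[k] N} (h : ∀ n x, x ∈ M.grading n → f x = g x) : f = g := by
  ext x
  induction x using DirectSum.Decomposition.inductionOn M.grading with
  | zero => simp
  | homogeneous y => exact h _ _ y.2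
  | add a b ha hb => rw [map_add, map_add, ha, hb]

theorem multilinear_ext {ι : Type*} [Finite ι] {X : ι → DGModule.{u, v} k} {N : Type*}
    [AddCommGroup N] [Module k N] {f g : MultilinearMap k (fun i => X i) N}
    (h : ∀ (n : ι → ℤ) (x : ∀ i, X i), (∀ i, x i ∈ (X i).grading (n i)) → f x = g x) : f = g := by
  classical
  have := Fintype.ofFinite ι
  ext x
  have hx : x = fun i => ∑ n ∈ (DirectSum.decompose (X i).grading (x i)).support,
      ((DirectSum.decompose (X i).grading (x i) n : (X i).grading n) : X i) :=
    funext fun i => (DirectSum.sum_support_decompose (X i).grading (x i)).symm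
  rw [hx, f.map_sum_finset, g.map_sum_finset]
  exact Finset.sum_congr rfl fun r _ => h r _ fun i => SetLike.coe_mem _

theorem invol_of_mem {M : DGModule.{u, v} k} {n : ℤ} {x : M} (hx : x ∈ M.grading n) :
    M.invol x = (n.negOnePow : ℤˣ) • x := by
  lift x to M.grading n using hx
  simp [invol]

theorem parityPart_of_mem {M : DGModule.{u, v} k} {n : ℤ} {x : M} (hx : x ∈ M.grading n)
    (a : Fin 2) : M.parityPart a x = if n % 2 = ((a : ℕ) : ℤ) then x else 0 := by
  lift x to M.grading n using hx
  simp only [parityPart, DirectSum.decomposeLinearEquiv_apply, LinearMap.comp_apply,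
    LinearEquiv.coe_coe, DirectSum.decompose_coe, ← DirectSum.lof_eq_of k, DirectSum.toModule_lof]
  split_ifs <;> simp

theorem invol_mem {M : DGModule.{u, v} k} {n : ℤ} {x : M} (hx : x ∈ M.grading n) :
    M.invol x ∈ M.grading n := by
  rw [invol_of_mem hx, Units.smul_def]
  exact zsmul_mem hx _

theorem invol_invol {M : DGModule.{u, v} k} : M.invol ∘ₗ M.invol = LinearMap.id :=
  hom_ext fun n x hx => by
    rw [LinearMap.comp_apply, invol_of_mem hx, LinearMap.map_smul_of_tower, invol_of_mem hx,
      smul_smul, ← Int.negOnePow_add, Int.negOnePow_even _ ⟨n, rfl⟩, one_smul]; rfl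

theorem invol_comm {M N : DGModule.{u, v} k} (f : M →ₗ[k] N)
    (hf : ∀ n x, x ∈ M.grading n → f x ∈ N.grading n) : N.invol ∘ₗ f = f ∘ₗ M.invol :=
  hom_ext fun n x hx => by
    simp only [LinearMap.comp_apply]
    rw [invol_of_mem hx, invol_of_mem (hf n x hx), LinearMap.map_smul_of_tower]

/-- Every Koszul sign in the tensor computations comes from this: it is applied with $c=-1$ to
differentials and with $c=1$ to $\nu$. -/
theorem invol_anticomm {M N : DGModule.{u, v} k} (f : M →ₗ[k] N) (c : ℤ) (hc : Odd c)
    (hf : ∀ n x, x ∈ M.grading n → f x ∈ N.grading (n + c)) :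
    N.invol ∘ₗ f = - (f ∘ₗ M.invol) :=
  hom_ext fun n x hx => by
    simp only [LinearMap.comp_apply, LinearMap.neg_apply]
    rw [invol_of_mem hx, invol_of_mem (hf n x hx), LinearMap.map_smul_of_tower,
      Int.negOnePow_add, Int.negOnePow_odd c hc]
    simp

end DGModule

end OperadLifting

namespace OperadLifting

variable {k : Type u} [CommRing k]

/-! ### Axioms for composition, relabelled -/

/-- An order preserving relabelling has no inversions, so transport along it costs no sign. -/
theorem shuffleExp_of_strictMono {l L : Type} [Fintype l] [LinearOrder l] [Fintype L]
    [LinearOrder L] {h : L → l} (hh : StrictMono h) (q : L → ℤ) : shuffleExp h 0 q = 0 := by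
  unfold shuffleExp
  simp only [Pi.zero_apply, zero_mul, ite_self, Finset.sum_const_zero, add_zero]
  refine Finset.sum_eq_zero fun x _ => Finset.sum_eq_zero fun y _ => if_neg fun ⟨h1, h2⟩ => ?_
  exact lt_asymm h2 (hh h1)

theorem SigmaModule.map_map (M : SigmaModule.{u, v} k) {e e' e'' : Type} [Finite e] [Finite e']
    [Finite e''] (σ : e ≃ e') (τ : e' ≃ e'') (x : M.obj e) :
    M.map τ (M.map σ x) = M.map (σ.trans τ) x := (M.map_trans σ τ x).symm

theorem SigmaModule.map_congr (M : SigmaModule.{u, v} k) {e e' : Type} [Finite e] [Finite e']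
    {σ τ : e ≃ e'} (h : ∀ y, σ y = τ y) (x : M.obj e) : M.map σ x = M.map τ x := by
  rw [Equiv.ext h]

/-- Reassociation `⊔_i ⊔_{x ∈ a_i} E_{φ(i,x)} = ⊔_y E_y` along a bijection `φ : ⊔_i a_i ≃ L`. -/
def sigmaSigmaEquiv {l L : Type} {a : l → Type} (φ : (Σ i, a i) ≃ L) (E : L → Type) :
    (Σ i, Σ x : a i, E (φ ⟨i, x⟩)) ≃ Σ y, E y :=
  (Equiv.sigmaAssoc fun i x => E (φ ⟨i, x⟩)).symm.trans (Equiv.sigmaCongrLeft (β := E) φ)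

/-- The decomposition of `⊔_y E_y` along a bijection `ρ : c ⊔ e ≃ L`. -/
def sumSigmaEquiv {c e L : Type} (ρ : c ⊕ e ≃ L) (E : L → Type) :
    (Σ i : c, E (ρ (.inl i))) ⊕ (Σ i : e, E (ρ (.inr i))) ≃ Σ y, E y :=
  (Equiv.sumSigmaDistrib fun i => E (ρ i)).symm.trans (Equiv.sigmaCongrLeft (β := E) ρ)

namespace IsRightComp

variable {M P : SigmaModule.{u, v} k} {compM : CompData M P} {compP : CompData P P}

theorem map_comp_of_strictMono (H : IsRightComp compM compP) {l l' : Type} [Fintype l]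
    [LinearOrder l] [Fintype l'] [LinearOrder l'] (σ : l ≃ l') (hσ : StrictMono σ)
    (e : l' → Type) [∀ i, Finite (e i)] (q : l' → ℤ) (a : M.obj l) (b : ∀ i, P.obj (e i))
    (hb : ∀ i, b i ∈ (P.obj (e i)).grading (q i)) :
    compM l' e b (M.map σ a) =
      M.map (Equiv.sigmaCongrLeft σ) (compM l (fun i => e (σ i)) (fun i => b (σ i)) a) := by
  rw [H.map_comp l l' σ e q a b hb, shuffleExp_of_strictMono hσ, Int.negOnePow_zero, one_smul]

/-- The associativity axiom speaks of the fibres of a map $L\to l$; here arbitrary ordered families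
$a_i$ are transported to such fibres. Monotonicity of $\varphi$ on each $a_i$ ensures that the only
sign is the one of the axiom. -/
theorem assoc_of_equiv (H : IsRightComp compM compP) (HP : IsRightComp compP compP) {l L : Type}
    [Fintype l] [LinearOrder l] [Fintype L] [LinearOrder L] {a : l → Type} [∀ i, Fintype (a i)]
    [∀ i, LinearOrder (a i)] (φ : (Σ i, a i) ≃ L) (hφ : ∀ i, StrictMono fun x => φ ⟨i, x⟩)
    (E : L → Type) [∀ y, Finite (E y)] (p : l → ℤ) (q : L → ℤ) (x : M.obj l)
    (b : ∀ i, P.obj (a i)) (c : ∀ y, P.obj (E y)) (hb : ∀ i, b i ∈ (P.obj (a i)).grading (p i))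
    (hc : ∀ y, c y ∈ (P.obj (E y)).grading (q y)) :
    compM L E c (M.map φ (compM l a b x)) =
      ((shuffleExp (fun y => (φ.symm y).1) p q).negOnePow : ℤˣ) •
        M.map (sigmaSigmaEquiv φ E) (compM l (fun i => Σ x : a i, E (φ ⟨i, x⟩))
          (fun i => compP (a i) (fun x => E (φ ⟨i, x⟩)) (fun x => c (φ ⟨i, x⟩)) (b i)) x) := by
  classical
  -- The map whose fibre over $i$ is the image of $a_i$.
  set h : L → l := fun y => (φ.symm y).1 with hh
  let f : ∀ i, a i → {y // h y = i} := fun i x => ⟨φ ⟨i, x⟩, by simp [hh]⟩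
  have hf : ∀ i, Function.Bijective (f i) := by
    intro i
    constructor
    · intro x y hxy
      exact (hφ i).injective (congrArg Subtype.val hxy)
    · rintro ⟨y, rfl⟩
      exact ⟨(φ.symm y).2, Subtype.ext (φ.apply_symm_apply y)⟩
  let τ : ∀ i, a i ≃ {y // h y = i} := fun i => Equiv.ofBijective (f i) (hf i)
  have hτ : ∀ i, StrictMono (τ i) := fun i x y hxy => hφ i hxy
  have e1 : M.map φ (compM l a b x) = M.map (Equiv.sigmaFiberEquiv h)
      (compM l (fun i => {y // h y = i}) (fun i => P.map (τ i) (b i)) x) := by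
    rw [H.comp_map, M.map_map]
    refine M.map_congr ?_ _
    rintro ⟨i, y⟩
    rfl
  rw [e1, H.assoc l L h E p q x _ c (fun i => P.map_mem _ _ _ (hb i)) hc]
  congr 1
  let τ' : ∀ i, (Σ x : a i, E (φ ⟨i, x⟩)) ≃ Σ x : {y // h y = i}, E x.1 := fun i =>
    Equiv.sigmaCongrLeft (β := fun x : {y // h y = i} => E x.1) (τ i)
  have e2 : (fun i => compP {y // h y = i} (fun x => E x.1) (fun x => c x.1) (P.map (τ i) (b i))) =
      fun i => P.map (τ' i)
        (compP (a i) (fun x => E (φ ⟨i, x⟩)) (fun x => c (φ ⟨i, x⟩)) (b i)) := by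
    funext i
    exact HP.map_comp_of_strictMono (τ i) (hτ i) (fun x : {y // h y = i} => E x.1)
      (fun x => q x.1) (b i) (fun x => c x.1) (fun x => hc x.1)
  rw [e2, H.comp_map, M.map_map]
  refine M.map_congr ?_ _
  rintro ⟨i, x, y⟩
  rfl

end IsRightComp

/-- Same transport as in `IsRightComp.assoc_of_equiv`, for the axiom `mul_comp`: the two summands
become the fibres of the colouring `isRight`. -/
theorem RightModuleAlgebra.mul_comp_of_equiv {P : Operad.{u, v} k} {U : SigmaModule.{u, v} k}
    (A : RightModuleAlgebra P U) {c e L : Type} [Fintype c] [LinearOrder c] [Fintype e]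
    [LinearOrder e] [Fintype L] [LinearOrder L] (ρ : c ⊕ e ≃ L)
    (hc : StrictMono fun x => ρ (.inl x)) (he : StrictMono fun x => ρ (.inr x))
    (E : L → Type) [∀ y, Finite (E y)] (r r' : ℤ) (q : L → ℤ) (x : U.obj c) (y : U.obj e)
    (s : ∀ y, P.obj (E y)) (hx : x ∈ (U.obj c).grading r) (hy : y ∈ (U.obj e).grading r')
    (hs : ∀ y, s y ∈ (P.obj (E y)).grading (q y)) :
    A.comp L E s (U.map ρ (A.mul c e x y)) =
      ((shuffleExp (fun i => (ρ.symm i).isRight) (fun z => cond z r' r) q).negOnePow : ℤˣ) •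
        U.map (sumSigmaEquiv ρ E)
          (A.mul (Σ i : c, E (ρ (.inl i))) (Σ i : e, E (ρ (.inr i)))
            (A.comp c (fun i => E (ρ (.inl i))) (fun i => s (ρ (.inl i))) x)
            (A.comp e (fun i => E (ρ (.inr i))) (fun i => s (ρ (.inr i))) y)) := by
  classical
  set h : L → Bool := fun i => (ρ.symm i).isRight with hh
  let f : c → {y // h y = false} := fun x => ⟨ρ (.inl x), by simp [hh]⟩
  let g : e → {y // h y = true} := fun x => ⟨ρ (.inr x), by simp [hh]⟩
  have hf : Function.Bijective f := by
    constructor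
    · intro x y hxy
      exact hc.injective (congrArg Subtype.val hxy)
    · rintro ⟨y, hy⟩
      obtain ⟨z | z, rfl⟩ := ρ.surjective y
      · exact ⟨z, rfl⟩
      · simp [hh] at hy
  have hg : Function.Bijective g := by
    constructor
    · intro x y hxy
      exact he.injective (congrArg Subtype.val hxy)
    · rintro ⟨y, hy⟩
      obtain ⟨z | z, rfl⟩ := ρ.surjective y
      · simp [hh] at hy
      · exact ⟨z, rfl⟩
  let τ := Equiv.ofBijective f hf
  let τ' := Equiv.ofBijective g hg
  have hτ : StrictMono τ := fun x y hxy => hc hxy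
  have hτ' : StrictMono τ' := fun x y hxy => he hxy
  have e1 : U.map ρ (A.mul c e x y) = U.map (boolFiber h)
      (A.mul {y // h y = false} {y // h y = true} (U.map τ x) (U.map τ' y)) := by
    rw [A.mul_map, U.map_map]
    exact U.map_congr (by rintro (z | z) <;> rfl) _
  rw [e1, A.mul_comp L h E (fun z => cond z r' r) q _ _ s (U.map_mem _ _ _ hx)
    (U.map_mem _ _ _ hy) hs,
    A.isRightComp.map_comp_of_strictMono τ hτ (fun x : {y // h y = false} => E x.1)
      (fun x => q x.1) x (fun x => s x.1) (fun x => hs x.1),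
    A.isRightComp.map_comp_of_strictMono τ' hτ' (fun x : {y // h y = true} => E x.1)
      (fun x => q x.1) y (fun x => s x.1) (fun x => hs x.1), A.mul_map, U.map_map]
  congr 1
  exact U.map_congr (by rintro (z | z) <;> rfl) _

end OperadLifting

/-! ### Decomposable elements and the structure maps evaluated on them -/

namespace OperadLifting

variable {k : Type u} [CommRing k]

theorem negOnePow_sum {ι : Type*} (s : Finset ι) (f : ι → ℤ) :
    (∑ i ∈ s, f i).negOnePow = ∏ i ∈ s, (f i).negOnePow := by
  classical
  induction s using Finset.induction_on with
  | empty => simp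
  | insert a s ha ih => rw [Finset.sum_insert ha, Finset.prod_insert ha, Int.negOnePow_add, ih]

theorem units_smul_tmul {M N : Type*} [AddCommGroup M] [AddCommGroup N] [Module k M] [Module k N]
    (ε : ℤˣ) (x : M) (y : N) : (ε • x) ⊗ₜ[k] y = ε • (x ⊗ₜ[k] y) :=
  ((TensorProduct.mk k M N).flip y).map_smul_of_tower ε x

theorem tmul_units_smul {M N : Type*} [AddCommGroup M] [AddCommGroup N] [Module k M] [Module k N]
    (ε : ℤˣ) (x : M) (y : N) : x ⊗ₜ[k] (ε • y) = ε • (x ⊗ₜ[k] y) :=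
  (TensorProduct.mk k M N x).map_smul_of_tower ε y

/-- The involutions in the slots before $j$ become scalars on homogeneous factors, and their product
is the usual sign. -/
theorem DGModule.tensorD_tprod {n : ℕ} {M : Fin n → DGModule.{u, v} k} {τ : Fin n → ℤ}
    {t : ∀ j, M j} (ht : ∀ j, t j ∈ (M j).grading (τ j)) :
    DGModule.tensorD M (PiTensorProduct.tprod k t) =
      ∑ j, ((∑ i, if i < j then τ i else 0).negOnePow : ℤˣ) •
        PiTensorProduct.tprod k (Function.update t j ((M j).d (t j))) := by
  unfold DGModule.tensorD
  rw [LinearMap.sum_apply]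
  refine Finset.sum_congr rfl fun j _ => ?_
  rw [PiTensorProduct.map_tprod, negOnePow_sum, ← multilinear_units_smul]
  congr 1
  funext i
  rcases lt_trichotomy i j with h | rfl | h
  · simp [h, h.ne, DGModule.invol_of_mem (ht i)]
  · simp
  · simp [h.not_gt, h.ne']

namespace FreeObj

section Gen

variable {U : SigmaModule.{u, v} k} {G : ℕ → DGModule.{u, v} k} {P : SigmaModule.{u, v} k}
variable {e : Type} [Finite e] {m : ℕ}

/-- The element `u ⊗ g ⊗ t_1 ⊗ ⋯ ⊗ t_m` of `U ⊗ (K ∘ P)`. -/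
noncomputable def gen (h : e → Fin (m + 1)) (u : U.obj {y : e // h y = 0}) (g : G m)
    (t : ∀ j : Fin m, P.obj {y : e // h y = j.succ}) : FreeObj U G P e :=
  incl U G P e ⟨m, h⟩ (u ⊗ₜ (g ⊗ₜ PiTensorProduct.tprod k t))

theorem desc_incl {N : Type*} [AddCommGroup N] [Module k N]
    (φ : ∀ x : (Σ m : ℕ, (e → Fin (m + 1))), Summand U G P e x →ₗ[k] N)
    (x : Σ m : ℕ, (e → Fin (m + 1))) (y : Summand U G P e x) :
    desc U G P e φ (incl U G P e x y) = φ x y := by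
  classical
  exact DirectSum.toModule_lof k x y

theorem lmap_incl {P' : SigmaModule.{u, v} k}
    (φ : ∀ x : (Σ m : ℕ, (e → Fin (m + 1))), Summand U G P e x →ₗ[k] Summand U G P' e x)
    (x : Σ m : ℕ, (e → Fin (m + 1))) (y : Summand U G P e x) :
    DirectSum.lmap φ (incl U G P e x y) = incl U G P' e x (φ x y) := by
  classical
  exact DirectSum.lmap_lof φ x y

/-- Homogeneous decomposables span, so identities of linear maps need only be checked where degrees,
hence signs, are explicit. Nearly all structural identities below are proved this way. -/
theorem hom_ext {N : Type*} [AddCommGroup N] [Module k N] {f f' : FreeObj U G P e →ₗ[k] N}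
    (H : ∀ (m : ℕ) (h : e → Fin (m + 1)) (p q : ℤ) (r : Fin m → ℤ)
      (u : U.obj {y : e // h y = 0}) (g : G m) (t : ∀ j : Fin m, P.obj {y : e // h y = j.succ}),
      u ∈ (U.obj {y : e // h y = 0}).grading p → g ∈ (G m).grading q →
      (∀ j, t j ∈ (P.obj {y : e // h y = j.succ}).grading (r j)) →
      f (gen h u g t) = f' (gen h u g t)) : f = f' := by
  classical
  refine DirectSum.linearMap_ext k fun x => ?_
  obtain ⟨m, h⟩ := x
  refine TensorProduct.ext (DGModule.hom_ext fun p u hu => ?_)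
  refine TensorProduct.ext (DGModule.hom_ext fun q g hg => ?_)
  refine PiTensorProduct.ext (DGModule.multilinear_ext fun r t ht => ?_)
  exact H m h p q r u g t hu hg ht

/-- Equal labellings that are not definitionally equal put the factors into different types.
Comparing along the bijections that fix every point replaces casts by the functoriality of `U` and
`P`. -/
theorem gen_congr {h h' : e → Fin (m + 1)} (hh : h = h') {u : U.obj {y : e // h y = 0}}
    {u' : U.obj {y : e // h' y = 0}} {g : G m} {t : ∀ j : Fin m, P.obj {y : e // h y = j.succ}}
    {t' : ∀ j : Fin m, P.obj {y : e // h' y = j.succ}}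
    (hu : U.map (Equiv.subtypeEquivRight fun y => by rw [hh]) u = u')
    (ht : ∀ j, P.map (Equiv.subtypeEquivRight fun y => by rw [hh]) (t j) = t' j) :
    (gen h u g t : FreeObj U G P e) = gen h' u' g t' := by
  subst hh
  have e1 : u = u' := by
    rw [← hu]
    exact (U.map_refl _ u).symm
  have e2 : t = t' := funext fun j => by
    rw [← ht]
    exact (P.map_refl _ _).symm
  rw [e1, e2]

theorem gen_mem {h : e → Fin (m + 1)} {u : U.obj {y : e // h y = 0}} {g : G m}
    {t : ∀ j : Fin m, P.obj {y : e // h y = j.succ}} {p q : ℤ} {r : Fin m → ℤ}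
    (hu : u ∈ (U.obj {y : e // h y = 0}).grading p) (hg : g ∈ (G m).grading q)
    (ht : ∀ j, t j ∈ (P.obj {y : e // h y = j.succ}).grading (r j)) :
    gen h u g t ∈ grading U G P e (p + q + ∑ j, r j) :=
  Submodule.subset_span ⟨m, h, p, q, r, u, g, t, hu, hg, ht, rfl, rfl⟩

variable (h : e → Fin (m + 1)) (u u' : U.obj {y : e // h y = 0}) (g g' : G m)
  (t : ∀ j : Fin m, P.obj {y : e // h y = j.succ})

theorem gen_smul_left (ε : ℤˣ) : (gen h (ε • u) g t : FreeObj U G P e) = ε • gen h u g t := by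
  unfold gen
  rw [units_smul_tmul, LinearMap.map_smul_of_tower]

theorem gen_add_left : (gen h (u + u') g t : FreeObj U G P e) = gen h u g t + gen h u' g t := by
  unfold gen
  rw [TensorProduct.add_tmul, map_add]

theorem gen_sum_left {ι : Type*} (s : Finset ι) (f : ι → U.obj {y : e // h y = 0}) :
    (gen h (∑ i ∈ s, f i) g t : FreeObj U G P e) = ∑ i ∈ s, gen h (f i) g t := by
  unfold gen
  rw [TensorProduct.sum_tmul, map_sum]

theorem gen_smul_right (ε : Fin m → ℤˣ) :
    (gen h u g (fun j => ε j • t j) : FreeObj U G P e) = (∏ j, ε j) • gen h u g t := by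
  unfold gen
  rw [multilinear_units_smul, tmul_units_smul, tmul_units_smul,
    LinearMap.map_smul_of_tower]

theorem gen_update_smul (j : Fin m) (ε : ℤˣ) (x : P.obj {y : e // h y = j.succ}) :
    (gen h u g (Function.update t j (ε • x)) : FreeObj U G P e) =
      ε • gen h u g (Function.update t j x) := by
  exact LinearMap.map_smul_of_tower (incl U G P e ⟨m, h⟩ ∘ₗ TensorProduct.mk k _ _ u ∘ₗ
    TensorProduct.mk k _ _ g ∘ₗ (PiTensorProduct.tprod k).toLinearMap t j) ε x

theorem gen_update_add (j : Fin m) (x x' : P.obj {y : e // h y = j.succ}) :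
    (gen h u g (Function.update t j (x + x')) : FreeObj U G P e) =
      gen h u g (Function.update t j x) + gen h u g (Function.update t j x') := by
  unfold gen
  rw [MultilinearMap.map_update_add, TensorProduct.tmul_add, TensorProduct.tmul_add, map_add]

theorem gen_update_sum {ι : Type*} (s : Finset ι) (j : Fin m)
    (f : ι → P.obj {y : e // h y = j.succ}) :
    (gen h u g (Function.update t j (∑ i ∈ s, f i)) : FreeObj U G P e) =
      ∑ i ∈ s, gen h u g (Function.update t j (f i)) := by
  unfold gen
  rw [MultilinearMap.map_update_sum, TensorProduct.tmul_sum, TensorProduct.tmul_sum, map_sum]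

variable {h u g t}

theorem d_gen {p q : ℤ} {r : Fin m → ℤ}
    (hu : u ∈ (U.obj {y : e // h y = 0}).grading p) (hg : g ∈ (G m).grading q)
    (ht : ∀ j, t j ∈ (P.obj {y : e // h y = j.succ}).grading (r j)) :
    d U G P e (gen h u g t) = gen h ((U.obj _).d u) g t +
      ((p.negOnePow : ℤˣ) • gen h u ((G m).d g) t +
        ∑ j, ((p + q + ∑ i, if i < j then r i else 0).negOnePow : ℤˣ) •
          gen h u g (Function.update t j ((P.obj _).d (t j)))) := by
  unfold d gen
  rw [lmap_incl]
  simp only [LinearMap.add_apply, TensorProduct.map_tmul, LinearMap.id_apply,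
    DGModule.invol_of_mem hu, DGModule.invol_of_mem hg, DGModule.tensorD_tprod ht, map_add,
    TensorProduct.tmul_add, TensorProduct.tmul_sum, map_sum, tmul_units_smul,
    units_smul_tmul, LinearMap.map_smul_of_tower, smul_smul, Int.negOnePow_add,
    mul_assoc, mul_comm]

theorem map_gen {e' : Type} [Finite e'] (σ : e ≃ e') :
    map U G P σ (gen h u g t) = gen (h ∘ σ.symm) (U.map (fiberRelabel σ h 0) u) g
      (fun j => P.map (fiberRelabel σ h j.succ) (t j)) := by
  unfold map gen
  rw [desc_incl]
  simp [PiTensorProduct.map_tprod]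

theorem mapRight_gen {Q : SigmaModule.{u, v} k}
    (ψ : (e : Type) → [Finite e] → (P.obj e →ₗ[k] Q.obj e)) :
    mapRight U G ψ e (gen h u g t) = gen h u g (fun j => ψ _ (t j)) := by
  unfold mapRight gen
  rw [lmap_incl]
  simp [PiTensorProduct.map_tprod]

end Gen

section Alg

variable {P : Operad.{u, v} k} {U : SigmaModule.{u, v} k}
variable (A : RightModuleAlgebra P U) (G : ℕ → DGModule.{u, v} k)
variable {e : Type} [Finite e] {m : ℕ} {h : e → Fin (m + 1)} {u : U.obj {y : e // h y = 0}}
  {g : G m} {t : ∀ j : Fin m, P.obj {y : e // h y = j.succ}}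

theorem mul_gen {c : Type} [Finite c] (v : U.obj c) :
    mul A G c e v (gen h u g t) =
      gen (Sum.elim (fun _ => 0) h) (U.map (fiberSumZero c h) (A.mul c _ v u)) g
        (fun j => P.map (fiberSumSucc c h j) (t j)) := by
  unfold mul gen
  rw [desc_incl]
  simp [PiTensorProduct.map_tprod]

theorem induced_gen (f : ∀ m : ℕ, G m →ₗ[k] FreeObj U G P.toSigmaModule (Fin m)) :
    induced A G f e (gen h u g t) = map U G P.toSigmaModule (fiberDecomp h)
      (mul A G _ _ ((U.obj _).invol u) (act A G (fun j : Fin m => {y : e // h y = j.succ}) t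
        (f m g))) := by
  unfold induced gen
  rw [desc_incl]
  simp [mulₗ]

end Alg

section Act

variable {P : Operad.{u, v} k} {U : SigmaModule.{u, v} k}
variable (A : RightModuleAlgebra P U) (G : ℕ → DGModule.{u, v} k)
variable {L : Type} [Fintype L] [LinearOrder L] (E : L → Type) [∀ i, Finite (E i)]
variable {m : ℕ} {h : L → Fin (m + 1)} {u : U.obj {y : L // h y = 0}}
  {g : G m} {t : ∀ j : Fin m, P.obj {y : L // h y = j.succ}}

/-- The exponent of the sign of the right action on `u ⊗ g ⊗ t_1 ⊗ ⋯ ⊗ t_m`. -/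
def actExp (h : L → Fin (m + 1)) (γ : ℤ) (τ : Fin m → ℤ) (q : L → ℤ) : ℤ :=
  shuffleExp h (Fin.cons 0 τ) q + ∑ i : L, if h i = 0 then γ * q i else 0

/-- Links the sign in `actSigned`, which is computed from parities in `Fin 2`, with the sign
computed from integer degrees. -/
theorem actExp_congr (h : L → Fin (m + 1)) {γ γ' : ℤ} {τ τ' : Fin m → ℤ} {q q' : L → ℤ}
    (hγ : (γ : ZMod 2) = γ') (hτ : ∀ j, (τ j : ZMod 2) = τ' j) (hq : ∀ i, (q i : ZMod 2) = q' i) :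
    (actExp h γ τ q).negOnePow = (actExp h γ' τ' q').negOnePow := by
  apply negOnePow_eq_of_cast_eq
  have hc : ∀ i, ((Fin.cons 0 τ : Fin (m + 1) → ℤ) i : ZMod 2) =
      ((Fin.cons 0 τ' : Fin (m + 1) → ℤ) i : ZMod 2) := by
    intro i
    refine Fin.cases ?_ (fun j => ?_) i
    · simp
    · simpa using hτ j
  unfold actExp shuffleExp
  push_cast [apply_ite (Int.cast : ℤ → ZMod 2)]
  simp only [hγ, hc, hq]

theorem act_incl (s : ∀ i, P.obj (E i)) (x : Σ m : ℕ, (L → Fin (m + 1)))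
    (y : Summand U G P.toSigmaModule L x) :
    act A G E s (incl U G P.toSigmaModule L x y) =
      incl U G P.toSigmaModule (Σ i, E i) ⟨x.1, x.2 ∘ Sigma.fst⟩ (actSigned A G E x.2 s y) := by
  classical
  have h1 : incl U G P.toSigmaModule L x y = DFinsupp.single x y := by
    unfold incl
    rw [← DirectSum.single_eq_lof]
    congr!
  rw [h1]
  unfold act
  simp only [LinearMap.compMultilinearMap_apply, LinearEquiv.coe_coe]
  rw [DFinsupp.lsum_single]
  rfl

theorem actUnsigned_apply {m : ℕ} (h : L → Fin (m + 1)) (s : ∀ i, P.obj (E i)) :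
    actUnsigned A G E h s = TensorProduct.map (actZero A E h s)
      (TensorProduct.map LinearMap.id (PiTensorProduct.map (actSucc E h s))) := rfl

/-- For homogeneous arguments exactly one choice of parities contributes to the sum in `actSigned`.
This gives the right action in closed form. -/
theorem act_gen {γ : ℤ} {τ : Fin m → ℤ} {q : L → ℤ} {s : ∀ i, P.obj (E i)}
    (hg : g ∈ (G m).grading γ)
    (ht : ∀ j, t j ∈ (P.obj {y : L // h y = j.succ}).grading (τ j))
    (hs : ∀ i, s i ∈ (P.obj (E i)).grading (q i)) :
    act A G E s (gen h u g t) = ((actExp h γ τ q).negOnePow : ℤˣ) •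
      gen (h ∘ Sigma.fst) (actZero A E h s u) g (fun j => actSucc E h s j (t j)) := by
  classical
  -- Each degree has a unique parity; $a_0,b_0,c_0$ below are those of $g$, $t$ and $s$.
  have two : ∀ n : ℤ, ∃ a : Fin 2, ∀ b : Fin 2, n % 2 = ((b : ℕ) : ℤ) ↔ b = a := by
    intro n
    rcases Int.emod_two_eq_zero_or_one n with hn | hn
    · exact ⟨0, fun b => by fin_cases b <;> simp [hn]⟩
    · exact ⟨1, fun b => by fin_cases b <;> simp [hn]⟩
  have cast : ∀ (n : ℤ) (a : Fin 2), n % 2 = ((a : ℕ) : ℤ) → (((a : ℕ) : ℤ) : ZMod 2) = n := by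
    intro n a hn
    rw [← hn]
    exact ZMod.intCast_mod n 2
  obtain ⟨a₀, ha₀⟩ := two γ
  choose b₀ hb₀ using fun j => two (τ j)
  choose c₀ hc₀ using fun i => two (q i)
  unfold gen
  rw [act_incl]
  have key : actSigned A G E h s (u ⊗ₜ (g ⊗ₜ PiTensorProduct.tprod k t)) =
      ((actExp h γ τ q).negOnePow : ℤˣ) • (actZero A E h s u ⊗ₜ (g ⊗ₜ
        PiTensorProduct.tprod k (fun j => actSucc E h s j (t j)))) := by
    unfold actSigned
    simp only [sum_apply, LinearMap.sum_apply]
    have ev : ∀ (a : Fin 2) (b : Fin m → Fin 2) (c : L → Fin 2), (((actExp h ((a : ℕ) : ℤ)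
        (fun j => ((b j : ℕ) : ℤ)) (fun i => ((c i : ℕ) : ℤ))).negOnePow : ℤˣ) •
      (LinearMap.lcomp k (Summand U G P.toSigmaModule (Σ i, E i) ⟨m, h ∘ Sigma.fst⟩)
        (TensorProduct.map LinearMap.id
          (TensorProduct.map ((G m).parityPart a)
            (PiTensorProduct.map (fun j => (P.obj {i : L // h i = j.succ}).parityPart (b j)))) :
          Summand U G P.toSigmaModule L ⟨m, h⟩ →ₗ[k]
            Summand U G P.toSigmaModule L ⟨m, h⟩)).compMultilinearMap
        ((actUnsigned A G E h).compLinearMap (fun i => (P.obj (E i)).parityPart (c i)))) s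
          (u ⊗ₜ (g ⊗ₜ PiTensorProduct.tprod k t)) =
        if a = a₀ ∧ b = b₀ ∧ c = c₀ then ((actExp h γ τ q).negOnePow : ℤˣ) •
          (actZero A E h s u ⊗ₜ (g ⊗ₜ
            PiTensorProduct.tprod k (fun j => actSucc E h s j (t j)))) else 0 := by
      intro a b c
      rw [smul_apply, LinearMap.smul_apply]
      simp only [LinearMap.compMultilinearMap_apply, LinearMap.lcomp_apply,
        MultilinearMap.compLinearMap_apply, TensorProduct.map_tmul, LinearMap.id_apply,
        PiTensorProduct.map_tprod, DGModule.parityPart_of_mem hg,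
        DGModule.parityPart_of_mem (ht _), DGModule.parityPart_of_mem (hs _)]
      split_ifs with h1 h2 h2
      · obtain ⟨-, rfl, rfl⟩ := h2
        simp only [(hb₀ _ _).2, (hc₀ _ _).2, if_true]
        rw [actExp_congr h (cast _ _ h1) (fun j => cast _ _ ((hb₀ j _).2 rfl))
          (fun i => cast _ _ ((hc₀ i _).2 rfl)), actUnsigned_apply]
        simp [PiTensorProduct.map_tprod]
      -- A wrong parity for one $t_j$ or one $s_i$ makes that argument zero, and a multilinear map
      -- vanishes there.
      · rw [not_and_or, not_and_or] at h2
        rcases h2 with h2 | h2 | h2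
        · exact absurd ((ha₀ a).1 h1) h2
        · obtain ⟨j, hj⟩ := Function.ne_iff.1 h2
          rw [(PiTensorProduct.tprod k).map_coord_zero j (if_neg fun h3 => hj ((hb₀ j _).1 h3))]
          simp
        · obtain ⟨i, hi⟩ := Function.ne_iff.1 h2
          rw [(actUnsigned A G E h).map_coord_zero i (if_neg fun h3 => hi ((hc₀ i _).1 h3))]
          simp
      · exact absurd ((ha₀ a).2 h2.1) h1
      · simp
    refine (Finset.sum_congr rfl fun a _ => Finset.sum_congr rfl fun b _ =>
      Finset.sum_congr rfl fun c _ => ev a b c).trans ?_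
    simp [ite_and]
  rw [key, LinearMap.map_smul_of_tower]

end Act

end FreeObj

end OperadLifting

/-! ### Equivariance, and compatibility with the left action of `U` -/

namespace OperadLifting

variable {k : Type u} [CommRing k]

namespace FreeObj

section Sigma

variable {U : SigmaModule.{u, v} k} {G : ℕ → DGModule.{u, v} k} {P : SigmaModule.{u, v} k}
variable {e e' e'' : Type} [Finite e] [Finite e'] [Finite e'']

theorem map_map (σ : e ≃ e') (τ : e' ≃ e'') (z : FreeObj U G P e) :
    map U G P τ (map U G P σ z) = map U G P (σ.trans τ) z := by
  rw [← LinearMap.comp_apply]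
  congr 1
  refine hom_ext fun m h p q r u g t hu hg ht => ?_
  rw [LinearMap.comp_apply, map_gen, map_gen, map_gen]
  refine gen_congr rfl ?_ fun j => ?_
  · rw [U.map_map, U.map_map]
    exact U.map_congr (fun _ => rfl) _
  · rw [P.map_map, P.map_map]
    exact P.map_congr (fun _ => rfl) _

theorem map_congr {σ τ : e ≃ e'} (h : ∀ y, σ y = τ y) (z : FreeObj U G P e) :
    map U G P σ z = map U G P τ z := by
  rw [Equiv.ext h]

theorem d_map (σ : e ≃ e') (z : FreeObj U G P e) :
    d U G P e' (map U G P σ z) = map U G P σ (d U G P e z) := by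
  rw [← LinearMap.comp_apply, ← LinearMap.comp_apply]
  congr 1
  refine hom_ext fun m h p q r u g t hu hg ht => ?_
  rw [LinearMap.comp_apply, LinearMap.comp_apply, map_gen, d_gen hu hg ht,
    d_gen (U.map_mem _ _ _ hu) hg (fun j => P.map_mem _ _ _ (ht j))]
  simp only [map_add, map_sum, LinearMap.map_smul_of_tower, map_gen, U.map_d]
  congr 2
  refine Finset.sum_congr rfl fun j _ => ?_
  congr 2
  funext i
  rw [← P.map_d]
  exact (Function.apply_update (fun i x => P.map (fiberRelabel σ h i.succ) x) t j _ i).symm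

end Sigma

section Alg

variable {P : Operad.{u, v} k} {U : SigmaModule.{u, v} k}
variable (A : RightModuleAlgebra P U) (G : ℕ → DGModule.{u, v} k)

theorem mul_units_smul {c e : Type} [Finite c] [Finite e] (ε : ℤˣ) (v : U.obj c)
    (z : FreeObj U G P.toSigmaModule e) : mul A G c e (ε • v) z = ε • mul A G c e v z :=
  ((mulₗ A G c e).flip z).map_smul_of_tower ε v

theorem induced_gen_of_mem (f : ∀ m : ℕ, G m →ₗ[k] FreeObj U G P.toSigmaModule (Fin m))
    {e : Type} [Finite e] {m : ℕ} {h : e → Fin (m + 1)} {p : ℤ} {u : U.obj {y : e // h y = 0}}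
    (hu : u ∈ (U.obj {y : e // h y = 0}).grading p) (g : G m)
    (t : ∀ j : Fin m, P.obj {y : e // h y = j.succ}) :
    induced A G f e (gen h u g t) = (p.negOnePow : ℤˣ) • map U G P.toSigmaModule (fiberDecomp h)
      (mul A G _ _ u (act A G (fun j : Fin m => {y : e // h y = j.succ}) t (f m g))) := by
  rw [induced_gen, DGModule.invol_of_mem hu, mul_units_smul, LinearMap.map_smul_of_tower]

theorem d_mul {c e : Type} [Finite c] [Finite e] {p : ℤ} {v : U.obj c}
    (hv : v ∈ (U.obj c).grading p) (z : FreeObj U G P.toSigmaModule e) :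
    d U G P.toSigmaModule (c ⊕ e) (mul A G c e v z) = mul A G c e ((U.obj c).d v) z +
      (p.negOnePow : ℤˣ) • mul A G c e v (d U G P.toSigmaModule e z) := by
  rw [← LinearMap.comp_apply, ← LinearMap.comp_apply, ← LinearMap.smul_apply,
    ← LinearMap.add_apply]
  congr 1
  refine hom_ext fun m h p' q r u g t hu hg ht => ?_
  rw [LinearMap.add_apply, LinearMap.smul_apply, LinearMap.comp_apply, LinearMap.comp_apply,
    mul_gen, d_gen hu hg ht,
    d_gen (U.map_mem _ _ _ (A.mul_mem _ _ _ _ _ _ hv hu)) hg (fun j => P.map_mem _ _ _ (ht j)),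
    ← U.map_d, A.mul_d _ _ p v u hv]
  simp only [map_add, map_sum, LinearMap.map_smul_of_tower, mul_gen, gen_add_left, gen_smul_left,
    smul_add, Finset.smul_sum, smul_smul, ← Int.negOnePow_add, add_assoc]
  congr 3
  refine Finset.sum_congr rfl fun j _ => ?_
  congr 2
  funext i
  rw [← P.map_d]
  exact (Function.apply_update (fun i x => P.map (fiberSumSucc c h i) x) t j _ i).symm

theorem mul_map_map {c c' e e' : Type} [Finite c] [Finite c'] [Finite e] [Finite e']
    (σ : c ≃ c') (τ : e ≃ e') (v : U.obj c) (z : FreeObj U G P.toSigmaModule e) :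
    mul A G c' e' (U.map σ v) (map U G P.toSigmaModule τ z) =
      map U G P.toSigmaModule (Equiv.sumCongr σ τ) (mul A G c e v z) := by
  rw [← LinearMap.comp_apply, ← LinearMap.comp_apply]
  congr 1
  refine hom_ext fun m h p q r u g t hu hg ht => ?_
  rw [LinearMap.comp_apply, LinearMap.comp_apply, mul_gen, map_gen, map_gen, mul_gen, A.mul_map]
  refine gen_congr ?_ ?_ fun j => ?_
  · funext y
    rcases y with y | y <;> rfl
  · rw [U.map_map, U.map_map, U.map_map]
    refine U.map_congr ?_ _
    rintro (y | y) <;> rfl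
  · rw [P.map_map, P.map_map, P.map_map]
    refine P.map_congr ?_ _
    exact fun _ => rfl

theorem mul_mul {a b e : Type} [Finite a] [Finite b] [Finite e]
    (v : U.obj a) (w : U.obj b) (z : FreeObj U G P.toSigmaModule e) :
    map U G P.toSigmaModule (Equiv.sumAssoc a b e) (mul A G (a ⊕ b) e (A.mul a b v w) z) =
      mul A G a (b ⊕ e) v (mul A G b e w z) := by
  rw [← LinearMap.comp_apply, ← LinearMap.comp_apply]
  congr 1
  refine hom_ext fun m h p q r u g t hu hg ht => ?_
  rw [LinearMap.comp_apply, LinearMap.comp_apply, mul_gen, map_gen, mul_gen, mul_gen]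
  have h1 := A.mul_map (Equiv.refl a) (fiberSumZero b h) v (A.mul _ _ w u)
  rw [U.map_refl] at h1
  rw [h1, ← A.mul_assoc]
  refine gen_congr ?_ ?_ fun j => ?_
  · funext y
    rcases y with y | y | y <;> rfl
  · simp only [U.map_map]
    refine U.map_congr ?_ _
    rintro ((y | y) | y) <;> rfl
  · simp only [P.map_map]
    refine P.map_congr ?_ _
    exact fun _ => rfl

variable {L : Type} [Fintype L] [LinearOrder L] {E E' : L → Type} [∀ i, Finite (E i)]
  [∀ i, Finite (E' i)]

/-- Bijections of the sets $E_i$ leave the order of the factors unchanged, so the signs on the two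
sides are the same. -/
theorem act_map (τ : ∀ i, E i ≃ E' i) {q : L → ℤ} {s : ∀ i, P.obj (E i)}
    (hs : ∀ i, s i ∈ (P.obj (E i)).grading (q i)) (z : FreeObj U G P.toSigmaModule L) :
    act A G E' (fun i => P.map (τ i) (s i)) z =
      map U G P.toSigmaModule (Equiv.sigmaCongrRight τ) (act A G E s z) := by
  rw [← LinearMap.comp_apply]
  congr 1
  refine hom_ext fun m h p q r u g t hu hg ht => ?_
  rw [LinearMap.comp_apply, act_gen A G E hg ht hs,
    act_gen A G E' hg ht (fun i => P.map_mem _ _ _ (hs i)), LinearMap.map_smul_of_tower, map_gen]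
  congr 1
  refine gen_congr ?_ ?_ fun j => ?_
  · funext y
    rfl
  · unfold actZero
    rw [LinearMap.comp_apply, LinearMap.comp_apply, A.isRightComp.comp_map _ _ _
      (fun i : {i : L // h i = 0} => τ i.1)]
    simp only [U.map_map]
    exact U.map_congr (fun _ => rfl) _
  · unfold actSucc
    rw [LinearMap.comp_apply, LinearMap.comp_apply, P.isRightComp.comp_map _ _ _
      (fun i : {i : L // h i = j.succ} => τ i.1)]
    simp only [P.map_map]
    exact P.map_congr (fun _ => rfl) _

variable (f : ∀ m : ℕ, G m →ₗ[k] FreeObj U G P.toSigmaModule (Fin m))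

theorem induced_map {e e' : Type} [Finite e] [Finite e'] (σ : e ≃ e')
    (z : FreeObj U G P.toSigmaModule e) :
    induced A G f e' (map U G P.toSigmaModule σ z) =
      map U G P.toSigmaModule σ (induced A G f e z) := by
  rw [← LinearMap.comp_apply, ← LinearMap.comp_apply]
  congr 1
  refine hom_ext fun m h p q r u g t hu hg ht => ?_
  rw [LinearMap.comp_apply, LinearMap.comp_apply, map_gen, induced_gen_of_mem A G f hu,
    induced_gen_of_mem A G f (U.map_mem _ _ _ hu), act_map A G _ ht, mul_map_map, map_map,
    LinearMap.map_smul_of_tower, map_map]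
  congr 1
  refine map_congr ?_ _
  rintro (y | ⟨j, y⟩) <;> rfl

/-- Associativity of the product in `U`. The sign arises because the leading factor of
$v\cdot(u\otimes\cdots)$ has degree $|v|+|u|$. -/
theorem induced_mul {c e : Type} [Finite c] [Finite e] {p : ℤ} {v : U.obj c}
    (hv : v ∈ (U.obj c).grading p) (z : FreeObj U G P.toSigmaModule e) :
    induced A G f (c ⊕ e) (mul A G c e v z) =
      (p.negOnePow : ℤˣ) • mul A G c e v (induced A G f e z) := by
  rw [← LinearMap.comp_apply, ← LinearMap.comp_apply, ← LinearMap.smul_apply]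
  congr 1
  refine hom_ext fun m h p' q r u g t hu hg ht => ?_
  have h1 : ∀ x, mul A G c e v (map U G P.toSigmaModule (fiberDecomp h) x) =
      map U G P.toSigmaModule (Equiv.sumCongr (Equiv.refl c) (fiberDecomp h))
        (mul A G c _ v x) := fun x => by
    rw [← mul_map_map, U.map_refl]
  rw [LinearMap.smul_apply, LinearMap.comp_apply, LinearMap.comp_apply, mul_gen,
    induced_gen_of_mem A G f hu,
    induced_gen_of_mem A G f (U.map_mem _ _ _ (A.mul_mem _ _ _ _ _ _ hv hu)), act_map A G _ ht,
    mul_map_map, map_map, LinearMap.map_smul_of_tower, h1, ← mul_mul, map_map,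
    Int.negOnePow_add, ← smul_smul]
  congr 2
  refine map_congr ?_ _
  rintro ((y | y) | ⟨j, y⟩) <;> rfl

end Alg

end FreeObj

end OperadLifting

namespace OperadLifting

variable {k : Type u} [CommRing k]

/-! ### Compatibility of `∂_f` with the right action -/

theorem sum_subtype_eq {ι : Type*} [Fintype ι] {p : ι → Prop} [DecidablePred p] (f : ι → ℤ) :
    ∑ x : {x // p x}, f x.1 = ∑ x, if p x then f x else 0 := by
  rw [← Finset.sum_filter]
  exact (Finset.sum_subtype _ (by simp) f).symm

theorem sum_subtype_sum_subtype_eq {ι κ : Type*} [Fintype ι] [Fintype κ] {p : ι → Prop}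
    [DecidablePred p] {r : κ → Prop} [DecidablePred r] (F : ι → κ → ℤ) :
    ∑ x : {x // p x}, ∑ y : {y // r y}, F x.1 y.1 =
      ∑ x, ∑ y, if p x ∧ r y then F x y else 0 := by
  rw [sum_subtype_eq (f := fun x => ∑ y : {y // r y}, F x y.1)]
  refine Finset.sum_congr rfl fun x _ => ?_
  rw [sum_subtype_eq (f := fun y => F x y)]
  by_cases hx : p x <;> simp [hx]

theorem sum_inr_eq {c e L : Type*} [Fintype c] [Fintype e] [Fintype L] (ρ : c ⊕ e ≃ L)
    (f : L → ℤ) : ∑ z : e, f (ρ (.inr z)) = ∑ i, if (ρ.symm i).isRight then f i else 0 := by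
  rw [← Equiv.sum_comp ρ, Fintype.sum_sum_type]
  simp

namespace FreeObj

section Core

variable {P : Operad.{u, v} k} {U : SigmaModule.{u, v} k}
variable {L : Type} [Fintype L] [LinearOrder L] {E : L → Type} [∀ i, Finite (E i)]
variable {m m' : ℕ} (h : L → Fin (m + 1)) (f : Fin m → Fin (m' + 1))

/-- The map `L ⟶ {0, …, m'}` which is `0` on the fibre of `h` at `0` and `f j` on the fibre at
`j + 1`. -/
abbrev glue : L → Fin (m' + 1) :=
  Sum.elim (fun _ => 0) (f ∘ Sigma.fst) ∘ (fiberDecomp h).symm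

omit [Fintype L] [LinearOrder L] in
-- Depends on $y$ only through $h(y)$; this turns conditions on `glue` into conditions on values of
-- $h$ in the sign computations.
theorem glue_eq (y : L) : glue h f y = (Fin.cons 0 f : Fin (m + 1) → Fin (m' + 1)) (h y) := by
  obtain ⟨z, rfl⟩ := (fiberDecomp h).surjective y
  unfold glue
  rw [Function.comp_apply, Equiv.symm_apply_apply]
  rcases z with ⟨y, hy⟩ | ⟨j, y, hy⟩
  · change 0 = (Fin.cons 0 f : Fin (m + 1) → Fin (m' + 1)) (h y)
    rw [hy, Fin.cons_zero]
  · change f j = (Fin.cons 0 f : Fin (m + 1) → Fin (m' + 1)) (h y)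
    rw [hy, Fin.cons_succ]

/-- The contribution of the `κ`th factor to the sign in `act_map_mul_act`. -/
def blockExp (τ : Fin m → ℤ) (q : L → ℤ) (κ : Fin (m' + 1)) : ℤ :=
  (∑ x, ∑ y, if x < y ∧ h y < h x ∧ glue h f x = κ ∧ glue h f y = κ then q x * q y else 0) +
    ∑ j, ∑ x, if h x < j.succ ∧ f j = κ ∧ glue h f x = κ then τ j * q x else 0

/-- Rewrites the sign of associativity in the block $\kappa$ as a sum over all of $L$ with side
conditions, so that the blocks can later be added up. The bijection enters only through its
underlying points. -/
theorem shuffleExp_glue {κ : Fin (m' + 1)}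
    (φ : (Σ j : {j // f j = κ}, {y // h y = j.1.succ}) ≃ {y // glue h f y = κ})
    (hφ : ∀ z, (φ z).1 = z.2.1) (τ : Fin m → ℤ) (q : L → ℤ) :
    shuffleExp (fun y => (φ.symm y).1) (fun j => τ j.1) (fun y => q y.1) =
      blockExp h f τ q κ := by
  have hs : ∀ y, (φ.symm y).1.1.succ = h y.1 := fun y => by
    conv_rhs => rw [← φ.apply_symm_apply y, hφ]
    exact (φ.symm y).2.2.symm
  unfold shuffleExp blockExp
  congr 1
  -- Indices in `Fin m` are shifted by one to be compared with values of `h`, where `0` is reserved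
  -- for the factor in `U`.
  · simp only [← Fin.succ_lt_succ_iff (a := (φ.symm _).1.1), ← Subtype.coe_lt_coe, hs]
    rw [sum_subtype_sum_subtype_eq (p := fun y => glue h f y = κ) (r := fun y => glue h f y = κ)
      (F := fun x y => if x < y ∧ h y < h x then q x * q y else 0)]
    refine Finset.sum_congr rfl fun x _ => Finset.sum_congr rfl fun y _ => ?_
    rw [← ite_and]
    exact if_congr (by tauto) rfl rfl
  · simp only [← Fin.succ_lt_succ_iff (a := (φ.symm _).1.1), ← Subtype.coe_lt_coe, hs]
    rw [sum_subtype_sum_subtype_eq (p := fun j => f j = κ) (r := fun y => glue h f y = κ)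
      (F := fun j x => if h x < j.succ then τ j * q x else 0)]
    refine Finset.sum_congr rfl fun x _ => Finset.sum_congr rfl fun y _ => ?_
    rw [← ite_and]
    exact if_congr (by tauto) rfl rfl

/-- Associativity of `P` in one tensor factor. The bijection `θ` is constrained only on points, so
that it can absorb whatever relabelling the application produces. -/
theorem actSucc_actSucc {k' : Fin m'}
    (θ : {z : Σ j, {z : Σ i, E i // (h ∘ Sigma.fst) z = j.succ} // (f ∘ Sigma.fst) z = k'.succ} ≃
      {z : Σ i, E i // (glue h f ∘ Sigma.fst) z = k'.succ}) (hθ : ∀ z, (θ z).1 = z.1.2.1)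
    {s : ∀ i, P.obj (E i)} {q : L → ℤ} (hs : ∀ i, s i ∈ (P.obj (E i)).grading (q i))
    {t : ∀ j : Fin m, P.obj {y : L // h y = j.succ}} {τ : Fin m → ℤ}
    (ht : ∀ j, t j ∈ (P.obj {y : L // h y = j.succ}).grading (τ j))
    (x : P.obj {j // f j = k'.succ}) :
    actSucc E (glue h f) s k'
      (P.map (fiberRelabel (fiberDecomp h) (Sum.elim (fun _ => 0) (f ∘ Sigma.fst)) k'.succ)
        (P.map (fiberSumSucc {y // h y = 0} (f ∘ Sigma.fst) k')
          (actSucc (fun j => {y : L // h y = j.succ}) f t k' x))) =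
      ((blockExp h f τ q k'.succ).negOnePow : ℤˣ) • P.map θ
        (actSucc (fun j => {z : Σ i, E i // (h ∘ Sigma.fst) z = j.succ}) f
          (fun j => actSucc E h s j (t j)) k' x) := by
  let φ : (Σ j : {j // f j = k'.succ}, {y // h y = j.1.succ}) ≃ {y // glue h f y = k'.succ} :=
    (fiberSigma f (fun j => {y : L // h y = j.succ}) k'.succ).trans
      ((fiberSumSucc {y // h y = 0} (f ∘ Sigma.fst) k').trans
        (fiberRelabel (fiberDecomp h) (Sum.elim (fun _ => 0) (f ∘ Sigma.fst)) k'.succ))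
  let ψ : (Σ j : {j // f j = k'.succ}, Σ y : {y // h y = j.1.succ}, E y.1) ≃
      Σ y : {y // glue h f y = k'.succ}, E y.1 := sigmaSigmaEquiv φ fun y => E y.1
  have key : P.comp {y // glue h f y = k'.succ} (fun y => E y.1) (fun y => s y.1)
      (P.map φ (P.comp {j // f j = k'.succ} (fun j => {y // h y = j.1.succ})
        (fun j => t j.1) x)) =
      ((blockExp h f τ q k'.succ).negOnePow : ℤˣ) • P.map ψ
        (P.comp {j // f j = k'.succ} (fun j => Σ y : {y // h y = j.1.succ}, E y.1)
          (fun j => P.comp {y // h y = j.1.succ} (fun y => E y.1) (fun y => s y.1) (t j.1)) x) := by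
    rw [← shuffleExp_glue h f φ (fun _ => rfl)]
    exact P.isRightComp.assoc_of_equiv P.isRightComp φ (fun j y y' hy => hy) (fun y => E y.1)
      (fun j => τ j.1) (fun y => q y.1) x (fun j => t j.1) (fun y => s y.1)
      (fun j => ht j.1) (fun y => hs y.1)
  unfold actSucc
  simp only [LinearMap.comp_apply, P.map_map]
  refine (congrArg (P.map (fiberSigma (glue h f) E k'.succ)) key).trans ?_
  rw [LinearMap.map_smul_of_tower, P.isRightComp.comp_map _ _ _
    (fun j : {j // f j = k'.succ} => fiberSigma h E j.1.succ), P.map_map, P.map_map]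
  congr 1
  refine P.map_congr ?_ _
  rintro ⟨j, y, z⟩
  refine Subtype.ext ?_
  rw [Equiv.trans_apply, Equiv.trans_apply, Equiv.trans_apply, hθ]
  rfl


/-- Combines the compatibility of the product with the right action and the associativity of that
action: $s$ is first distributed over $u$ and $w(t)$, and then passed through $w(t)$ into the $t_i$.
-/
theorem mul_comp_comp (A : RightModuleAlgebra P U) {c l : Type} [Fintype c] [LinearOrder c]
    [Fintype l] [LinearOrder l] {a : l → Type} [∀ i, Fintype (a i)] [∀ i, LinearOrder (a i)]
    (ρ : c ⊕ (Σ i, a i) ≃ L) (hc : StrictMono fun x => ρ (.inl x))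
    (ha : ∀ i, StrictMono fun x : a i => ρ (.inr ⟨i, x⟩)) {r r' : ℤ} {p : l → ℤ} {q : L → ℤ}
    {u : U.obj c} (hu : u ∈ (U.obj c).grading r) {w : U.obj l} (hw : w ∈ (U.obj l).grading r')
    {t : ∀ i, P.obj (a i)} (ht : ∀ i, t i ∈ (P.obj (a i)).grading (p i))
    {s : ∀ i, P.obj (E i)} (hs : ∀ i, s i ∈ (P.obj (E i)).grading (q i)) :
    A.comp L E s (U.map ρ (A.mul c (Σ i, a i) u (A.comp l a t w))) =
      ((shuffleExp (fun i => (ρ.symm i).isRight) (fun z => cond z (r' + ∑ i, p i) r) q +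
        ((∑ z : Σ i, a i, ∑ z' : Σ i, a i, if ρ (.inr z) < ρ (.inr z') ∧ z'.1 < z.1 then
          q (ρ (.inr z)) * q (ρ (.inr z')) else 0) +
        ∑ i, ∑ z : Σ i, a i, if z.1 < i then p i * q (ρ (.inr z)) else 0)).negOnePow : ℤˣ) •
      U.map ((Equiv.sumCongr (Equiv.refl _)
          (sigmaSigmaEquiv (Equiv.refl (Σ i, a i)) fun z => E (ρ (.inr z)))).trans
            (sumSigmaEquiv ρ E))
        (A.mul (Σ i : c, E (ρ (.inl i))) (Σ i, Σ x : a i, E (ρ (.inr ⟨i, x⟩)))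
          (A.comp c (fun i => E (ρ (.inl i))) (fun i => s (ρ (.inl i))) u)
          (A.comp l (fun i => Σ x : a i, E (ρ (.inr ⟨i, x⟩)))
            (fun i => P.comp (a i) (fun x => E (ρ (.inr ⟨i, x⟩)))
              (fun x => s (ρ (.inr ⟨i, x⟩))) (t i)) w)) := by
  -- The order pulled back from $L$, so that $\rho$ is monotone on the second summand and no further
  -- sign appears.
  let _ : LinearOrder (Σ i, a i) := LinearOrder.lift' (fun z => ρ (.inr z))
    (ρ.injective.comp Sum.inr_injective)
  rw [A.mul_comp_of_equiv ρ hc (fun x y hxy => hxy) E r _ q u _ s hu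
    (A.isRightComp.comp_mem _ _ _ _ _ _ hw ht) hs, Int.negOnePow_add, ← smul_smul]
  congr 1
  have h1 := A.isRightComp.assoc_of_equiv P.isRightComp (Equiv.refl (Σ i, a i)) ha
    (fun z => E (ρ (.inr z))) p (fun z => q (ρ (.inr z))) w t (fun z => s (ρ (.inr z))) ht
    (fun z => hs _)
  rw [U.map_refl] at h1
  rw [h1, LinearMap.map_smul_of_tower, LinearMap.map_smul_of_tower]
  congr 1
  have h2 := A.mul_map (Equiv.refl (Σ i : c, E (ρ (.inl i))))
    (sigmaSigmaEquiv (Equiv.refl (Σ i, a i)) fun z => E (ρ (.inr z)))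
    (A.comp c (fun i => E (ρ (.inl i))) (fun i => s (ρ (.inl i))) u)
  rw [U.map_refl] at h2
  rw [h2]
  exact U.map_map _ _ _

/-- Points with $h=0$ are inserted into $u$, the other points of the zero block into the $t_j$ with
$f(j)=0$. Besides the block sign, only the passage of the former past $w$, of degree $r'$, remains.
-/
theorem shuffleExp_mul_glue
    (ρ : {y // h y = 0} ⊕ (Σ j : {j // f j = 0}, {y // h y = j.1.succ}) ≃ {y // glue h f y = 0})
    (hl : ∀ z, (ρ (.inl z)).1 = z.1) (hr : ∀ z, (ρ (.inr z)).1 = z.2.1) (r r' : ℤ)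
    (τ : Fin m → ℤ) (q : L → ℤ) :
    shuffleExp (fun i => (ρ.symm i).isRight)
        (fun z => cond z (r' + ∑ j : {j // f j = 0}, τ j.1) r) (fun y => q y.1) +
      ((∑ z : Σ j : {j // f j = 0}, {y // h y = j.1.succ},
        ∑ z' : Σ j : {j // f j = 0}, {y // h y = j.1.succ},
          if ρ (.inr z) < ρ (.inr z') ∧ z'.1 < z.1 then q (ρ (.inr z)).1 * q (ρ (.inr z')).1
          else 0) +
        ∑ j : {j // f j = 0}, ∑ z : Σ j : {j // f j = 0}, {y // h y = j.1.succ},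
          if z.1 < j then τ j.1 * q (ρ (.inr z)).1 else 0) =
    blockExp h f τ q 0 + ∑ x, if h x = 0 then r' * q x else 0 := by
  have hz : ∀ z : Σ j : {j // f j = 0}, {y // h y = j.1.succ},
      z.1.1.succ = h (ρ (.inr z)).1 := fun z => by
    rw [hr, z.2.2]
  have hρ : ∀ y, (ρ.symm y).isRight = true ↔ h y.1 ≠ 0 := fun y => by
    obtain ⟨z, rfl⟩ := ρ.surjective y
    rw [Equiv.symm_apply_apply]
    rcases z with z | z
    · simp [hl, z.2]
    · simp [hr, z.2.2]
  have hρ' : ∀ y, (ρ.symm y).isRight = false ↔ h y.1 = 0 := fun y => by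
    rw [← Bool.not_eq_true, hρ, not_not]
  have hC : (∑ z : Σ j : {j // f j = 0}, {y // h y = j.1.succ},
        ∑ z' : Σ j : {j // f j = 0}, {y // h y = j.1.succ},
          if ρ (.inr z) < ρ (.inr z') ∧ z'.1 < z.1 then q (ρ (.inr z)).1 * q (ρ (.inr z')).1
          else 0) = ∑ x : {y // glue h f y = 0}, ∑ y : {y // glue h f y = 0},
            if h x.1 ≠ 0 ∧ h y.1 ≠ 0 ∧ x < y ∧ h y.1 < h x.1 then q x.1 * q y.1 else 0 := by
    simp only [← Fin.succ_lt_succ_iff (a := Subtype.val (Sigma.fst _)), ← Subtype.coe_lt_coe, hz]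
    rw [sum_inr_eq ρ fun x => ∑ z' : Σ j : {j // f j = 0}, {y // h y = j.1.succ},
      if x.1 < (ρ (.inr z')).1 ∧ h (ρ (.inr z')).1 < h x.1 then q x.1 * q (ρ (.inr z')).1 else 0]
    refine Finset.sum_congr rfl fun x _ => ?_
    rw [sum_inr_eq ρ fun y => if x.1 < y.1 ∧ h y.1 < h x.1 then q x.1 * q y.1 else 0]
    simp only [hρ, ← ite_and]
    by_cases hx : h x.1 = 0 <;> simp [hx]
  have hD : (∑ j : {j // f j = 0}, ∑ z : Σ j : {j // f j = 0}, {y // h y = j.1.succ},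
      if z.1 < j then τ j.1 * q (ρ (.inr z)).1 else 0) =
      ∑ j : {j // f j = 0}, ∑ x : {y // glue h f y = 0},
        if h x.1 ≠ 0 ∧ h x.1 < j.1.succ then τ j.1 * q x.1 else 0 := by
    simp only [← Fin.succ_lt_succ_iff (a := Subtype.val (Sigma.fst _)), ← Subtype.coe_lt_coe, hz]
    refine Finset.sum_congr rfl fun j _ => ?_
    rw [sum_inr_eq ρ fun x => if h x.1 < j.1.succ then τ j.1 * q x.1 else 0]
    simp only [hρ, ← ite_and]
  have hR : (∑ x, if h x = 0 then r' * q x else 0) =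
      ∑ x : {y // glue h f y = 0}, if h x.1 = 0 then r' * q x.1 else 0 := by
    rw [sum_subtype_eq (p := fun y => glue h f y = 0) fun x => if h x = 0 then r' * q x else 0]
    refine Finset.sum_congr rfl fun x _ => ?_
    by_cases hx : h x = 0
    · simp only [glue_eq, hx, Fin.cons_zero, if_true]
    · simp [hx]
  have hB : blockExp h f τ q 0 =
      (∑ x : {y // glue h f y = 0}, ∑ y : {y // glue h f y = 0},
        if x < y ∧ h y.1 < h x.1 then q x.1 * q y.1 else 0) +
      ∑ j : {j // f j = 0}, ∑ x : {y // glue h f y = 0},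
        if h x.1 < j.1.succ then τ j.1 * q x.1 else 0 := by
    unfold blockExp
    simp only [← Subtype.coe_lt_coe]
    rw [sum_subtype_sum_subtype_eq (p := fun y => glue h f y = 0) (r := fun y => glue h f y = 0)
      (F := fun x y => if x < y ∧ h y < h x then q x * q y else 0),
      sum_subtype_sum_subtype_eq (p := fun j => f j = 0) (r := fun y => glue h f y = 0)
      (F := fun j x => if h x < j.succ then τ j * q x else 0)]
    simp only [← ite_and]
    congr 1 <;>
    exact Finset.sum_congr rfl fun x _ => Finset.sum_congr rfl fun y _ =>
      if_congr (by tauto) rfl rfl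
  rw [hC, hD, hR, hB]
  -- Only elements going to the left factor cross the right one, so $r$ disappears and the degree
  -- $r'+\sum_j\tau_j$ of the right factor splits into two terms.
  have hA : shuffleExp (fun i => (ρ.symm i).isRight)
      (fun z => cond z (r' + ∑ j : {j // f j = 0}, τ j.1) r) (fun y => q y.1) =
      (∑ x : {y // glue h f y = 0}, ∑ y : {y // glue h f y = 0},
        if x < y ∧ h y.1 = 0 ∧ h x.1 ≠ 0 then q x.1 * q y.1 else 0) +
      ((∑ x : {y // glue h f y = 0}, if h x.1 = 0 then r' * q x.1 else 0) +
      ∑ j : {j // f j = 0}, ∑ x : {y // glue h f y = 0},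
        if h x.1 = 0 then τ j.1 * q x.1 else 0) := by
    unfold shuffleExp
    congr 1
    · refine Finset.sum_congr rfl fun x _ => Finset.sum_congr rfl fun y _ =>
        if_congr (and_congr_right fun _ => ?_) rfl rfl
      rw [Bool.lt_iff, hρ, hρ']
    · rw [Finset.sum_comm (γ := {j // f j = 0}), ← Finset.sum_add_distrib, Fintype.sum_bool,
        ← Finset.sum_add_distrib]
      refine Finset.sum_congr rfl fun x _ => ?_
      simp only [Bool.lt_iff, hρ', and_true, cond_true, Bool.false_eq_true, and_false, if_false,
        add_zero]
      split_ifs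
      · rw [add_mul, Finset.sum_mul]
      · simp
  rw [hA]
  have e1 : ∀ a b c d e : ℤ, a + (b + c) + (d + e) = (a + d) + (c + e) + b := fun a b c d e => by
    ring
  rw [e1, ← Finset.sum_add_distrib, ← Finset.sum_add_distrib]
  congr 2
  · refine Finset.sum_congr rfl fun x _ => ?_
    rw [← Finset.sum_add_distrib]
    refine Finset.sum_congr rfl fun y _ => ?_
    by_cases hx : h x.1 = 0 <;> by_cases hy : h y.1 = 0 <;>
      simp [hx, hy, Fin.pos_iff_ne_zero]
  · refine Finset.sum_congr rfl fun j _ => ?_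
    rw [← Finset.sum_add_distrib]
    refine Finset.sum_congr rfl fun x _ => ?_
    by_cases hx : h x.1 = 0 <;> simp [hx]

/-- Counterpart of `actSucc_actSucc` for the factor in `U`, where the product also intervenes. -/
theorem actZero_mul_actZero (A : RightModuleAlgebra P U)
    (θ : {z : Σ i, E i // (h ∘ Sigma.fst) z = 0} ⊕
      {z : Σ j, {z : Σ i, E i // (h ∘ Sigma.fst) z = j.succ} // (f ∘ Sigma.fst) z = 0} ≃
      {z : Σ i, E i // (glue h f ∘ Sigma.fst) z = 0}) (hl : ∀ z, (θ (.inl z)).1 = z.1)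
    (hr : ∀ z, (θ (.inr z)).1 = z.1.2.1)
    {s : ∀ i, P.obj (E i)} {q : L → ℤ} (hs : ∀ i, s i ∈ (P.obj (E i)).grading (q i))
    {t : ∀ j : Fin m, P.obj {y : L // h y = j.succ}} {τ : Fin m → ℤ}
    (ht : ∀ j, t j ∈ (P.obj {y : L // h y = j.succ}).grading (τ j))
    {r r' : ℤ} {u : U.obj {y // h y = 0}} (hu : u ∈ (U.obj {y // h y = 0}).grading r)
    {w : U.obj {j // f j = 0}} (hw : w ∈ (U.obj {j // f j = 0}).grading r') :
    actZero A E (glue h f) s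
      (U.map (fiberRelabel (fiberDecomp h) (Sum.elim (fun _ => 0) (f ∘ Sigma.fst)) 0)
        (U.map (fiberSumZero {y // h y = 0} (f ∘ Sigma.fst))
          (A.mul _ _ u (actZero A (fun j => {y : L // h y = j.succ}) f t w)))) =
      ((blockExp h f τ q 0 + ∑ x, if h x = 0 then r' * q x else 0).negOnePow : ℤˣ) • U.map θ
        (A.mul _ _ (actZero A E h s u)
          (actZero A (fun j => {z : Σ i, E i // (h ∘ Sigma.fst) z = j.succ}) f
            (fun j => actSucc E h s j (t j)) w)) := by
  let ρ : {y // h y = 0} ⊕ (Σ j : {j // f j = 0}, {y // h y = j.1.succ}) ≃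
      {y // glue h f y = 0} :=
    (Equiv.sumCongr (Equiv.refl _) (fiberSigma f (fun j => {y : L // h y = j.succ}) 0)).trans
      ((fiberSumZero {y // h y = 0} (f ∘ Sigma.fst)).trans
        (fiberRelabel (fiberDecomp h) (Sum.elim (fun _ => 0) (f ∘ Sigma.fst)) 0))
  let ψ : (Σ y : {y // h y = 0}, E y.1) ⊕
      (Σ j : {j // f j = 0}, Σ y : {y // h y = j.1.succ}, E y.1) ≃
      Σ y : {y // glue h f y = 0}, E y.1 :=
    (Equiv.sumCongr (Equiv.refl _) (sigmaSigmaEquiv (Equiv.refl _)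
      fun z : (Σ j : {j // f j = 0}, {y // h y = j.1.succ}) => E (ρ (.inr z)).1)).trans
        (sumSigmaEquiv ρ fun y => E y.1)
  have key : A.comp {y // glue h f y = 0} (fun y => E y.1) (fun y => s y.1)
      (U.map ρ (A.mul _ _ u (A.comp {j // f j = 0} (fun j => {y // h y = j.1.succ})
        (fun j => t j.1) w))) =
      ((blockExp h f τ q 0 + ∑ x, if h x = 0 then r' * q x else 0).negOnePow : ℤˣ) • U.map ψ
        (A.mul _ _ (A.comp {y // h y = 0} (fun y => E y.1) (fun y => s y.1) u)
          (A.comp {j // f j = 0} (fun j => Σ y : {y // h y = j.1.succ}, E y.1)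
            (fun j => P.comp {y // h y = j.1.succ} (fun y => E y.1) (fun y => s y.1) (t j.1))
            w)) := by
    rw [← shuffleExp_mul_glue h f ρ (fun _ => rfl) (fun _ => rfl) r]
    exact mul_comp_comp (E := fun y : {y // glue h f y = 0} => E y.1) A ρ (fun y y' hy => hy)
      (fun j y y' hy => hy) (q := fun y => q y.1) hu hw (fun j => ht j.1) (fun y => hs y.1)
  have h1 := A.mul_map (Equiv.refl _) (fiberSigma f (fun j => {y : L // h y = j.succ}) 0) u
    (A.comp {j // f j = 0} (fun j => {y // h y = j.1.succ}) (fun j => t j.1) w)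
  rw [U.map_refl] at h1
  unfold actZero actSucc
  simp only [LinearMap.comp_apply]
  rw [h1, U.map_map, U.map_map]
  refine (congrArg (U.map (fiberSigma (glue h f) E 0)) key).trans ?_
  rw [LinearMap.map_smul_of_tower, A.isRightComp.comp_map _ _ _
    (fun j : {j // f j = 0} => fiberSigma h E j.1.succ), U.map_map, U.map_map, A.mul_map,
    U.map_map]
  congr 1
  refine U.map_congr ?_ _
  rintro (⟨y, z⟩ | ⟨j, y, z⟩)
  · refine Subtype.ext ?_
    rw [Equiv.trans_apply, Equiv.trans_apply, Equiv.sumCongr_apply, Sum.map_inl, hl]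
    rfl
  · refine Subtype.ext ?_
    rw [Equiv.trans_apply, Equiv.trans_apply, Equiv.sumCongr_apply, Sum.map_inr, hr]
    rfl

end Core

end FreeObj

end OperadLifting

/-! ### Koszul sign identities modulo two -/

namespace OperadLifting

variable {k : Type u} [CommRing k]

/-- The indicator of a proposition, modulo two. -/
def ind (p : Prop) [Decidable p] : ZMod 2 := if p then 1 else 0

theorem cast_ite_eq (p : Prop) [Decidable p] (a : ℤ) :
    (((if p then a else 0 : ℤ)) : ZMod 2) = ind p * a := by
  unfold ind
  split_ifs <;> simp

theorem cast_shuffleExp {l L : Type} [Fintype l] [LinearOrder l] [Fintype L] [LinearOrder L]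
    (h : L → l) (p : l → ℤ) (q : L → ℤ) : ((shuffleExp h p q : ℤ) : ZMod 2) =
      ∑ x, ∑ y, ind (x < y ∧ h y < h x) * ((q x : ZMod 2) * q y) +
        ∑ i, ∑ x, ind (h x < i) * ((p i : ZMod 2) * q x) := by
  unfold shuffleExp
  simp only [Int.cast_add, Int.cast_sum, Int.cast_mul, cast_ite_eq]

/-- Symmetrisation: inversions counted in the order of the values of $h$ become comparable with
inversions counted in the order of $L$. -/
theorem sum_sum_eq_sum_lt {L : Type*} [Fintype L] [LinearOrder L] {F : L → L → ZMod 2}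
    (hF : ∀ x, F x x = 0) :
    ∑ x, ∑ y, F x y = ∑ x, ∑ y, ind (x < y) * (F x y + F y x) := by
  have h1 : ∀ x y, F x y = ind (x < y) * F x y + ind (y < x) * F x y := fun x y => by
    rcases lt_trichotomy x y with h | rfl | h
    · simp [ind, h, h.not_gt]
    · simp [hF]
    · simp [ind, h, h.not_gt]
  calc ∑ x, ∑ y, F x y = ∑ x, ∑ y, (ind (x < y) * F x y + ind (y < x) * F x y) :=
        Finset.sum_congr rfl fun x _ => Finset.sum_congr rfl fun y _ => h1 x y
    _ = ∑ x, ∑ y, ind (x < y) * F x y + ∑ x, ∑ y, ind (x < y) * F y x := by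
        simp only [Finset.sum_add_distrib]
        rw [Finset.sum_comm (f := fun x y => ind (y < x) * F x y)]
    _ = _ := by
        simp only [← Finset.sum_add_distrib, mul_add]

/-- Groups the points of $L$ by their image; the fibre over $0$, absent on the left, is harmless
because $c(0)=0$. -/
theorem sum_mul_sum_fiber {L : Type*} [Fintype L] {m : ℕ} (h : L → Fin (m + 1))
    (c : Fin (m + 1) → ZMod 2) (hc : c 0 = 0) (q : L → ZMod 2) :
    ∑ j : Fin m, c j.succ * ∑ x, ind (h x = j.succ) * q x = ∑ x, c (h x) * q x := by
  simp only [Finset.mul_sum]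
  rw [Finset.sum_comm]
  refine Finset.sum_congr rfl fun x _ => ?_
  rcases Fin.eq_zero_or_eq_succ (h x) with hx | ⟨i, hx⟩
  · simp [hx, ind, hc, (Fin.succ_ne_zero _).symm]
  · rw [Finset.sum_eq_single i]
    · simp [hx, ind]
    · intro j _ hj
      simp [hx, ind, hj.symm]
    · simp

namespace FreeObj

section Core

variable {L : Type} [Fintype L] [LinearOrder L]
variable {m m' : ℕ} (h : L → Fin (m + 1)) (f : Fin m → Fin (m' + 1))

theorem cast_actExp (γ : ℤ) (τ : Fin m → ℤ) (q : L → ℤ) : ((actExp h γ τ q : ℤ) : ZMod 2) =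
    ∑ x, ∑ y, ind (x < y ∧ h y < h x) * ((q x : ZMod 2) * q y) +
      ∑ j, ∑ x, ind (h x < j.succ) * ((τ j : ZMod 2) * q x) +
        ∑ x, ind (h x = 0) * ((γ : ZMod 2) * q x) := by
  unfold actExp
  simp only [Int.cast_add, Int.cast_sum, Int.cast_mul, cast_ite_eq, cast_shuffleExp]
  rw [Fin.sum_univ_succ (f := fun i : Fin (m + 1) => ∑ x, ind (h x < i) *
    (((Fin.cons 0 τ : Fin (m + 1) → ℤ) i : ZMod 2) * q x))]
  simp

theorem cast_sum_blockExp (τ : Fin m → ℤ) (q : L → ℤ) :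
    ((∑ κ, blockExp h f τ q κ : ℤ) : ZMod 2) =
    ∑ x, ∑ y, ind (x < y ∧ h y < h x ∧ glue h f x = glue h f y) * ((q x : ZMod 2) * q y) +
      ∑ j, ∑ x, ind (h x < j.succ ∧ f j = glue h f x) * ((τ j : ZMod 2) * q x) := by
  unfold blockExp
  rw [Finset.sum_add_distrib, Finset.sum_comm]
  generalize glue h f = G
  simp only [Int.cast_add, Int.cast_sum, Int.cast_mul, cast_ite_eq]
  congr 1
  · refine Finset.sum_congr rfl fun x _ => ?_
    rw [Finset.sum_comm]
    refine Finset.sum_congr rfl fun y _ => ?_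
    rw [Finset.sum_eq_single (G y)]
    · simp
    · intro κ _ hκ
      simp [ind, hκ.symm]
    · simp
  · rw [Finset.sum_comm]
    refine Finset.sum_congr rfl fun x _ => ?_
    rw [Finset.sum_comm]
    refine Finset.sum_congr rfl fun y _ => ?_
    rw [Finset.sum_eq_single (G y)]
    · simp
    · intro κ _ hκ
      simp [ind, hκ.symm]
    · simp

omit [LinearOrder L] in
-- The exponent has degree at most two in the degrees of the inserted elements. Replacing $\tau_j$
-- by $\tau_j+\sum_{h(x)=j+1}q_x$ therefore adds only cross terms, which are rewritten here as sums
-- over points of $L$.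
theorem cast_actExp_add (γ : ℤ) (τ' : Fin m' → ℤ) (τ : Fin m → ℤ) (q : L → ℤ) :
    ((actExp f γ τ' (fun j => τ j + ∑ x, if h x = j.succ then q x else 0) : ℤ) : ZMod 2) =
    (actExp f γ τ' τ : ℤ) +
      (∑ j, ∑ x, ind (j.succ < h x ∧ glue h f x < f j) * ((τ j : ZMod 2) * q x) +
        ∑ j, ∑ x, ind (h x < j.succ ∧ f j < glue h f x) * ((τ j : ZMod 2) * q x) +
        ∑ x, ∑ y, ind (h x < h y ∧ glue h f y < glue h f x) * ((q x : ZMod 2) * q y)) +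
      ∑ i, ∑ x, ind (h x ≠ 0 ∧ glue h f x < i.succ) * ((τ' i : ZMod 2) * q x) +
      ∑ x, ind (h x ≠ 0 ∧ glue h f x = 0) * ((γ : ZMod 2) * q x) := by
  set Q : Fin m → ZMod 2 := fun j => ∑ x, ind (h x = j.succ) * (q x : ZMod 2) with hQ
  have hq : ∀ j, ((τ j + ∑ x, if h x = j.succ then q x else 0 : ℤ) : ZMod 2) = τ j + Q j :=
    fun j => by
      simp only [Int.cast_add, Int.cast_sum, cast_ite_eq]
      rfl
  set F : Fin (m + 1) → Fin (m' + 1) := Fin.cons 0 f with hF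
  have hF0 : F 0 = 0 := Fin.cons_zero _ _
  have hFs : ∀ j, F j.succ = f j := fun j => Fin.cons_succ _ _ _
  simp only [glue_eq, ← hF]
  have e1 : ∑ j, ∑ x, ind (j.succ < h x ∧ F (h x) < f j) * ((τ j : ZMod 2) * q x) =
      ∑ j, ∑ j', ind (j < j' ∧ f j' < f j) * ((τ j : ZMod 2) * Q j') := by
    refine Finset.sum_congr rfl fun j _ => ?_
    have := sum_mul_sum_fiber h (fun i => ind (j.succ < i ∧ F i < f j) * (τ j : ZMod 2))
      (by simp [ind]) (fun x => (q x : ZMod 2))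
    simp only [hFs, Fin.succ_lt_succ_iff, mul_assoc] at this
    exact this.symm
  have e2 : ∑ j, ∑ x, ind (h x < j.succ ∧ f j < F (h x)) * ((τ j : ZMod 2) * q x) =
      ∑ j', ∑ j, ind (j < j' ∧ f j' < f j) * ((τ j' : ZMod 2) * Q j) := by
    refine Finset.sum_congr rfl fun j _ => ?_
    have := sum_mul_sum_fiber h (fun i => ind (i < j.succ ∧ f j < F i) * (τ j : ZMod 2))
      (by simp [ind, hF0]) (fun x => (q x : ZMod 2))
    simp only [hFs, Fin.succ_lt_succ_iff, mul_assoc] at this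
    exact this.symm
  have e3 : ∑ x, ∑ y, ind (h x < h y ∧ F (h y) < F (h x)) * ((q x : ZMod 2) * q y) =
      ∑ j, ∑ j', ind (j < j' ∧ f j' < f j) * (Q j * Q j') := by
    have e4 : ∀ j, ∑ j', ind (j < j' ∧ f j' < f j) * (Q j * Q j') =
        (∑ y, ind (j.succ < h y ∧ F (h y) < F j.succ) * (q y : ZMod 2)) * Q j := by
      intro j
      have := sum_mul_sum_fiber h (fun i => ind (j.succ < i ∧ F i < f j))
        (by simp [ind]) (fun x => (q x : ZMod 2))
      simp only [hFs, Fin.succ_lt_succ_iff] at this ⊢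
      rw [← this, Finset.sum_mul]
      exact Finset.sum_congr rfl fun j' _ => by ring
    simp only [e4]
    rw [sum_mul_sum_fiber h
      (fun i => ∑ y, ind (i < h y ∧ F (h y) < F i) * (q y : ZMod 2)) (by simp [ind, hF0])]
    refine Finset.sum_congr rfl fun x _ => ?_
    rw [Finset.sum_mul]
    exact Finset.sum_congr rfl fun y _ => by ring
  have e5 : ∑ i, ∑ x, ind (h x ≠ 0 ∧ F (h x) < i.succ) * ((τ' i : ZMod 2) * q x) =
      ∑ i, ∑ j, ind (f j < i.succ) * ((τ' i : ZMod 2) * Q j) := by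
    refine Finset.sum_congr rfl fun i _ => ?_
    have := sum_mul_sum_fiber h (fun κ => ind (κ ≠ 0 ∧ F κ < i.succ) * (τ' i : ZMod 2))
      (by simp [ind]) (fun x => (q x : ZMod 2))
    simp only [hFs, ne_eq, Fin.succ_ne_zero, not_false_eq_true, true_and, mul_assoc] at this ⊢
    exact this.symm
  have e6 : ∑ x, ind (h x ≠ 0 ∧ F (h x) = 0) * ((γ : ZMod 2) * q x) =
      ∑ j, ind (f j = 0) * ((γ : ZMod 2) * Q j) := by
    have := sum_mul_sum_fiber h (fun κ => ind (κ ≠ 0 ∧ F κ = 0) * (γ : ZMod 2))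
      (by simp [ind]) (fun x => (q x : ZMod 2))
    simp only [hFs, ne_eq, Fin.succ_ne_zero, not_false_eq_true, true_and, mul_assoc] at this ⊢
    exact this.symm
  rw [e1, e2, e3, e5, e6, Finset.sum_comm (f := fun j' j => ind (j < j' ∧ f j' < f j) *
    ((τ j' : ZMod 2) * Q j)), cast_actExp, cast_actExp]
  simp only [hq, mul_add, add_mul, Finset.sum_add_distrib]
  have e7 : ∑ x, ∑ y, ind (x < y ∧ f y < f x) * (Q x * (τ y : ZMod 2)) =
      ∑ x, ∑ y, ind (x < y ∧ f y < f x) * ((τ y : ZMod 2) * Q x) := by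
    simp only [mul_comm]
  rw [e7]
  ring

/-- Coherence of the sign rule: inserting $t$ and then $s$, or $s$ into $t$ and then the result,
reorders the same symbols. The identity is bilinear and is checked separately on the terms $qq$,
$\tau q$, $\tau' q$ and $\gamma q$. -/
theorem core_exp (γ ω : ℤ) (τ' : Fin m' → ℤ) (τ : Fin m → ℤ) (q : L → ℤ) :
    ((actExp f γ τ' τ + (actExp (glue h f) γ
        (fun i => τ' i + ∑ j, if f j = i.succ then τ j else 0) q +
      (∑ κ, blockExp h f τ q κ + ∑ x, if h x = 0 then ω * q x else 0)) : ℤ) : ZMod 2) =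
    ((actExp h (ω + γ + ∑ i, τ' i) τ q +
      actExp f γ τ' (fun j => τ j + ∑ x, if h x = j.succ then q x else 0) : ℤ) : ZMod 2) := by
  have hG0 : ∀ x, h x = 0 → glue h f x = 0 := fun x hx => by rw [glue_eq, hx, Fin.cons_zero]
  have hGs : ∀ x j, h x = j.succ → glue h f x = f j := fun x j hx => by
    rw [glue_eq, hx, Fin.cons_succ]
  have hGe : ∀ x y, h x = h y → glue h f x = glue h f y := fun x y hx => by
    rw [glue_eq, glue_eq, hx]
  have two : (1 : ZMod 2) + 1 = 0 := by decide
  rw [Int.cast_add, Int.cast_add, Int.cast_add, Int.cast_add, cast_actExp_add,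
    cast_sum_blockExp, cast_actExp (glue h f), cast_actExp h]
  generalize glue h f = G at *
  simp only [Int.cast_add, Int.cast_sum, Int.cast_mul, cast_ite_eq]
  have hqq : ∑ x, ∑ y, ind (x < y ∧ G y < G x) * ((q x : ZMod 2) * q y) +
      ∑ x, ∑ y, ind (x < y ∧ h y < h x ∧ G x = G y) * ((q x : ZMod 2) * q y) =
      ∑ x, ∑ y, ind (x < y ∧ h y < h x) * ((q x : ZMod 2) * q y) +
      ∑ x, ∑ y, ind (h x < h y ∧ G y < G x) * ((q x : ZMod 2) * q y) := by
    rw [sum_sum_eq_sum_lt (F := fun x y => ind (h x < h y ∧ G y < G x) *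
      ((q x : ZMod 2) * q y)) (by simp [ind])]
    simp only [← Finset.sum_add_distrib]
    refine Finset.sum_congr rfl fun x _ => Finset.sum_congr rfl fun y _ => ?_
    by_cases hxy : x < y
    · rcases lt_trichotomy (h x) (h y) with h1 | h1 | h1
      · simp [ind, hxy, h1, h1.not_gt]
      · simp [ind, hxy, h1, hGe x y h1]
      · rcases lt_trichotomy (G x) (G y) with h2 | h2 | h2
        -- The pair is interchanged once and then interchanged back: its contribution occurs twice
        -- and vanishes modulo two.
        · simp only [ind, hxy, h1, h1.not_gt, h2, h2.not_gt, h2.ne]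
          simp only [and_self, and_false, if_true, if_false]
          linear_combination -(q x * q y : ZMod 2) * two
        · simp only [ind, hxy, h1, h1.not_gt, h2]
          simp
        · simp only [ind, hxy, h1, h1.not_gt, h2, h2.not_gt, h2.ne']
          simp
    · simp [ind, hxy]
  have htq : ∑ i : Fin m', ∑ x, ind (G x < i.succ) *
        ((∑ j, ind (f j = i.succ) * (τ j : ZMod 2)) * q x) +
      ∑ j, ∑ x, ind (h x < j.succ ∧ f j = G x) * ((τ j : ZMod 2) * q x) =
      ∑ j, ∑ x, ind (h x < j.succ) * ((τ j : ZMod 2) * q x) +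
      (∑ j, ∑ x, ind (j.succ < h x ∧ G x < f j) * ((τ j : ZMod 2) * q x) +
        ∑ j, ∑ x, ind (h x < j.succ ∧ f j < G x) * ((τ j : ZMod 2) * q x)) := by
    have e1 : ∑ i : Fin m', ∑ x, ind (G x < i.succ) *
        ((∑ j, ind (f j = i.succ) * (τ j : ZMod 2)) * q x) =
        ∑ j, ∑ x, ind (G x < f j) * ((τ j : ZMod 2) * q x) := by
      rw [Finset.sum_comm, Finset.sum_comm (γ := Fin m)]
      refine Finset.sum_congr rfl fun x _ => ?_
      have := sum_mul_sum_fiber f (fun κ => ind (G x < κ) * (q x : ZMod 2))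
        (by simp [ind]) (fun j => (τ j : ZMod 2))
      refine Eq.trans (Finset.sum_congr rfl fun i _ => ?_) (this.trans
        (Finset.sum_congr rfl fun i _ => ?_)) <;> ring
    rw [e1]
    simp only [← Finset.sum_add_distrib]
    refine Finset.sum_congr rfl fun j _ => Finset.sum_congr rfl fun x _ => ?_
    rcases lt_trichotomy (h x) j.succ with h1 | h1 | h1
    · rcases lt_trichotomy (G x) (f j) with h2 | h2 | h2
      · simp only [ind, h1, h1.not_gt, h2, h2.not_gt, h2.ne']
        simp
      · simp only [ind, h1, h1.not_gt, h2]
        simp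
      · simp only [ind, h1, h1.not_gt, h2, h2.not_gt, h2.ne]
        simp only [and_self, and_false, if_true, if_false]
        linear_combination -(τ j * q x : ZMod 2) * two
    · simp [ind, h1, hGs x j h1]
    · simp [ind, h1, h1.not_gt]
  have htq' : ∑ i, ∑ x, ind (G x < i.succ) * ((τ' i : ZMod 2) * q x) =
      ∑ x, ind (h x = 0) * ((∑ i, (τ' i : ZMod 2)) * q x) +
      ∑ i, ∑ x, ind (h x ≠ 0 ∧ G x < i.succ) * ((τ' i : ZMod 2) * q x) := by
    simp only [Finset.sum_mul, Finset.mul_sum]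
    rw [Finset.sum_comm (f := fun x i => ind (h x = 0) * ((τ' i : ZMod 2) * q x)),
      ← Finset.sum_add_distrib]
    refine Finset.sum_congr rfl fun i _ => ?_
    rw [← Finset.sum_add_distrib]
    refine Finset.sum_congr rfl fun x _ => ?_
    by_cases hx : h x = 0
    · simp [ind, hx, hG0 x hx]
    · simp [ind, hx]
  have hgq : ∑ x, ind (G x = 0) * ((γ : ZMod 2) * q x) =
      ∑ x, ind (h x = 0) * ((γ : ZMod 2) * q x) +
      ∑ x, ind (h x ≠ 0 ∧ G x = 0) * ((γ : ZMod 2) * q x) := by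
    rw [← Finset.sum_add_distrib]
    refine Finset.sum_congr rfl fun x _ => ?_
    by_cases hx : h x = 0
    · simp [ind, hx, hG0 x hx]
    · simp [ind, hx]
  simp only [add_mul, mul_add, Finset.sum_add_distrib]
  linear_combination hqq + htq + htq' + hgq

end Core

end FreeObj

end OperadLifting

/-! ### The morphism `∂_f` commutes with the right action -/

namespace OperadLifting

variable {k : Type u} [CommRing k]

namespace FreeObj

section Core

variable {P : Operad.{u, v} k} {U : SigmaModule.{u, v} k} (A : RightModuleAlgebra P U)
variable (G : ℕ → DGModule.{u, v} k)
variable {L : Type} [Fintype L] [LinearOrder L] (E : L → Type) [∀ i, Finite (E i)]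
variable {m : ℕ} (h : L → Fin (m + 1))
variable {s : ∀ i, P.obj (E i)} {q : L → ℤ} (hs : ∀ i, s i ∈ (P.obj (E i)).grading (q i))

include hs

theorem actZero_mem {r : ℤ} {u : U.obj {y // h y = 0}}
    (hu : u ∈ (U.obj {y // h y = 0}).grading r) :
    actZero A E h s u ∈ (U.obj {z : Σ i, E i // (h ∘ Sigma.fst) z = 0}).grading
      (r + ∑ i, if h i = 0 then q i else 0) := by
  rw [← sum_subtype_eq (p := fun i => h i = 0)]
  exact U.map_mem _ _ _ (A.isRightComp.comp_mem _ _ _ _ _ _ hu fun i => hs i.1)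

theorem actSucc_mem {r : ℤ} {j : Fin m} {t : P.obj {y // h y = j.succ}}
    (ht : t ∈ (P.obj {y // h y = j.succ}).grading r) :
    actSucc E h s j t ∈ (P.obj {z : Σ i, E i // (h ∘ Sigma.fst) z = j.succ}).grading
      (r + ∑ i, if h i = j.succ then q i else 0) := by
  rw [← sum_subtype_eq (p := fun i => h i = j.succ)]
  exact P.map_mem _ _ _ (P.isRightComp.comp_mem _ _ _ _ _ _ ht fun i => hs i.1)

variable {t : ∀ j : Fin m, P.obj {y : L // h y = j.succ}} {τ : Fin m → ℤ}
    (ht : ∀ j, t j ∈ (P.obj {y : L // h y = j.succ}).grading (τ j))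
    {r : ℤ} {u : U.obj {y // h y = 0}} (hu : u ∈ (U.obj {y // h y = 0}).grading r)

include ht hu

/-- Both ways of inserting $s$ into $u\cdot x(t)$ agree factor by factor, by associativity in `U`
and in `P`. The block signs collected on the way combine to the stated one by `core_exp`; the total
degree $n$ of $x$ plays the role of the degree of the generator. -/
theorem act_map_mul_act {n : ℤ} {x : FreeObj U G P.toSigmaModule (Fin m)}
    (hx : x ∈ grading U G P.toSigmaModule (Fin m) n) :
    act A G E s (map U G P.toSigmaModule (fiberDecomp h)
      (mul A G _ _ u (act A G (fun j : Fin m => {y // h y = j.succ}) t x))) =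
    ((actExp h n τ q).negOnePow : ℤˣ) •
      map U G P.toSigmaModule (fiberDecomp (h ∘ Sigma.fst))
        (mul A G _ _ (actZero A E h s u)
          (act A G (fun j : Fin m => {z : Σ i, E i // (h ∘ Sigma.fst) z = j.succ})
            (fun j => actSucc E h s j (t j)) x)) := by
  induction hx using Submodule.span_induction with
  | zero => simp
  | add x y _ _ hx hy => simp only [map_add, hx, hy, smul_add]
  | smul a x _ hx => simp only [map_smul, hx]; rw [smul_comm]
  | mem x hx =>
    obtain ⟨m', f, ω, γ, τ', w, g, t', hw, hg, ht', rfl, rfl⟩ := hx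
    change act A G E s (map U G P.toSigmaModule (fiberDecomp h)
      (mul A G _ _ u (act A G (fun j : Fin m => {y // h y = j.succ}) t (gen f w g t')))) = _ •
      map U G P.toSigmaModule (fiberDecomp (h ∘ Sigma.fst))
        (mul A G _ _ (actZero A E h s u)
          (act A G (fun j : Fin m => {z : Σ i, E i // (h ∘ Sigma.fst) z = j.succ})
            (fun j => actSucc E h s j (t j)) (gen f w g t')))
    have hT : ∀ i, actSucc (fun j => {y // h y = j.succ}) f t i (t' i) ∈
        (P.obj _).grading (τ' i + ∑ j, if f j = i.succ then τ j else 0) := fun i =>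
      actSucc_mem _ f ht (ht' i)
    rw [act_gen A G _ hg ht' ht, act_gen A G _ hg ht' (fun j => actSucc_mem E h hs (ht j))]
    simp only [LinearMap.map_smul_of_tower, mul_gen, map_gen]
    rw [act_gen A G E hg (fun i => P.map_mem _ _ _ (P.map_mem _ _ _ (hT i))) hs]
    -- The labellings of $\bigsqcup_i E_i$ obtained before and after the insertion agree only
    -- pointwise; `θ₀` and `θ` incorporate the resulting identification.
    have hκ : ∀ z : Σ i, E i, (glue h f ∘ Sigma.fst) z = (Sum.elim (fun _ => 0) (f ∘ Sigma.fst) ∘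
        (fiberDecomp (h ∘ Sigma.fst : (Σ i, E i) → Fin (m + 1))).symm) z := fun z =>
      (glue_eq h f z.1).trans (glue_eq (h ∘ Sigma.fst : (Σ i, E i) → Fin (m + 1)) f z).symm
    let θ₀ : {z : Σ i, E i // (h ∘ Sigma.fst) z = 0} ⊕
        {z : Σ j, {z : Σ i, E i // (h ∘ Sigma.fst) z = j.succ} // (f ∘ Sigma.fst) z = 0} ≃
        {z : Σ i, E i // (glue h f ∘ Sigma.fst) z = 0} :=
      (fiberSumZero _ _).trans ((fiberRelabel (fiberDecomp (h ∘ Sigma.fst)) _ 0).trans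
        (Equiv.subtypeEquivRight fun z => by rw [hκ z]))
    let θ : ∀ i : Fin m', {z : Σ j, {z : Σ i, E i // (h ∘ Sigma.fst) z = j.succ} //
        (f ∘ Sigma.fst) z = i.succ} ≃ {z : Σ i, E i // (glue h f ∘ Sigma.fst) z = i.succ} :=
      fun i => (fiberSumSucc {z : Σ i, E i // (h ∘ Sigma.fst) z = 0} _ i).trans
        ((fiberRelabel (fiberDecomp (h ∘ Sigma.fst)) _ i.succ).trans
          (Equiv.subtypeEquivRight fun z => by rw [hκ z]))
    rw [actZero_mul_actZero h f A θ₀ (fun _ => rfl) (fun _ => rfl) hs ht hu hw]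
    simp only [fun i => actSucc_actSucc h f (θ i) (fun _ => rfl) hs ht (t' i)]
    rw [gen_smul_left, gen_smul_right, ← negOnePow_sum]
    simp only [smul_smul, ← Int.negOnePow_add]
    congr 1
    · refine negOnePow_eq_of_cast_eq (Eq.trans ?_ (core_exp h f γ ω τ' τ q))
      rw [Fin.sum_univ_succ]
      push_cast
      ring
    · refine gen_congr (funext hκ) ?_ fun i => ?_
      · rw [U.map_map, U.map_map]
        exact U.map_congr (by rintro (z | z) <;> rfl) _
      · rw [P.map_map, P.map_map]
        exact P.map_congr (fun _ => rfl) _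

end Core

section Induced

variable {P : Operad.{u, v} k} {U : SigmaModule.{u, v} k} (A : RightModuleAlgebra P U)
variable (G : ℕ → DGModule.{u, v} k)
variable (f : ∀ m : ℕ, G m →ₗ[k] FreeObj U G P.toSigmaModule (Fin m))
variable {L : Type} [Fintype L] [LinearOrder L] (E : L → Type) [∀ i, Finite (E i)]
variable {s : ∀ i, P.obj (E i)} {q : L → ℤ} (hs : ∀ i, s i ∈ (P.obj (E i)).grading (q i))

include hs

/-- The degree $-1$ of $f$ matters: replacing $\gamma$ by $\gamma-1$ in the sign of the action
compensates the change of $(-1)^{|u|}$ when elements of $s$ are inserted into $u$. -/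
theorem induced_act (hf : ∀ (m : ℕ) (n : ℤ) (g : G m), g ∈ (G m).grading n →
      f m g ∈ grading U G P.toSigmaModule (Fin m) (n - 1))
    (z : FreeObj U G P.toSigmaModule L) :
    induced A G f (Σ i, E i) (act A G E s z) = act A G E s (induced A G f L z) := by
  rw [← LinearMap.comp_apply, ← LinearMap.comp_apply]
  congr 1
  refine hom_ext fun m h p γ τ u g t hu hg ht => ?_
  rw [LinearMap.comp_apply, LinearMap.comp_apply, act_gen A G E hg ht hs,
    induced_gen_of_mem A G f hu, LinearMap.map_smul_of_tower, LinearMap.map_smul_of_tower,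
    induced_gen_of_mem A G f (actZero_mem A E h hs hu),
    act_map_mul_act A G E h hs ht hu (hf _ _ _ hg), smul_smul, smul_smul, ← Int.negOnePow_add,
    ← Int.negOnePow_add]
  congr 1
  refine negOnePow_eq_of_cast_eq ?_
  unfold actExp
  have h1 : ∑ i, (if h i = 0 then (γ - 1) * q i else 0) =
      (∑ i, if h i = 0 then γ * q i else 0) - ∑ i, if h i = 0 then q i else 0 := by
    rw [← Finset.sum_sub_distrib]
    refine Finset.sum_congr rfl fun i _ => ?_
    split_ifs <;> ring
  have two : (2 : ZMod 2) = 0 := rfl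
  rw [h1]
  generalize (∑ i, if h i = 0 then q i else 0) = a
  generalize (∑ i, if h i = 0 then γ * q i else 0) = b
  push_cast
  linear_combination (a : ZMod 2) * two

end Induced

end FreeObj

end OperadLifting

namespace OperadLifting

variable {k : Type u} [CommRing k]

namespace FreeObj

/-! ### The differential and the right action -/

section Signs

variable {L : Type} [Fintype L] [LinearOrder L] {m : ℕ} (h : L → Fin (m + 1))

theorem cast_actExp_sub_one (γ : ℤ) (τ : Fin m → ℤ) (q : L → ℤ) :
    ((actExp h (γ - 1) τ q : ℤ) : ZMod 2) =
      (actExp h γ τ q : ℤ) - ∑ x, ind (h x = 0) * (q x : ZMod 2) := by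
  rw [cast_actExp, cast_actExp]
  push_cast
  simp only [sub_mul, mul_sub, one_mul, Finset.sum_sub_distrib]
  ring

theorem cast_actExp_update_left (γ : ℤ) (τ : Fin m → ℤ) (q : L → ℤ) (j : Fin m) :
    ((actExp h γ (Function.update τ j (τ j - 1)) q : ℤ) : ZMod 2) =
      (actExp h γ τ q : ℤ) - ∑ x, ind (h x < j.succ) * (q x : ZMod 2) := by
  have h1 : ∀ i, ((Function.update τ j (τ j - 1) i : ℤ) : ZMod 2) = τ i - ind (i = j) := by
    intro i
    by_cases hi : i = j
    · subst hi
      simp [ind]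
    · simp [ind, hi]
  rw [cast_actExp, cast_actExp]
  simp only [h1, sub_mul, mul_sub, Finset.sum_sub_distrib]
  have h2 : ∑ i, ∑ x, ind (h x < i.succ) * (ind (i = j) * (q x : ZMod 2)) =
      ∑ x, ind (h x < j.succ) * (q x : ZMod 2) := by
    rw [Finset.sum_eq_single j]
    · simp [ind]
    · intro i _ hi
      simp [ind, hi]
    · simp
  rw [h2]
  ring

/-- The correction is the total degree of what $s_i$ crosses in the reordering: the $s_y$ inverted
with it, the $t_j$ standing behind its place, and $g$ if it goes into $u$. -/
theorem cast_actExp_update_right (γ : ℤ) (τ : Fin m → ℤ) (q : L → ℤ) (i : L) :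
    ((actExp h γ τ (Function.update q i (q i - 1)) : ℤ) : ZMod 2) =
      (actExp h γ τ q : ℤ) -
        (∑ y, ind ((i < y ∧ h y < h i) ∨ (y < i ∧ h i < h y)) * (q y : ZMod 2) +
          ∑ j, ind (h i < j.succ) * (τ j : ZMod 2) + ind (h i = 0) * (γ : ZMod 2)) := by
  have h1 : ∀ x, ((Function.update q i (q i - 1) x : ℤ) : ZMod 2) = q x - ind (x = i) := by
    intro x
    by_cases hx : x = i
    · subst hx
      simp [ind]
    · simp [ind, hx]
  have single : ∀ F : L → ZMod 2, ∑ x, F x * ind (x = i) = F i := by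
    intro F
    rw [Finset.sum_eq_single i]
    · simp [ind]
    · intro x _ hx
      simp [ind, hx]
    · simp
  rw [cast_actExp, cast_actExp]
  simp only [h1, sub_mul, mul_sub, Finset.sum_sub_distrib, ← mul_assoc, single]
  have e1 : ∑ x, ∑ y, ind (x < y ∧ h y < h x) * ind (x = i) * (q y : ZMod 2) =
      ∑ y, ind (i < y ∧ h y < h i) * (q y : ZMod 2) := by
    rw [Finset.sum_comm]
    refine Finset.sum_congr rfl fun y _ => ?_
    rw [← Finset.sum_mul, single fun x => ind (x < y ∧ h y < h x)]
  have e2 : ∑ y, ind ((i < y ∧ h y < h i) ∨ (y < i ∧ h i < h y)) * (q y : ZMod 2) =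
      ∑ y, ind (i < y ∧ h y < h i) * (q y : ZMod 2) +
        ∑ y, ind (y < i ∧ h i < h y) * (q y : ZMod 2) := by
    rw [← Finset.sum_add_distrib]
    refine Finset.sum_congr rfl fun y _ => ?_
    rcases lt_trichotomy i y with hy | hy | hy
    · simp [ind, hy, hy.not_gt]
    · simp [ind, hy]
    · simp [ind, hy, hy.not_gt]
  have e3 : ind (i < i ∧ h i < h i) = 0 := by simp [ind]
  rw [e1, e2, e3]
  ring

omit [LinearOrder L] in
-- Accounts for the elements of $s$ inserted ahead of the $j$th factor: those with $h=0$ sit in $u$,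
-- the others in the preceding factors.
theorem cast_sum_degree_lt (τ : Fin m → ℤ) (q : L → ℤ) (j : Fin m) :
    ((∑ i, (if i < j then τ i + ∑ x, (if h x = i.succ then q x else 0) else 0) : ℤ) : ZMod 2) +
      ∑ x, ind (h x = 0) * (q x : ZMod 2) =
      ∑ i, ind (i < j) * (τ i : ZMod 2) + ∑ x, ind (h x < j.succ) * (q x : ZMod 2) := by
  simp only [Int.cast_add, Int.cast_sum, cast_ite_eq, mul_add, Finset.sum_add_distrib]
  have e1 := sum_mul_sum_fiber h (fun κ => ind (κ ≠ 0 ∧ κ < j.succ)) (by simp [ind])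
    (fun x => (q x : ZMod 2))
  simp only [ne_eq, Fin.succ_ne_zero, not_false_eq_true, true_and, Fin.succ_lt_succ_iff] at e1
  rw [e1, add_assoc, ← Finset.sum_add_distrib]
  congr 1
  refine Finset.sum_congr rfl fun x _ => ?_
  by_cases hx : h x = 0 <;> simp [ind, hx]

/-- Reordering and then differentiating $s_i$ inside the factor in `U` gives the same sign as
differentiating first. The same check for the factors in `P` is `exp_succ`. -/
theorem exp_zero (p γ : ℤ) (τ : Fin m → ℤ) (q : L → ℤ) {i : L} (hi : h i = 0) :
    ((actExp h γ τ q + (p + ∑ y, if y < i ∧ h y = 0 then q y else 0) : ℤ) : ZMod 2) =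
      ((p + γ + ∑ j, τ j + (∑ y, if y < i then q y else 0) +
        actExp h γ τ (Function.update q i (q i - 1)) : ℤ) : ZMod 2) := by
  rw [Int.cast_add, Int.cast_add _ (actExp _ _ _ _), cast_actExp_update_right]
  simp only [Int.cast_add, Int.cast_sum, cast_ite_eq, hi]
  have e1 : ∑ y, ind (y < i) * (q y : ZMod 2) = ∑ y, ind (y < i ∧ h y = 0) * (q y : ZMod 2) +
      ∑ y, ind ((i < y ∧ h y < 0) ∨ (y < i ∧ 0 < h y)) * (q y : ZMod 2) := by
    rw [← Finset.sum_add_distrib]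
    refine Finset.sum_congr rfl fun y _ => ?_
    by_cases hy : y < i <;> by_cases h0 : h y = 0 <;> simp [ind, hy, h0, Fin.pos_iff_ne_zero]
  have e2 : ∑ j : Fin m, ind (0 < j.succ) * (τ j : ZMod 2) = ∑ j, (τ j : ZMod 2) := by
    simp [ind]
  rw [e1, e2]
  simp only [ind, if_true]
  ring

theorem exp_succ (p γ : ℤ) (τ : Fin m → ℤ) (q : L → ℤ) {i : L} {j : Fin m} (hi : h i = j.succ) :
    ((actExp h γ τ q + (p + (∑ x, if h x = 0 then q x else 0) + γ +
        (∑ j', if j' < j then τ j' + ∑ x, (if h x = j'.succ then q x else 0) else 0) +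
        (τ j + ∑ y, if y < i ∧ h y = j.succ then q y else 0)) : ℤ) : ZMod 2) =
      ((p + γ + ∑ j, τ j + (∑ y, if y < i then q y else 0) +
        actExp h γ τ (Function.update q i (q i - 1)) : ℤ) : ZMod 2) := by
  have e0 := cast_sum_degree_lt h τ q j
  rw [Int.cast_add _ (actExp _ _ _ _), cast_actExp_update_right]
  rw [Int.cast_add, Int.cast_add _ (τ j + _), Int.cast_add _ (∑ j', if j' < j then _ else _),
    eq_sub_of_add_eq e0]
  simp only [Int.cast_add, Int.cast_sum, cast_ite_eq, hi]
  have e1 : ∑ x, ind (h x < j.succ) * (q x : ZMod 2) +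
      ∑ y, ind (y < i ∧ h y = j.succ) * (q y : ZMod 2) =
      ∑ y, ind (y < i) * (q y : ZMod 2) -
      ∑ y, ind ((i < y ∧ h y < j.succ) ∨ (y < i ∧ j.succ < h y)) * (q y : ZMod 2) := by
    rw [← Finset.sum_add_distrib, ← Finset.sum_sub_distrib]
    refine Finset.sum_congr rfl fun y _ => ?_
    have two : (2 : ZMod 2) = 0 := rfl
    rcases lt_trichotomy y i with hy | rfl | hy
    · rcases lt_trichotomy (h y) j.succ with h0 | h0 | h0
      · simp [ind, hy, h0, h0.ne, h0.not_gt, hy.not_gt]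
      · simp [ind, hy, h0]
      · simp [ind, hy, h0, h0.ne', h0.not_gt]
    · simp [ind, hi]
    · by_cases h0 : h y < j.succ
      · simp only [ind, hy, h0, hy.not_gt]
        simp only [false_and, and_self, or_false, if_true, if_false]
        linear_combination (q y : ZMod 2) * two
      · simp [ind, hy.not_gt, h0]
  have e2 : ∑ j', ind (j' < j) * (τ j' : ZMod 2) + τ j = ∑ j', (τ j' : ZMod 2) -
      ∑ j', ind (j.succ < j'.succ) * (τ j' : ZMod 2) := by
    have e3 : (τ j : ZMod 2) = ∑ j', ind (j' = j) * (τ j' : ZMod 2) := by simp [ind]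
    rw [e3, ← Finset.sum_add_distrib, ← Finset.sum_sub_distrib]
    refine Finset.sum_congr rfl fun y _ => ?_
    rcases lt_trichotomy y j with hy | rfl | hy
    · simp [ind, hy, hy.ne, hy.not_gt]
    · simp [ind]
    · simp [ind, hy, hy.ne', hy.not_gt]
  have e4 : ind (j.succ = 0) = 0 := by simp [ind]
  rw [e4]
  linear_combination e1 + e2

end Signs

section Act

variable {P : Operad.{u, v} k} {U : SigmaModule.{u, v} k} (A : RightModuleAlgebra P U)
variable (G : ℕ → DGModule.{u, v} k)
variable {L : Type} [Fintype L] [LinearOrder L] (E : L → Type) [∀ i, Finite (E i)]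
variable {m : ℕ} (h : L → Fin (m + 1))
variable {s : ∀ i, P.obj (E i)} {q : L → ℤ} (hs : ∀ i, s i ∈ (P.obj (E i)).grading (q i))

include hs

theorem d_actZero {p : ℤ} {u : U.obj {y // h y = 0}} (hu : u ∈ (U.obj {y // h y = 0}).grading p) :
    (U.obj _).d (actZero A E h s u) = actZero A E h s ((U.obj _).d u) +
      ∑ i : {y // h y = 0}, ((p + ∑ y, if y < i.1 ∧ h y = 0 then q y else 0).negOnePow : ℤˣ) •
        actZero A E h (Function.update s i.1 ((P.obj _).d (s i.1))) u := by
  unfold actZero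
  simp only [LinearMap.comp_apply]
  rw [← U.map_d, A.isRightComp.comp_d _ _ p (fun i => q i.1) u _ hu fun i => hs i.1, map_add,
    map_sum]
  congr 1
  refine Finset.sum_congr rfl fun i _ => ?_
  rw [LinearMap.map_smul_of_tower, restrict_update_of_eq h i.2]
  congr 3
  simp only [← Subtype.coe_lt_coe]
  rw [sum_subtype_eq (p := fun y => h y = 0) fun y => if y < i.1 then q y else 0]
  simp only [← ite_and]
  exact Finset.sum_congr rfl fun y _ => if_congr (by tauto) rfl rfl

theorem d_actSucc {r : ℤ} {j : Fin m} {t : P.obj {y // h y = j.succ}}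
    (ht : t ∈ (P.obj {y // h y = j.succ}).grading r) :
    (P.obj _).d (actSucc E h s j t) = actSucc E h s j ((P.obj _).d t) +
      ∑ i : {y // h y = j.succ},
        ((r + ∑ y, if y < i.1 ∧ h y = j.succ then q y else 0).negOnePow : ℤˣ) •
        actSucc E h (Function.update s i.1 ((P.obj _).d (s i.1))) j t := by
  unfold actSucc
  simp only [LinearMap.comp_apply]
  rw [← P.map_d, P.isRightComp.comp_d _ _ r (fun i => q i.1) t _ ht fun i => hs i.1, map_add,
    map_sum]
  congr 1
  refine Finset.sum_congr rfl fun i _ => ?_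
  rw [LinearMap.map_smul_of_tower, restrict_update_of_eq h i.2]
  congr 3
  simp only [← Subtype.coe_lt_coe]
  rw [sum_subtype_eq (p := fun y => h y = j.succ) fun y => if y < i.1 then q y else 0]
  simp only [← ite_and]
  exact Finset.sum_congr rfl fun y _ => if_congr (by tauto) rfl rfl

/-- Both sides expand into terms in which $d$ hits $u$, $g$, one $t_j$ or one $s_i$. They match term
by term, and each match is one of the preceding sign identities. -/
theorem d_act {n : ℤ} {z : FreeObj U G P.toSigmaModule L}
    (hz : z ∈ grading U G P.toSigmaModule L n) :
    d U G P.toSigmaModule (Σ i, E i) (act A G E s z) =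
      act A G E s (d U G P.toSigmaModule L z) +
        ∑ i, ((n + ∑ y, if y < i then q y else 0).negOnePow : ℤˣ) •
          act A G E (Function.update s i ((P.obj (E i)).d (s i))) z := by
  induction hz using Submodule.span_induction with
  | zero => simp
  | add x y _ _ hx hy =>
    simp only [map_add, hx, hy, smul_add, Finset.sum_add_distrib]
    abel
  | smul a x _ hx =>
    simp only [map_smul, hx, smul_add, Finset.smul_sum]
    congr 1
    exact Finset.sum_congr rfl fun i _ => smul_comm _ _ _
  | mem x hx =>
    obtain ⟨m, h, p, γ, τ, u, g, t, hu, hg, ht, rfl, rfl⟩ := hx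
    change d U G P.toSigmaModule (Σ i, E i) (act A G E s (gen h u g t)) =
      act A G E s (d U G P.toSigmaModule L (gen h u g t)) +
        ∑ i, _ • act A G E (Function.update s i ((P.obj (E i)).d (s i))) (gen h u g t)
    have two : (2 : ZMod 2) = 0 := rfl
    have hs' : ∀ i y, Function.update s i ((P.obj (E i)).d (s i)) y ∈
        (P.obj (E y)).grading (Function.update q i (q i - 1) y) := by
      intro i y
      by_cases hy : y = i
      · subst hy
        simpa using (P.obj (E y)).d_mem _ _ (hs y)
      · simpa [hy] using hs y
    have ht' : ∀ i y, Function.update t i ((P.obj _).d (t i)) y ∈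
        (P.obj {x // h x = y.succ}).grading (Function.update τ i (τ i - 1) y) := by
      intro i y
      by_cases hy : y = i
      · subst hy
        simpa using (P.obj _).d_mem _ _ (ht y)
      · simpa [hy] using ht y
    -- The terms with $d s_i$ are sorted by the tensor factor into which $s_i$ is inserted.
    have split : ∀ F : L → FreeObj U G P.toSigmaModule (Σ i, E i), ∑ i, F i =
        ∑ i : {y // h y = 0}, F i.1 + ∑ j : Fin m, ∑ i : {y // h y = j.succ}, F i.1 := by
      intro F
      rw [← Equiv.sum_comp (fiberDecomp h), Fintype.sum_sum_type, Fintype.sum_sigma]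
      rfl
    rw [act_gen A G E hg ht hs, LinearMap.map_smul_of_tower,
      d_gen (actZero_mem A E h hs hu) hg (fun j => actSucc_mem E h hs (ht j)), d_gen hu hg ht]
    simp only [map_add, map_sum, LinearMap.map_smul_of_tower, act_gen A G E hg ht hs,
      act_gen A G E ((G m).d_mem _ _ hg) ht hs, act_gen A G E hg (ht' _) hs,
      act_gen A G E hg ht (hs' _), d_actZero A E h hs hu, d_actSucc E h hs (ht _), gen_add_left,
      gen_sum_left, gen_smul_left, gen_update_add, gen_update_sum, gen_update_smul, smul_add,
      Finset.smul_sum, smul_smul, Finset.sum_add_distrib, split, ← Int.negOnePow_add]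
    have e1 : ∀ j, (fun j' => actSucc E h s j' (Function.update t j ((P.obj _).d (t j)) j')) =
        Function.update (fun j' => actSucc E h s j' (t j')) j
          (actSucc E h s j ((P.obj _).d (t j))) := fun j =>
      funext fun j' => Function.apply_update (fun j' x => actSucc E h s j' x) t j _ j'
    simp only [e1]
    rw [show ∀ a b c d f : FreeObj U G P.toSigmaModule (Σ i, E i),
      a + b + (c + (d + f)) = a + (c + d) + (b + f) from fun a b c d f => by abel]
    refine congrArg₂ (· + ·) (congrArg₂ (· + ·) rfl (congrArg₂ (· + ·) ?_
      (Finset.sum_congr rfl fun j _ => ?_))) (congrArg₂ (· + ·) (Finset.sum_congr rfl fun i _ => ?_)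
      (Finset.sum_congr rfl fun j _ => Finset.sum_congr rfl fun i _ => ?_))
    · congr 1
      refine negOnePow_eq_of_cast_eq ?_
      rw [Int.cast_add _ (actExp _ _ _ _), cast_actExp_sub_one]
      simp only [Int.cast_add, Int.cast_sum, cast_ite_eq]
      linear_combination (∑ x, ind (h x = 0) * (q x : ZMod 2)) * two
    · congr 1
      refine negOnePow_eq_of_cast_eq ?_
      have e2 := cast_sum_degree_lt h τ q j
      rw [Int.cast_add _ (actExp _ _ _ _), cast_actExp_update_left, Int.cast_add, Int.cast_add _
        (∑ i, if i < j then _ else _), eq_sub_of_add_eq e2]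
      simp only [Int.cast_add, Int.cast_sum, cast_ite_eq]
      linear_combination (∑ x, ind (h x < j.succ) * (q x : ZMod 2)) * two
    · rw [negOnePow_eq_of_cast_eq (exp_zero h p γ τ q i.2)]
      congr 2
      funext j
      rw [actSucc_update_of_ne E h s (fun hj => Fin.succ_ne_zero j (hj.symm.trans i.2))]
    · rw [negOnePow_eq_of_cast_eq (exp_succ h p γ τ q i.2),
        actZero_update_of_ne A E h s (fun hj => Fin.succ_ne_zero j (i.2.symm.trans hj))]
      congr 2
      conv_rhs => rw [actSucc_update E h s i.2]
      funext j'
      exact (Function.apply_update (fun j' (x : P.obj {y // h y = j'.succ} →ₗ[k] _) => x (t j'))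
        (actSucc E h s) j _ j').symm

end Act

end FreeObj

end OperadLifting

namespace OperadLifting

variable {k : Type u} [CommRing k]

theorem negOnePow_smul_add_smul_eq_zero {M : Type*} [AddCommGroup M] {a b : ℤ}
    (h : ((a + b : ℤ) : ZMod 2) = 1) (x : M) :
    (a.negOnePow : ℤˣ) • x + (b.negOnePow : ℤˣ) • x = 0 := by
  have two : (2 : ZMod 2) = 0 := rfl
  have h1 : a.negOnePow = (b + 1).negOnePow := by
    refine negOnePow_eq_of_cast_eq ?_
    push_cast at h ⊢
    linear_combination h - (b : ZMod 2) * two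
  rw [h1, Int.negOnePow_succ, Units.neg_smul, neg_add_cancel]

theorem negOnePow_add_self_smul {M : Type*} [AddCommGroup M] (p : ℤ) (x : M) :
    ((p + p).negOnePow : ℤˣ) • x = x := by
  rw [Int.negOnePow_even _ ⟨p, rfl⟩, one_smul]

/-- The cancellation pattern of an anticommutator: only the terms involving the generator survive.
-/
theorem add_sum_add_add_sum {M ι : Type*} [AddCommGroup M] {s : Finset ι} {a b a' b' x : M}
    {c c' : ι → M} (ha : a + a' = 0) (hb : b + b' = x) (hc : ∀ i ∈ s, c i + c' i = 0) :
    a + (b + ∑ i ∈ s, c i) + (a' + (b' + ∑ i ∈ s, c' i)) = x := by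
  have h : a + (b + ∑ i ∈ s, c i) + (a' + (b' + ∑ i ∈ s, c' i)) =
      (a + a') + (b + b') + ∑ i ∈ s, (c i + c' i) := by
    rw [Finset.sum_add_distrib]
    abel
  rw [h, ha, hb, Finset.sum_eq_zero hc, zero_add, add_zero]

namespace FreeObj

/-! ### The morphisms `∂_f` -/

section Ext

variable {P : Operad.{u, v} k} {U : SigmaModule.{u, v} k} (A : RightModuleAlgebra P U)
variable (G : ℕ → DGModule.{u, v} k)
variable (f f' : ∀ m : ℕ, G m →ₗ[k] FreeObj U G P.toSigmaModule (Fin m))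

/-- The extension `u ⊗ g ⊗ s ↦ u · f(g)(s)` of `f` to `U ⊗ (K ∘ P)`, without sign. -/
noncomputable def ext (e : Type) [Finite e] :
    FreeObj U G P.toSigmaModule e →ₗ[k] FreeObj U G P.toSigmaModule e :=
  desc U G P.toSigmaModule e (fun x =>
    map U G P.toSigmaModule (fiberDecomp x.2) ∘ₗ
      TensorProduct.lift
        ((mulₗ A G {y : e // x.2 y = 0} (Σ j : Fin x.1, {y : e // x.2 y = j.succ})).compl₂
          (TensorProduct.lift
            ((PiTensorProduct.lift (act A G (fun j : Fin x.1 => {y : e // x.2 y = j.succ}))).flip ∘ₗ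
              f x.1))))

variable {e : Type} [Finite e]

theorem ext_gen {m : ℕ} (h : e → Fin (m + 1)) (u : U.obj {y : e // h y = 0}) (g : G m)
    (t : ∀ j : Fin m, P.obj {y : e // h y = j.succ}) :
    ext A G f e (gen h u g t) = map U G P.toSigmaModule (fiberDecomp h)
      (mul A G _ _ u (act A G (fun j : Fin m => {y : e // h y = j.succ}) t (f m g))) := by
  unfold ext gen
  rw [desc_incl]
  simp [mulₗ]

theorem ext_add (z : FreeObj U G P.toSigmaModule e) :
    ext A G (fun m => f m + f' m) e z = ext A G f e z + ext A G f' e z := by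
  rw [← LinearMap.add_apply]
  congr 1
  refine hom_ext fun m h p q r u g t hu hg ht => ?_
  simp only [LinearMap.add_apply, ext_gen, map_add]

theorem induced_sub (z : FreeObj U G P.toSigmaModule e) :
    induced A G (fun m => f m - f' m) e z = induced A G f e z - induced A G f' e z := by
  rw [← LinearMap.sub_apply]
  congr 1
  refine hom_ext fun m h p q r u g t hu hg ht => ?_
  simp only [LinearMap.sub_apply, induced_gen, map_sub]

variable {f}
variable (hf : ∀ (m : ℕ) (n : ℤ) (g : G m), g ∈ (G m).grading n →
  f m g ∈ grading U G P.toSigmaModule (Fin m) (n - 1))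

include hf

/-- Moving the outer $\partial_f$ past $u$ and through the right action leaves it on $f(g)$. The
signs $(-1)^{|u|}$ from the two applications cancel, hence the unsigned extension. -/
theorem induced_induced (z : FreeObj U G P.toSigmaModule e) :
    induced A G f e (induced A G f e z) = ext A G (fun m => induced A G f (Fin m) ∘ₗ f m) e z := by
  rw [← LinearMap.comp_apply]
  congr 1
  refine hom_ext fun m h p q r u g t hu hg ht => ?_
  rw [LinearMap.comp_apply, ext_gen, induced_gen_of_mem A G f hu, LinearMap.map_smul_of_tower,
    induced_map, induced_mul A G f hu, LinearMap.map_smul_of_tower, smul_smul,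
    induced_act A G f _ ht hf, ← Int.negOnePow_add, Int.negOnePow_even _ ⟨p, rfl⟩, one_smul]
  rfl

/-- The terms in which $d$ hits $u$ or some $t_j$ occur twice with opposite signs, since
$\partial_f$ is odd; those with $d$ on $f(g)$ or on $g$ remain. -/
theorem d_induced_add (z : FreeObj U G P.toSigmaModule e) :
    d U G P.toSigmaModule e (induced A G f e z) + induced A G f e (d U G P.toSigmaModule e z) =
      ext A G (fun m => d U G P.toSigmaModule (Fin m) ∘ₗ f m + f m ∘ₗ (G m).d) e z := by
  rw [← LinearMap.comp_apply, ← LinearMap.comp_apply, ← LinearMap.add_apply]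
  congr 1
  refine hom_ext fun m h p q r u g t hu hg ht => ?_
  have ht' : ∀ i y, Function.update t i ((P.obj _).d (t i)) y ∈
      (P.obj {x // h x = y.succ}).grading (Function.update r i (r i - 1) y) := by
    intro i y
    by_cases hy : y = i
    · subst hy
      simpa using (P.obj _).d_mem _ _ (ht y)
    · simpa [hy] using ht y
  rw [LinearMap.add_apply, LinearMap.comp_apply, LinearMap.comp_apply, ext_gen,
    induced_gen_of_mem A G f hu, LinearMap.map_smul_of_tower, d_map, d_mul A G hu,
    d_act A G _ ht (hf m q g hg), d_gen hu hg ht]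
  simp only [map_add, map_sum, LinearMap.map_smul_of_tower, induced_gen_of_mem A G f hu,
    induced_gen_of_mem A G f ((U.obj _).d_mem _ _ hu), LinearMap.add_apply, LinearMap.comp_apply,
    smul_add, Finset.smul_sum, smul_smul, ← Int.negOnePow_add]
  have two : (2 : ZMod 2) = 0 := rfl
  refine add_sum_add_add_sum (negOnePow_smul_add_smul_eq_zero ?_ _) ?_ fun j _ =>
    negOnePow_smul_add_smul_eq_zero ?_ _
  · push_cast
    linear_combination (p : ZMod 2) * two - two
  · exact congrArg₂ (· + ·) (negOnePow_add_self_smul _ _) (negOnePow_add_self_smul _ _)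
  · push_cast
    linear_combination ((p : ZMod 2) + p + q + ∑ i, if i < j then (r i : ZMod 2) else 0) * two -
      two

end Ext

/-! ### Change of the operad -/

section MapRight

variable {U : SigmaModule.{u, v} k} {G : ℕ → DGModule.{u, v} k}

/-- Only an arity-wise chain map is needed, so this covers $\iota$, which is not a morphism of
operads. -/
theorem d_mapRight {P Q : SigmaModule.{u, v} k}
    (φ : (e : Type) → [Finite e] → (P.obj e →ₗ[k] Q.obj e))
    (hφ : ∀ (e : Type) [Finite e] (n : ℤ) (x : P.obj e),
      x ∈ (P.obj e).grading n → φ e x ∈ (Q.obj e).grading n)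
    (hφ_d : ∀ (e : Type) [Finite e] (x : P.obj e), φ e ((P.obj e).d x) = (Q.obj e).d (φ e x))
    {e : Type} [Finite e] (z : FreeObj U G P e) :
    mapRight U G φ e (d U G P e z) = d U G Q e (mapRight U G φ e z) := by
  rw [← LinearMap.comp_apply, ← LinearMap.comp_apply]
  congr 1
  refine hom_ext fun m h p q r u g t hu hg ht => ?_
  rw [LinearMap.comp_apply, LinearMap.comp_apply, mapRight_gen, d_gen hu hg ht,
    d_gen hu hg (fun j => hφ _ _ _ (ht j))]
  simp only [map_add, map_sum, LinearMap.map_smul_of_tower, mapRight_gen]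
  congr 2
  refine Finset.sum_congr rfl fun j _ => ?_
  congr 2
  funext i
  rw [← hφ_d]
  exact Function.apply_update (fun i x => φ {y : e // h y = i.succ} x) t j _ i

variable {R S : Operad.{u, v} k} (ψ : OperadHom R S) (A : RightModuleAlgebra S U)

theorem mapRight_map {e e' : Type} [Finite e] [Finite e'] (σ : e ≃ e')
    (z : FreeObj U G R.toSigmaModule e) :
    mapRight U G ψ.toFun e' (map U G R.toSigmaModule σ z) =
      map U G S.toSigmaModule σ (mapRight U G ψ.toFun e z) := by
  rw [← LinearMap.comp_apply, ← LinearMap.comp_apply]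
  congr 1
  refine hom_ext fun m h p q r u g t hu hg ht => ?_
  simp only [LinearMap.comp_apply, mapRight_gen, map_gen, ψ.toFun_map]

theorem mapRight_mul {c e : Type} [Finite c] [Finite e] (v : U.obj c)
    (z : FreeObj U G R.toSigmaModule e) :
    mapRight U G ψ.toFun (c ⊕ e) (mul (A.restrict ψ) G c e v z) =
      mul A G c e v (mapRight U G ψ.toFun e z) := by
  rw [← LinearMap.comp_apply, ← LinearMap.comp_apply]
  congr 1
  refine hom_ext fun m h p q r u g t hu hg ht => ?_
  simp only [LinearMap.comp_apply, mapRight_gen, mul_gen, ψ.toFun_map]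
  rfl

theorem mapRight_act {L : Type} [Fintype L] [LinearOrder L] (E : L → Type) [∀ i, Finite (E i)]
    {s : ∀ i, R.obj (E i)} {q : L → ℤ} (hs : ∀ i, s i ∈ (R.obj (E i)).grading (q i))
    (z : FreeObj U G R.toSigmaModule L) :
    mapRight U G ψ.toFun (Σ i, E i) (act (A.restrict ψ) G E s z) =
      act A G E (fun i => ψ.toFun (E i) (s i)) (mapRight U G ψ.toFun L z) := by
  rw [← LinearMap.comp_apply, ← LinearMap.comp_apply]
  congr 1
  refine hom_ext fun m h p q r u g t hu hg ht => ?_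
  rw [LinearMap.comp_apply, LinearMap.comp_apply, act_gen _ G E hg ht hs,
    LinearMap.map_smul_of_tower, mapRight_gen, mapRight_gen,
    act_gen A G E hg (fun j => ψ.toFun_mem _ _ _ (ht j)) (fun i => ψ.toFun_mem _ _ _ (hs i))]
  unfold actSucc
  simp only [LinearMap.comp_apply, ψ.toFun_map, ψ.toFun_comp]
  rfl

/-- $\psi$ is compatible with all the operations from which $\partial_\alpha$ is built, `U` being an
$\mathcal R$-algebra by restriction. Hence lifting $\partial_\beta$ reduces to lifting $\beta$ on
generators. -/
theorem mapRight_induced (α : ∀ m : ℕ, G m →ₗ[k] FreeObj U G R.toSigmaModule (Fin m))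
    {e : Type} [Finite e] (z : FreeObj U G R.toSigmaModule e) :
    mapRight U G ψ.toFun e (induced (A.restrict ψ) G α e z) =
      induced A G (fun m => mapRight U G ψ.toFun (Fin m) ∘ₗ α m) e
        (mapRight U G ψ.toFun e z) := by
  rw [← LinearMap.comp_apply, ← LinearMap.comp_apply]
  congr 1
  refine hom_ext fun m h p q r u g t hu hg ht => ?_
  rw [LinearMap.comp_apply, LinearMap.comp_apply, induced_gen, mapRight_map, mapRight_mul,
    mapRight_act ψ A _ ht, mapRight_gen, induced_gen]
  rfl

end MapRight

end FreeObj

end OperadLifting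

namespace OperadLifting

variable {k : Type u} [CommRing k]

/-! ### The induced contraction -/

section Tensor

variable {n : ℕ} {M : Fin n → DGModule.{u, v} k}

/-- Turns anticommutation in a single slot into cancellation of two tensor products of maps. -/
theorem map_add_map_eq_zero {F F' : ∀ i, M i →ₗ[k] M i} (j : Fin n) (hj : F' j = -F j)
    (h : ∀ i, i ≠ j → F' i = F i) : PiTensorProduct.map F + PiTensorProduct.map F' = 0 := by
  have h1 : F' = Function.update F j (-F j) := by
    funext i
    by_cases hi : i = j
    · subst hi
      simp [hj]
    · simp [hi, h i hi]
  have h2 := (PiTensorProduct.mapMultilinear k (fun i => (M i : Type v))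
    (fun i => (M i : Type v))).map_update_neg F j (F j)
  rw [Function.update_eq_self, ← h1] at h2
  exact add_eq_zero_iff_eq_neg'.2 h2

theorem map_add_map_eq {F F' : ∀ i, M i →ₗ[k] M i} (j : Fin n) (h : ∀ i, i ≠ j → F' i = F i) :
    PiTensorProduct.map F + PiTensorProduct.map F' =
      PiTensorProduct.map (Function.update F j (F j + F' j)) := by
  have h1 : F' = Function.update F j (F' j) := by
    funext i
    by_cases hi : i = j
    · subst hi
      simp
    · simp [hi, h i hi]
  rw [PiTensorProduct.map_update_add, Function.update_eq_self, ← h1]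

theorem tensorD_tensorD : DGModule.tensorD M ∘ₗ DGModule.tensorD M = 0 := by
  have hd : ∀ i, (M i).invol ∘ₗ (M i).d = -((M i).d ∘ₗ (M i).invol) := fun i =>
    DGModule.invol_anticomm _ (-1) (by decide) (M i).d_mem
  let D : Fin n → ((⨂[k] i, M i) →ₗ[k] ⨂[k] i, M i) := fun j => PiTensorProduct.map
    fun i => if i < j then (M i).invol else if i = j then (M i).d else LinearMap.id
  have key : ∀ j j', j < j' → D j * D j' + D j' * D j = 0 := by
    intro j j' h
    simp only [D, Module.End.mul_eq_comp]
    rw [← PiTensorProduct.map_comp, ← PiTensorProduct.map_comp]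
    refine map_add_map_eq_zero j ?_ fun i hi => ?_
    · simp only [lt_irrefl, if_false, if_true, h, hd]
    · rcases lt_or_gt_of_ne hi with h1 | h1
      · simp only [h1, h1.trans h, if_true]
      · simp only [h1.not_gt, hi, if_false, LinearMap.comp_id, LinearMap.id_comp]
  have h0 : DGModule.tensorD M = ∑ j, D j := rfl
  rw [h0, ← Module.End.mul_eq_comp, Finset.sum_mul_sum, ← Finset.sum_product']
  -- The terms $(j,j')$ and $(j',j)$ cancel; on the diagonal $d^2=0$ in one slot.
  refine Finset.sum_involution (fun a _ => (a.2, a.1)) ?_ ?_ (by simp) (by simp)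
  · rintro ⟨j, j'⟩ -
    rcases lt_trichotomy j j' with h | rfl | h
    · exact key _ _ h
    · have h1 : D j * D j = 0 := by
        simp only [D, Module.End.mul_eq_comp]
        rw [← PiTensorProduct.map_comp, ← PiTensorProduct.mapMultilinear_apply]
        refine MultilinearMap.map_coord_zero _ j ?_
        simp only [lt_irrefl, if_false, if_true]
        exact LinearMap.ext (M j).d_d
      rw [h1, add_zero]
    · rw [add_comm]
      exact key _ _ h
  · rintro ⟨j, j'⟩ - hne heq
    obtain rfl : j' = j := congrArg Prod.fst heq
    refine hne ?_
    simp only [D, Module.End.mul_eq_comp]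
    rw [← PiTensorProduct.map_comp, ← PiTensorProduct.mapMultilinear_apply]
    refine MultilinearMap.map_coord_zero _ j' ?_
    simp only [lt_irrefl, if_false, if_true]
    exact LinearMap.ext (M j').d_d

/-- The homotopy on a tensor product induced by endomorphisms `π` and homotopies `ν` between the
identity and `π`. -/
noncomputable def tensorHomotopy (π ν : ∀ i, M i →ₗ[k] M i) :
    (⨂[k] i, M i) →ₗ[k] ⨂[k] i, M i :=
  ∑ j : Fin n, PiTensorProduct.map
    (fun i => if i < j then π i ∘ₗ (M i).invol else if i = j then ν i else LinearMap.id)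

/-- Off the diagonal, the differential in slot $j$ and the homotopy in slot $j'$ anticommute. The
$j$th diagonal term is $\pi$ before slot $j$, $\mathrm{id}-\pi$ in it and the identity after it, so
the sum telescopes. -/
theorem tensorD_tensorHomotopy_add {π ν : ∀ i, M i →ₗ[k] M i}
    (hπ : ∀ i n x, x ∈ (M i).grading n → π i x ∈ (M i).grading n)
    (hπ_d : ∀ i, (M i).d ∘ₗ π i = π i ∘ₗ (M i).d)
    (hν : ∀ i n x, x ∈ (M i).grading n → ν i x ∈ (M i).grading (n + 1))
    (hν_d : ∀ i, (M i).d ∘ₗ ν i + ν i ∘ₗ (M i).d = LinearMap.id - π i) :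
    DGModule.tensorD M ∘ₗ tensorHomotopy π ν + tensorHomotopy π ν ∘ₗ DGModule.tensorD M =
      LinearMap.id - PiTensorProduct.map π := by
  have hd : ∀ i, (M i).invol ∘ₗ (M i).d = -((M i).d ∘ₗ (M i).invol) := fun i =>
    DGModule.invol_anticomm _ (-1) (by decide) (M i).d_mem
  have hn : ∀ i, (M i).invol ∘ₗ ν i = -(ν i ∘ₗ (M i).invol) := fun i =>
    DGModule.invol_anticomm _ 1 (by decide) (hν i)
  have hp : ∀ i, (M i).invol ∘ₗ π i = π i ∘ₗ (M i).invol := fun i =>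
    DGModule.invol_comm _ (hπ i)
  have hpp : ∀ i, (M i).invol ∘ₗ π i ∘ₗ (M i).invol = π i := fun i => by
    rw [← LinearMap.comp_assoc, hp, LinearMap.comp_assoc, DGModule.invol_invol, LinearMap.comp_id]
  -- Interpolates between the identity at $c=0$ and $\pi^{\otimes n}$ at $c=n$.
  let T : ℕ → ((⨂[k] i, M i) →ₗ[k] ⨂[k] i, M i) := fun c =>
    PiTensorProduct.map fun i : Fin n => if (i : ℕ) < c then π i else LinearMap.id
  have key : ∀ j j' : Fin n,
      PiTensorProduct.map (fun i => if i < j then (M i).invol else if i = j then (M i).d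
        else LinearMap.id) ∘ₗ PiTensorProduct.map (fun i => if i < j' then π i ∘ₗ (M i).invol
        else if i = j' then ν i else LinearMap.id) +
      PiTensorProduct.map (fun i => if i < j' then π i ∘ₗ (M i).invol
        else if i = j' then ν i else LinearMap.id) ∘ₗ
        PiTensorProduct.map (fun i => if i < j then (M i).invol else if i = j then (M i).d
        else LinearMap.id) = if j = j' then T j - T (j + 1) else 0 := by
    intro j j'
    rw [← PiTensorProduct.map_comp, ← PiTensorProduct.map_comp]
    rcases lt_trichotomy j j' with h | rfl | h
    · rw [if_neg h.ne]
      refine map_add_map_eq_zero j ?_ fun i hi => ?_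
      · simp only [lt_irrefl, if_false, if_true, h]
        rw [LinearMap.comp_assoc, hd, ← LinearMap.comp_assoc, hπ_d, LinearMap.comp_neg,
          LinearMap.comp_assoc]
      · rcases lt_or_gt_of_ne hi with h1 | h1
        · simp only [h1, h1.trans h, if_true]
          rw [hpp, LinearMap.comp_assoc, DGModule.invol_invol, LinearMap.comp_id]
        · simp only [h1.not_gt, hi, if_false, LinearMap.comp_id, LinearMap.id_comp]
    · rw [if_pos rfl, map_add_map_eq j]
      · simp only [lt_irrefl, if_false, if_true, hν_d]
        rw [sub_eq_add_neg, PiTensorProduct.map_update_add, sub_eq_add_neg]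
        congr 1
        · congr 1
          funext i
          rcases lt_trichotomy i j with h | rfl | h
          · simp [h, h.ne, hpp, Fin.lt_def.1 h]
          · simp
          · simp [h.ne', h.not_gt, (Fin.lt_def.1 h).not_gt]
        · rw [← PiTensorProduct.mapMultilinear_apply, MultilinearMap.map_update_neg]
          congr 1
          rw [PiTensorProduct.mapMultilinear_apply]
          congr 1
          funext i
          rcases lt_trichotomy i j with h | rfl | h
          · simp [h, h.ne, hpp, Nat.lt_succ_of_lt (Fin.lt_def.1 h)]
          · simp
          · have : ¬ (i : ℕ) < j + 1 := by
              have := Fin.lt_def.1 h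
              omega
            simp [h.ne', h.not_gt, this]
      · intro i hi
        rcases lt_or_gt_of_ne hi with h1 | h1
        · simp only [h1, if_true]
          rw [hpp, LinearMap.comp_assoc, DGModule.invol_invol, LinearMap.comp_id]
        · simp only [h1.not_gt, hi, if_false, LinearMap.id_comp]
    · rw [if_neg h.ne']
      refine map_add_map_eq_zero j' ?_ fun i hi => ?_
      · simp only [lt_irrefl, if_false, if_true, h]
        rw [hn, neg_neg]
      · rcases lt_or_gt_of_ne hi with h1 | h1
        · simp only [h1, h1.trans h, if_true]
          rw [hpp, LinearMap.comp_assoc, DGModule.invol_invol, LinearMap.comp_id]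
        · simp only [h1.not_gt, hi, if_false, LinearMap.comp_id, LinearMap.id_comp]
  unfold DGModule.tensorD tensorHomotopy
  simp only [← Module.End.mul_eq_comp, Finset.sum_mul, Finset.mul_sum] at key ⊢
  rw [Finset.sum_comm, ← Finset.sum_add_distrib]
  simp only [← Finset.sum_add_distrib, key, Finset.sum_ite_eq, Finset.mem_univ, if_true]
  rw [Fin.sum_univ_eq_sum_range (fun c => T c - T (c + 1)), Finset.sum_range_sub']
  congr 1
  · simp only [T, Nat.not_lt_zero, if_false]
    exact PiTensorProduct.map_id
  · simp only [T, Fin.is_lt, if_true]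

end Tensor

/-! ### The homotopy on `U ⊗ (K ∘ P)` -/

namespace FreeObj

variable {U : SigmaModule.{u, v} k} {G : ℕ → DGModule.{u, v} k} {P Q : SigmaModule.{u, v} k}

variable (U G)

/-- The homotopy on `U ⊗ (K ∘ P)` induced by `ν`. -/
noncomputable def homotopy (π ν : (e : Type) → [Finite e] → (P.obj e →ₗ[k] P.obj e))
    (e : Type) [Finite e] : FreeObj U G P e →ₗ[k] FreeObj U G P e :=
  DirectSum.lmap (fun x : (Σ m : ℕ, (e → Fin (m + 1))) =>
    (TensorProduct.map (U.obj {y : e // x.2 y = 0}).invol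
      (TensorProduct.map (G x.1).invol
        (tensorHomotopy (fun j : Fin x.1 => π {y : e // x.2 y = j.succ})
          (fun j : Fin x.1 => ν {y : e // x.2 y = j.succ}))) :
      Summand U G P e x →ₗ[k] Summand U G P e x))

variable {U G}
variable {π ν : (e : Type) → [Finite e] → (P.obj e →ₗ[k] P.obj e)} {e : Type} [Finite e]

theorem homotopy_gen {m : ℕ} (h : e → Fin (m + 1)) (u : U.obj {y : e // h y = 0}) (g : G m)
    (t : ∀ j : Fin m, P.obj {y : e // h y = j.succ}) :
    homotopy U G π ν e (gen h u g t) = ∑ j, gen h ((U.obj _).invol u) ((G m).invol g)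
      (fun i => if i < j then π _ ((P.obj _).invol (t i)) else if i = j then ν _ (t i) else t i) := by
  unfold homotopy gen
  rw [lmap_incl]
  simp only [TensorProduct.map_tmul, tensorHomotopy, LinearMap.sum_apply,
    PiTensorProduct.map_tprod, TensorProduct.tmul_sum, map_sum]
  refine Finset.sum_congr rfl fun j _ => ?_
  congr 4
  funext i
  split_ifs <;> rfl

/-- The homotopy is odd, so it anticommutes with the differentials of `U` and `G`; only the
contribution of the tensor power of `P` survives. -/
theorem d_homotopy_add
    (hπ : ∀ (e : Type) [Finite e] (n : ℤ) (x : P.obj e),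
      x ∈ (P.obj e).grading n → π e x ∈ (P.obj e).grading n)
    (hπ_d : ∀ (e : Type) [Finite e] (x : P.obj e), π e ((P.obj e).d x) = (P.obj e).d (π e x))
    (hν : ∀ (e : Type) [Finite e] (n : ℤ) (x : P.obj e),
      x ∈ (P.obj e).grading n → ν e x ∈ (P.obj e).grading (n + 1))
    (hν_d : ∀ (e : Type) [Finite e] (x : P.obj e),
      (P.obj e).d (ν e x) + ν e ((P.obj e).d x) = x - π e x) (z : FreeObj U G P e) :
    d U G P e (homotopy U G π ν e z) + homotopy U G π ν e (d U G P e z) =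
      z - mapRight U G π e z := by
  suffices H : d U G P e ∘ₗ homotopy U G π ν e + homotopy U G π ν e ∘ₗ d U G P e =
      LinearMap.id - mapRight U G π e from LinearMap.congr_fun H z
  refine hom_ext fun m h p q r u g t hu hg ht => ?_
  have key := LinearMap.congr_fun (tensorD_tensorHomotopy_add
    (M := fun j : Fin m => P.obj {y : e // h y = j.succ})
    (π := fun j : Fin m => π {y : e // h y = j.succ})
    (ν := fun j : Fin m => ν {y : e // h y = j.succ})
    (fun i => hπ _) (fun i => LinearMap.ext fun x => (hπ_d _ x).symm) (fun i => hν _)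
    (fun i => LinearMap.ext fun x => hν_d _ x)) (PiTensorProduct.tprod k t)
  simp only [LinearMap.add_apply, LinearMap.comp_apply, LinearMap.sub_apply,
    LinearMap.id_apply] at key ⊢
  have hi : ∀ (M : DGModule.{u, v} k) (x : M), M.invol (M.invol x) = x := fun M x =>
    LinearMap.congr_fun DGModule.invol_invol x
  have hd : ∀ (M : DGModule.{u, v} k) (x : M), M.invol (M.d x) = -M.d (M.invol x) := fun M x =>
    LinearMap.congr_fun (DGModule.invol_anticomm M.d (-1) (by decide) M.d_mem) x
  unfold d homotopy mapRight gen
  simp only [lmap_incl, LinearMap.add_apply, TensorProduct.map_tmul, LinearMap.id_apply, map_add,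
    TensorProduct.tmul_add, hi, hd, TensorProduct.neg_tmul, TensorProduct.tmul_neg, map_neg]
  rw [← map_sub, ← TensorProduct.tmul_sub, ← TensorProduct.tmul_sub, ← key,
    TensorProduct.tmul_add, TensorProduct.tmul_add, map_add]
  abel

theorem d_d (z : FreeObj U G P e) : d U G P e (d U G P e z) = 0 := by
  suffices H : d U G P e ∘ₗ d U G P e = 0 from LinearMap.congr_fun H z
  refine hom_ext fun m h p q r u g t hu hg ht => ?_
  have key := LinearMap.congr_fun (tensorD_tensorD
    (M := fun j : Fin m => P.obj {y : e // h y = j.succ})) (PiTensorProduct.tprod k t)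
  simp only [LinearMap.comp_apply, LinearMap.zero_apply] at key ⊢
  have hd : ∀ (M : DGModule.{u, v} k) (x : M), M.invol (M.d x) = -M.d (M.invol x) := fun M x =>
    LinearMap.congr_fun (DGModule.invol_anticomm M.d (-1) (by decide) M.d_mem) x
  unfold d gen
  simp only [lmap_incl, LinearMap.add_apply, TensorProduct.map_tmul, LinearMap.id_apply, map_add,
    TensorProduct.tmul_add, hd, TensorProduct.neg_tmul, TensorProduct.tmul_neg, map_neg, key,
    DGModule.d_d, TensorProduct.zero_tmul, TensorProduct.tmul_zero, map_zero]
  abel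

/-- Every summand of the homotopy has $\nu$ in some slot. -/
theorem mapRight_homotopy {φ : (e : Type) → [Finite e] → (P.obj e →ₗ[k] Q.obj e)}
    (hφν : ∀ (e : Type) [Finite e] (x : P.obj e), φ e (ν e x) = 0) (z : FreeObj U G P e) :
    mapRight U G φ e (homotopy U G π ν e z) = 0 := by
  rw [← LinearMap.comp_apply, ← LinearMap.zero_apply (σ₁₂ := RingHom.id k) z]
  congr 1
  refine hom_ext fun m h p q r u g t hu hg ht => ?_
  rw [LinearMap.comp_apply, homotopy_gen, map_sum]
  refine Finset.sum_eq_zero fun j _ => ?_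
  rw [mapRight_gen]
  unfold gen
  rw [(PiTensorProduct.tprod k).map_coord_zero j (by simp [hφν])]
  simp

theorem mapRight_mapRight {R : SigmaModule.{u, v} k}
    {φ : (e : Type) → [Finite e] → (P.obj e →ₗ[k] Q.obj e)}
    {φ' : (e : Type) → [Finite e] → (Q.obj e →ₗ[k] R.obj e)} (z : FreeObj U G P e) :
    mapRight U G φ' e (mapRight U G φ e z) = mapRight U G (fun e _ => φ' e ∘ₗ φ e) e z := by
  rw [← LinearMap.comp_apply]
  congr 1
  refine hom_ext fun m h p q r u g t hu hg ht => ?_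
  rw [LinearMap.comp_apply, mapRight_gen, mapRight_gen, mapRight_gen]
  rfl

theorem mapRight_eq_self (hπ : ∀ (e : Type) [Finite e] (x : P.obj e), π e x = x)
    (z : FreeObj U G P e) : mapRight U G π e z = z := by
  have : mapRight U G π e = LinearMap.id := by
    refine hom_ext fun m h p q r u g t hu hg ht => ?_
    rw [mapRight_gen]
    simp only [hπ]
    rfl
  rw [this]
  rfl

end FreeObj

end OperadLifting

namespace OperadLifting

variable {k : Type u} [CommRing k]

namespace FreeObj

/-! ### The filtration by the degree of the generators -/

section Filtration

variable (U : SigmaModule.{u, v} k) (G : ℕ → DGModule.{u, v} k) (P : SigmaModule.{u, v} k)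

/-- The span of the homogeneous elements `u ⊗ g ⊗ s_1 ⊗ ⋯ ⊗ s_m` of degree `n` with `|g| ≤ b`. -/
def filtration (e : Type) [Finite e] (n b : ℤ) : Submodule k (FreeObj U G P e) :=
  Submodule.span k {z | ∃ (m : ℕ) (h : e → Fin (m + 1)) (p q : ℤ) (r : Fin m → ℤ)
    (u : U.obj {y : e // h y = 0}) (g : G m) (t : ∀ j : Fin m, P.obj {y : e // h y = j.succ}),
    u ∈ (U.obj {y : e // h y = 0}).grading p ∧ g ∈ (G m).grading q ∧
    (∀ j, t j ∈ (P.obj {y : e // h y = j.succ}).grading (r j)) ∧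
    p + q + ∑ j, r j = n ∧ q ≤ b ∧ z = gen h u g t}

variable {U G P} {e : Type} [Finite e]

theorem gen_mem_filtration {m : ℕ} {h : e → Fin (m + 1)} {u : U.obj {y : e // h y = 0}} {g : G m}
    {t : ∀ j : Fin m, P.obj {y : e // h y = j.succ}} {p q n b : ℤ} {r : Fin m → ℤ}
    (hu : u ∈ (U.obj {y : e // h y = 0}).grading p) (hg : g ∈ (G m).grading q)
    (ht : ∀ j, t j ∈ (P.obj {y : e // h y = j.succ}).grading (r j))
    (hn : p + q + ∑ j, r j = n) (hb : q ≤ b) : gen h u g t ∈ filtration U G P e n b :=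
  Submodule.subset_span ⟨m, h, p, q, r, u, g, t, hu, hg, ht, hn, hb, rfl⟩

theorem filtration_map_mem {N : Type*} [AddCommGroup N] [Module k N] (Φ : FreeObj U G P e →ₗ[k] N)
    (W : Submodule k N) {n b : ℤ}
    (H : ∀ (m : ℕ) (h : e → Fin (m + 1)) (p q : ℤ) (r : Fin m → ℤ)
      (u : U.obj {y : e // h y = 0}) (g : G m) (t : ∀ j : Fin m, P.obj {y : e // h y = j.succ}),
      u ∈ (U.obj {y : e // h y = 0}).grading p → g ∈ (G m).grading q →
      (∀ j, t j ∈ (P.obj {y : e // h y = j.succ}).grading (r j)) →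
      p + q + ∑ j, r j = n → q ≤ b → Φ (gen h u g t) ∈ W)
    {z : FreeObj U G P e} (hz : z ∈ filtration U G P e n b) : Φ z ∈ W := by
  refine (Submodule.span_le (p := W.comap Φ)).2 ?_ hz
  rintro _ ⟨m, h, p, q, r, u, g, t, hu, hg, ht, hn, hb, rfl⟩
  exact H m h p q r u g t hu hg ht hn hb

theorem filtration_mono {n b b' : ℤ} (hb : b ≤ b') {z : FreeObj U G P e}
    (hz : z ∈ filtration U G P e n b) : z ∈ filtration U G P e n b' :=
  filtration_map_mem LinearMap.id _ (fun _ _ _ _ _ _ _ _ hu hg ht hn hq =>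
    gen_mem_filtration hu hg ht hn (hq.trans hb)) hz

theorem filtration_le_grading {n b : ℤ} {z : FreeObj U G P e}
    (hz : z ∈ filtration U G P e n b) : z ∈ grading U G P e n :=
  filtration_map_mem LinearMap.id _ (fun _ _ _ _ _ _ _ _ hu hg ht hn _ =>
    hn ▸ gen_mem hu hg ht) hz

/-- The source of all convergence statements: a filtration level that has become negative is zero.
-/
theorem eq_zero_of_mem_filtration (hG : ∀ m, (G m).IsNonneg) {n b : ℤ} (hb : b < 0)
    {z : FreeObj U G P e} (hz : z ∈ filtration U G P e n b) : z = 0 := by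
  refine filtration_map_mem LinearMap.id ⊥ (fun m h p q r u g t hu hg ht hn hq => ?_) hz
  rw [hG m q (by omega), Submodule.mem_bot] at hg
  rw [hg, LinearMap.id_apply, Submodule.mem_bot]
  unfold gen
  rw [TensorProduct.zero_tmul, TensorProduct.tmul_zero, map_zero]

/-- The other factors have nonnegative degree, so the generator carries at most the total degree.
This is where nonnegativity of `U` and $\mathcal S$ is used. -/
theorem grading_le_filtration (hU : ∀ (e : Type) [Finite e], (U.obj e).IsNonneg)
    (hP : ∀ (e : Type) [Finite e], (P.obj e).IsNonneg) {n : ℤ} {z : FreeObj U G P e}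
    (hz : z ∈ grading U G P e n) : z ∈ filtration U G P e n n := by
  refine (Submodule.span_le (p := filtration U G P e n n)).2 ?_ hz
  rintro _ ⟨m, h, p, q, r, u, g, t, hu, hg, ht, hn, rfl⟩
  by_cases hp : p < 0
  · rw [hU _ p hp, Submodule.mem_bot] at hu
    rw [hu, TensorProduct.zero_tmul, map_zero]
    exact zero_mem _
  by_cases hr : ∃ j, r j < 0
  · obtain ⟨j, hj⟩ := hr
    have h1 := ht j
    rw [hP _ _ hj, Submodule.mem_bot] at h1
    rw [(PiTensorProduct.tprod k).map_coord_zero j h1, TensorProduct.tmul_zero,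
      TensorProduct.tmul_zero, map_zero]
    exact zero_mem _
  push Not at hp hr
  have := Finset.sum_nonneg fun j (_ : j ∈ Finset.univ) => hr j
  exact gen_mem_filtration hu hg ht hn (by omega)

theorem d_mem_filtration {n b : ℤ} {z : FreeObj U G P e} (hz : z ∈ filtration U G P e n b) :
    d U G P e z ∈ filtration U G P e (n - 1) b := by
  refine filtration_map_mem _ _ (fun m h p q r u g t hu hg ht hn hq => ?_) hz
  have smul : ∀ (ε : ℤˣ) (x : FreeObj U G P e), x ∈ filtration U G P e (n - 1) b →
      ε • x ∈ filtration U G P e (n - 1) b := fun ε x hx => zsmul_mem hx _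
  rw [d_gen hu hg ht]
  refine add_mem (gen_mem_filtration ((U.obj _).d_mem _ _ hu) hg ht (by omega) hq)
    (add_mem (smul _ _ (gen_mem_filtration hu ((G m).d_mem _ _ hg) ht (by omega) (by omega)))
      (sum_mem fun j _ => smul _ _ ?_))
  refine gen_mem_filtration (r := fun i => r i - if i = j then 1 else 0) hu hg (fun i => ?_) ?_ hq
  · by_cases hi : i = j
    · subst hi
      simpa using (P.obj _).d_mem _ _ (ht i)
    · simpa [hi] using ht i
  · rw [Finset.sum_sub_distrib]
    simp
    omega

theorem mapRight_mem_filtration {Q : SigmaModule.{u, v} k}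
    {φ : (e : Type) → [Finite e] → (P.obj e →ₗ[k] Q.obj e)}
    (hφ : ∀ (e : Type) [Finite e] (n : ℤ) (x : P.obj e),
      x ∈ (P.obj e).grading n → φ e x ∈ (Q.obj e).grading n)
    {n b : ℤ} {z : FreeObj U G P e} (hz : z ∈ filtration U G P e n b) :
    mapRight U G φ e z ∈ filtration U G Q e n b := by
  refine filtration_map_mem _ _ (fun m h p q r u g t hu hg ht hn hq => ?_) hz
  rw [mapRight_gen]
  exact gen_mem_filtration hu hg (fun j => hφ _ _ _ (ht j)) hn hq

theorem homotopy_mem_filtration {π ν : (e : Type) → [Finite e] → (P.obj e →ₗ[k] P.obj e)}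
    (hπ : ∀ (e : Type) [Finite e] (n : ℤ) (x : P.obj e),
      x ∈ (P.obj e).grading n → π e x ∈ (P.obj e).grading n)
    (hν : ∀ (e : Type) [Finite e] (n : ℤ) (x : P.obj e),
      x ∈ (P.obj e).grading n → ν e x ∈ (P.obj e).grading (n + 1))
    {n b : ℤ} {z : FreeObj U G P e} (hz : z ∈ filtration U G P e n b) :
    homotopy U G π ν e z ∈ filtration U G P e (n + 1) b := by
  refine filtration_map_mem _ _ (fun m h p q r u g t hu hg ht hn hq => ?_) hz
  rw [homotopy_gen]
  refine sum_mem fun j _ => gen_mem_filtration (r := fun i => r i + if i = j then 1 else 0)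
    (DGModule.invol_mem hu) (DGModule.invol_mem hg) (fun i => ?_) ?_ hq
  · rcases lt_trichotomy i j with hi | rfl | hi
    · simpa [hi, hi.ne] using hπ _ _ _ (DGModule.invol_mem (ht i))
    · simpa using hν _ _ _ (ht i)
    · simpa [hi.not_gt, hi.ne'] using ht i
  · rw [Finset.sum_add_distrib]
    simp
    omega

theorem map_mem_filtration {e' : Type} [Finite e'] (σ : e ≃ e') {n b : ℤ} {z : FreeObj U G P e}
    (hz : z ∈ filtration U G P e n b) : map U G P σ z ∈ filtration U G P e' n b := by
  refine filtration_map_mem _ _ (fun m h p q r u g t hu hg ht hn hq => ?_) hz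
  rw [map_gen]
  exact gen_mem_filtration (U.map_mem _ _ _ hu) hg (fun j => P.map_mem _ _ _ (ht j)) hn hq

end Filtration

section Alg

variable {P : Operad.{u, v} k} {U : SigmaModule.{u, v} k} (A : RightModuleAlgebra P U)
variable {G : ℕ → DGModule.{u, v} k}

theorem mul_mem_filtration {c e : Type} [Finite c] [Finite e] {p n b : ℤ} {v : U.obj c}
    (hv : v ∈ (U.obj c).grading p) {z : FreeObj U G P.toSigmaModule e}
    (hz : z ∈ filtration U G P.toSigmaModule e n b) :
    mul A G c e v z ∈ filtration U G P.toSigmaModule (c ⊕ e) (p + n) b := by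
  refine filtration_map_mem _ _ (fun m h p' q r u g t hu hg ht hn hq => ?_) hz
  rw [mul_gen]
  exact gen_mem_filtration (U.map_mem _ _ _ (A.mul_mem _ _ _ _ _ _ hv hu)) hg
    (fun j => P.map_mem _ _ _ (ht j)) (by omega) hq

theorem act_mem_filtration {L : Type} [Fintype L] [LinearOrder L] {E : L → Type}
    [∀ i, Finite (E i)] {s : ∀ i, P.obj (E i)} {q : L → ℤ}
    (hs : ∀ i, s i ∈ (P.obj (E i)).grading (q i)) {n b : ℤ} {z : FreeObj U G P.toSigmaModule L}
    (hz : z ∈ filtration U G P.toSigmaModule L n b) :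
    act A G E s z ∈ filtration U G P.toSigmaModule (Σ i, E i) (n + ∑ i, q i) b := by
  refine filtration_map_mem _ _ (fun m h p γ τ u g t hu hg ht hn hγ => ?_) hz
  rw [act_gen A G E hg ht hs]
  refine zsmul_mem (gen_mem_filtration (actZero_mem A E h hs hu) hg
    (fun j => actSucc_mem E h hs (ht j)) ?_ hγ) _
  have h1 : ∑ i, q i = (∑ i, if h i = 0 then q i else 0) +
      ∑ j : Fin m, ∑ i, if h i = j.succ then q i else 0 := by
    rw [Finset.sum_comm, ← Finset.sum_add_distrib]
    refine Finset.sum_congr rfl fun i _ => ?_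
    rcases Fin.eq_zero_or_eq_succ (h i) with hi | ⟨j, hi⟩
    · simp [hi, (Fin.succ_ne_zero _).symm]
    · simp [hi]
  rw [Finset.sum_add_distrib, h1]
  omega

variable {f : ∀ m : ℕ, G m →ₗ[k] FreeObj U G P.toSigmaModule (Fin m)}

/-- Multiplying by $u$ and inserting $t$ never touch the generator, so the drop of its degree under
$f$ is inherited by the extension. -/
theorem ext_mem_filtration {a c : ℤ} (hf : ∀ (m : ℕ) (q : ℤ) (g : G m), g ∈ (G m).grading q →
      f m g ∈ filtration U G P.toSigmaModule (Fin m) (q - a) (q - c))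
    {e : Type} [Finite e] {n b : ℤ} {z : FreeObj U G P.toSigmaModule e}
    (hz : z ∈ filtration U G P.toSigmaModule e n b) :
    ext A G f e z ∈ filtration U G P.toSigmaModule e (n - a) (b - c) := by
  refine filtration_map_mem _ _ (fun m h p q r u g t hu hg ht hn hq => ?_) hz
  rw [ext_gen]
  have h1 := map_mem_filtration (fiberDecomp h) (mul_mem_filtration A hu
    (act_mem_filtration A ht (hf m q g hg)))
  rw [show p + (q - a + ∑ j, r j) = n - a by omega] at h1
  exact filtration_mono (by omega) h1

theorem induced_mem_filtration {a c : ℤ} (hf : ∀ (m : ℕ) (q : ℤ) (g : G m),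
      g ∈ (G m).grading q → f m g ∈ filtration U G P.toSigmaModule (Fin m) (q - a) (q - c))
    {e : Type} [Finite e] {n b : ℤ} {z : FreeObj U G P.toSigmaModule e}
    (hz : z ∈ filtration U G P.toSigmaModule e n b) :
    induced A G f e z ∈ filtration U G P.toSigmaModule e (n - a) (b - c) := by
  refine filtration_map_mem _ _ (fun m h p q r u g t hu hg ht hn hq => ?_) hz
  rw [induced_gen_of_mem A G f hu, ← ext_gen]
  exact zsmul_mem (ext_mem_filtration A hf (gen_mem_filtration hu hg ht hn hq)) _

theorem induced_eq_zero {b : ℤ} (hf : ∀ (m : ℕ) (q : ℤ) (g : G m), q ≤ b →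
      g ∈ (G m).grading q → f m g = 0)
    {e : Type} [Finite e] {n : ℤ} {z : FreeObj U G P.toSigmaModule e}
    (hz : z ∈ filtration U G P.toSigmaModule e n b) : induced A G f e z = 0 := by
  refine filtration_map_mem _ ⊥ (fun m h p q r u g t hu hg ht hn hq => ?_) hz
  rw [induced_gen, hf m q g hq hg, map_zero, map_zero, map_zero]
  exact zero_mem _

end Alg

end FreeObj

end OperadLifting

namespace OperadLifting

variable {k : Type u} [CommRing k]

/-- Linear maps on the homogeneous parts assemble to a linear map. -/
theorem DGModule.exists_linearMap {N : Type*} [AddCommGroup N] [Module k N]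
    (M : DGModule.{u, v} k) (f : ℤ → M →ₗ[k] N) :
    ∃ φ : M →ₗ[k] N, ∀ (n : ℤ) (x : M), x ∈ M.grading n → φ x = f n x := by
  refine ⟨DirectSum.toModule k ℤ N (fun n => f n ∘ₗ (M.grading n).subtype) ∘ₗ
    (DirectSum.decomposeLinearEquiv M.grading).toLinearMap, fun n x hx => ?_⟩
  lift x to M.grading n using hx
  simp only [LinearMap.comp_apply, LinearEquiv.coe_coe, DirectSum.decomposeLinearEquiv_apply,
    DirectSum.decompose_coe, ← DirectSum.lof_eq_of k, DirectSum.toModule_lof,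
    Submodule.subtype_apply]

theorem add_sub_add_left_of_comm {M : Type*} [AddCommGroup M] (x y z : M) :
    x + y - (y + z) = x - z := by
  abel

theorem add_add_eq_sub {M : Type*} [AddCommGroup M] {a η κ ζ x y z : M} (ha : a = -ζ - x)
    (hη : η = ζ - z) (hκ : κ = x + y) : a + η + κ = y - z := by
  rw [ha, hη, hκ]
  abel

theorem eq_neg_add_sub {M : Type*} [AddCommGroup M] {a x y z w : M} (h : w = a - z) :
    a - x - w = -(x - y + (y - z)) := by
  rw [h]
  abel

namespace FreeObj

/-! ### The recursive construction of twisting cochains -/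

section FixedPoint

variable {P : Operad.{u, v} k} {U : SigmaModule.{u, v} k} (A : RightModuleAlgebra P U)
variable {G : ℕ → DGModule.{u, v} k}
variable (b : ∀ m : ℕ, G m →ₗ[k] FreeObj U G P.toSigmaModule (Fin m))
variable (H : ∀ m : ℕ, FreeObj U G P.toSigmaModule (Fin m) →ₗ[k]
  FreeObj U G P.toSigmaModule (Fin m))

/-- The iterates of $a\mapsto b-H\,\partial_a a$, started at $0$. -/
theorem exists_approx : ∃ a : ℕ → ∀ m : ℕ, G m →ₗ[k] FreeObj U G P.toSigmaModule (Fin m),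
    (∀ (m : ℕ) (g : G m), a 0 m g = 0) ∧ ∀ (t m : ℕ) (g : G m),
      a (t + 1) m g = b m g - H m (induced A G (a t) (Fin m) (a t m g)) := by
  have h : ∀ a : ∀ m : ℕ, G m →ₗ[k] FreeObj U G P.toSigmaModule (Fin m),
      ∃ a' : ∀ m : ℕ, G m →ₗ[k] FreeObj U G P.toSigmaModule (Fin m),
        ∀ (m : ℕ) (g : G m), a' m g = b m g - H m (induced A G a (Fin m) (a m g)) := fun a =>
    ⟨fun m => b m - H m ∘ₗ induced A G a (Fin m) ∘ₗ a m, fun m g => LinearMap.sub_apply _ _ _⟩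
  choose T hT using h
  refine ⟨fun t => T^[t] fun _ => 0, fun m g => LinearMap.zero_apply g, fun t m g => ?_⟩
  simp only [Function.iterate_succ_apply']
  exact hT _ m g

variable {b H}
  {a : ℕ → ∀ m : ℕ, G m →ₗ[k] FreeObj U G P.toSigmaModule (Fin m)}
  (h_zero : ∀ (m : ℕ) (g : G m), a 0 m g = 0)
  (h_succ : ∀ (t m : ℕ) (g : G m),
    a (t + 1) m g = b m g - H m (induced A G (a t) (Fin m) (a t m g)))
variable (hb : ∀ (m : ℕ) (q : ℤ) (g : G m), g ∈ (G m).grading q →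
  b m g ∈ filtration U G P.toSigmaModule (Fin m) (q - 1) (q - 1))
variable (hH : ∀ (m : ℕ) (n c : ℤ) (z : FreeObj U G P.toSigmaModule (Fin m)),
  z ∈ filtration U G P.toSigmaModule (Fin m) n c →
  H m z ∈ filtration U G P.toSigmaModule (Fin m) (n + 1) c)

include h_zero h_succ hb hH in
theorem approx_mem (t m : ℕ) (q : ℤ) (g : G m) (hg : g ∈ (G m).grading q) :
    a t m g ∈ filtration U G P.toSigmaModule (Fin m) (q - 1) (q - 1) := by
  induction t generalizing m q with
  | zero =>
    rw [h_zero]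
    exact zero_mem _
  | succ t ih =>
    rw [h_succ]
    refine sub_mem (hb m q g hg) (filtration_mono (b := q - 1 - 1) (by omega) ?_)
    have := hH m _ _ _ (induced_mem_filtration A ih (ih m q g hg))
    rwa [sub_add_cancel] at this

include h_zero h_succ hb hH in
-- The map $a\mapsto\partial_a a$ is quadratic, and $\partial_{a'}a'-\partial_a
-- a=\partial_{a'-a}a'+\partial_a(a'-a)$. In both terms the undifferenced factor lowers the level by
-- one more, so each iteration gains one level.
theorem approx_succ_sub_mem (t m : ℕ) (q : ℤ) (g : G m) (hg : g ∈ (G m).grading q) :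
    (a (t + 1) m - a t m) g ∈
      filtration U G P.toSigmaModule (Fin m) (q - 1) (q - 1 - t) := by
  induction t generalizing m q with
  | zero =>
    rw [LinearMap.sub_apply, h_zero, sub_zero, Nat.cast_zero, sub_zero]
    exact approx_mem A h_zero h_succ hb hH 1 m q g hg
  | succ t ih =>
    have h1 := hH m _ _ _ (induced_mem_filtration A (f := fun m =>
      a (t + 1) m - a t m) (a := 1) (c := 1 + t)
      (fun m q g hg => by simpa only [sub_sub] using ih m q g hg)
      (approx_mem A h_zero h_succ hb hH (t + 1) m q g hg))
    have h2 := hH m _ _ _ (induced_mem_filtration A (approx_mem A h_zero h_succ hb hH t) (ih m q g hg))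
    rw [sub_add_cancel] at h1 h2
    have h3 := neg_mem (add_mem (filtration_mono (b' := q - 1 - (t + 1 : ℕ))
      (by push_cast; omega) h1) (filtration_mono (b' := q - 1 - (t + 1 : ℕ))
      (by push_cast; omega) h2))
    rw [induced_sub, LinearMap.sub_apply, map_sub, map_sub, map_sub,
      ← eq_neg_add_sub (h_succ t m g)] at h3
    rwa [LinearMap.sub_apply, h_succ (t + 1)]

include h_zero h_succ hb hH in
-- On degree $q$ the successive differences have level $q-1-t$, which is negative from $t=q$ on.
theorem approx_eq (hG : ∀ m, (G m).IsNonneg) {t m : ℕ} {q : ℤ} {g : G m}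
    (hg : g ∈ (G m).grading q) (ht : q ≤ t) :
    a t m g = a q.toNat m g := by
  have h : q.toNat ≤ t := by omega
  induction t, h using Nat.le_induction with
  | base => rfl
  | succ t h ih =>
    rw [← ih (by omega), ← sub_eq_zero, ← LinearMap.sub_apply]
    exact eq_zero_of_mem_filtration hG (by omega) (approx_succ_sub_mem A h_zero h_succ hb hH t m q g hg)

include hb hH in
/-- The equation `α = b - H ∂_α α` has a solution. -/
theorem exists_eq_sub_homotopy (hG : ∀ m, (G m).IsNonneg) :
    ∃ α : ∀ m : ℕ, G m →ₗ[k] FreeObj U G P.toSigmaModule (Fin m),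
      (∀ (m : ℕ) (q : ℤ) (g : G m), g ∈ (G m).grading q →
        α m g ∈ filtration U G P.toSigmaModule (Fin m) (q - 1) (q - 1)) ∧
      ∀ m : ℕ, α m = b m - H m ∘ₗ induced A G α (Fin m) ∘ₗ α m := by
  obtain ⟨a, h_zero, h_succ⟩ := exists_approx A b H
  -- The limit: on degree $q$ it is the stable value, reached at step $q$. For negative $q$ the
  -- index is $0$, which is immaterial because $G$ vanishes there.
  choose α hα using fun m => (G m).exists_linearMap fun q => a q.toNat m
  refine ⟨α, fun m q g hg => ?_, fun m => DGModule.hom_ext fun q g hg => ?_⟩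
  · rw [hα m q g hg]
    exact approx_mem A h_zero h_succ hb hH _ m q g hg
  -- The argument involves only generators of degree at most $q-1$, on which $\alpha$ already equals
  -- the iterate.
  · have h1 : induced A G α (Fin m) (a q.toNat m g) =
        induced A G (a q.toNat) (Fin m) (a q.toNat m g) := by
      rw [← sub_eq_zero, ← induced_sub]
      refine induced_eq_zero A (b := q - 1) (fun m q' g hq hg => ?_)
        (approx_mem A h_zero h_succ hb hH _ m q g hg)
      rw [LinearMap.sub_apply, hα m q' g hg, sub_eq_zero,
        approx_eq A h_zero h_succ hb hH hG (t := q.toNat) hg (by omega)]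
    rw [LinearMap.sub_apply, LinearMap.comp_apply, LinearMap.comp_apply, hα m q g hg, h1,
      ← h_succ]
    exact (approx_eq A h_zero h_succ hb hH hG hg (by omega)).symm

include hH in
/-- The equation `ω = H (ω α - ∂_α ω)` has no solution but `0`. -/
theorem eq_zero_of_eq_homotopy (hG : ∀ m, (G m).IsNonneg)
    {α ω : ∀ m : ℕ, G m →ₗ[k] FreeObj U G P.toSigmaModule (Fin m)}
    (hα : ∀ (m : ℕ) (q : ℤ) (g : G m), g ∈ (G m).grading q →
      α m g ∈ filtration U G P.toSigmaModule (Fin m) (q - 1) (q - 1))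
    (hω : ∀ (m : ℕ) (q : ℤ) (g : G m), g ∈ (G m).grading q →
      ω m g ∈ filtration U G P.toSigmaModule (Fin m) (q - 2) q)
    (h : ∀ (m : ℕ) (g : G m), ω m g =
      H m (ext A G ω (Fin m) (α m g) - induced A G α (Fin m) (ω m g))) (m : ℕ) : ω m = 0 := by
  -- Feeding a bound for $\omega$ into its equation improves it by one level, since $\alpha$ and
  -- $\partial_\alpha$ each lower the generator degree by at least one.
  have key : ∀ (c m : ℕ) (q : ℤ) (g : G m), g ∈ (G m).grading q →
      ω m g ∈ filtration U G P.toSigmaModule (Fin m) (q - 2) (q - c) := by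
    intro c
    induction c with
    | zero => simpa using hω
    | succ c ih =>
      intro m q g hg
      have h1 := ext_mem_filtration A ih (hα m q g hg)
      have h2 := induced_mem_filtration A hα (ih m q g hg)
      rw [show q - 1 - 2 = q - 3 by omega] at h1
      rw [show q - 2 - 1 = q - 3 by omega] at h2
      have h3 := hH m _ _ _ (sub_mem (filtration_mono (b' := q - (c + 1 : ℕ))
        (by push_cast; omega) h1) (filtration_mono (b' := q - (c + 1 : ℕ))
        (by push_cast; omega) h2))
      rw [show q - 3 + 1 = q - 2 by omega] at h3
      rwa [h m g]
  refine DGModule.hom_ext fun q g hg => ?_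
  exact eq_zero_of_mem_filtration hG (by omega) (key (q.toNat + 1) m q g hg)

end FixedPoint

/-! ### Curvature and the twisting equation -/

section Curvature

variable {P : Operad.{u, v} k} {U : SigmaModule.{u, v} k} (A : RightModuleAlgebra P U)
variable (G : ℕ → DGModule.{u, v} k)
variable {α ω : ∀ m : ℕ, G m →ₗ[k] FreeObj U G P.toSigmaModule (Fin m)}
variable (hα : ∀ (m : ℕ) (n : ℤ) (g : G m), g ∈ (G m).grading n →
  α m g ∈ grading U G P.toSigmaModule (Fin m) (n - 1))

theorem exists_curvature (α : ∀ m : ℕ, G m →ₗ[k] FreeObj U G P.toSigmaModule (Fin m)) :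
    ∃ ω : ∀ m : ℕ, G m →ₗ[k] FreeObj U G P.toSigmaModule (Fin m), ∀ m, ω m =
      d U G P.toSigmaModule (Fin m) ∘ₗ α m + α m ∘ₗ (G m).d +
        induced A G α (Fin m) ∘ₗ α m :=
  ⟨_, fun _ => rfl⟩

include hα

/-- The right side is $(d+\partial_\alpha)^2$, because $d^2=0$; the curvature is its restriction to
generators. -/
theorem ext_curvature (hω : ∀ m, ω m = d U G P.toSigmaModule (Fin m) ∘ₗ α m + α m ∘ₗ (G m).d +
      induced A G α (Fin m) ∘ₗ α m)
    {e : Type} [Finite e] (z : FreeObj U G P.toSigmaModule e) :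
    ext A G ω e z =
      d U G P.toSigmaModule e (induced A G α e z) + induced A G α e (d U G P.toSigmaModule e z) +
        induced A G α e (induced A G α e z) := by
  rw [induced_induced A G hα, d_induced_add A G hα, ← ext_add, ← funext hω]

/-- A map `α` whose curvature `d α + α d + ∂_α α` vanishes is a twisting cochain. -/
theorem isTwistingCochain_of_curvature (h : ∀ m, d U G P.toSigmaModule (Fin m) ∘ₗ α m +
      α m ∘ₗ (G m).d + induced A G α (Fin m) ∘ₗ α m = 0) :
    IsTwistingCochain A G α := by
  refine ⟨hα, fun e _ => ?_⟩
  refine hom_ext fun m h' p q r u g t hu hg ht => ?_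
  have h1 := ext_curvature A G hα (fun m => (h m).symm) (gen h' u g t)
  rw [ext_gen, LinearMap.zero_apply, map_zero, map_zero, map_zero] at h1
  rw [LinearMap.comp_apply, LinearMap.add_apply, LinearMap.add_apply, map_add, map_add, d_d,
    zero_add, ← add_assoc, ← h1, LinearMap.zero_apply]

end Curvature

/-! ### The lift and the vanishing of its curvature -/

section Lift

variable {R S : Operad.{u, v} k} {ψ : OperadHom R S}
  {ι : (e : Type) → [Finite e] → (S.obj e →ₗ[k] R.obj e)}
  {ν : (e : Type) → [Finite e] → (R.obj e →ₗ[k] R.obj e)}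
  (hι_deg : ∀ (e : Type) [Finite e] (n : ℤ) (x : S.obj e),
    x ∈ (S.obj e).grading n → ι e x ∈ (R.obj e).grading n)
  (hι_d : ∀ (e : Type) [Finite e] (x : S.obj e), ι e ((S.obj e).d x) = (R.obj e).d (ι e x))
  (hν_deg : ∀ (e : Type) [Finite e] (n : ℤ) (x : R.obj e),
    x ∈ (R.obj e).grading n → ν e x ∈ (R.obj e).grading (n + 1))
  (hψι : ∀ (e : Type) [Finite e] (x : S.obj e), ψ.toFun e (ι e x) = x)
  (hν_d : ∀ (e : Type) [Finite e] (x : R.obj e),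
    (R.obj e).d (ν e x) + ν e ((R.obj e).d x) = x - ι e (ψ.toFun e x))
  (hψν : ∀ (e : Type) [Finite e] (x : R.obj e), ψ.toFun e (ν e x) = 0)
  {U : SigmaModule.{u, v} k} (A : RightModuleAlgebra S U) {G : ℕ → DGModule.{u, v} k}
  {β : ∀ m : ℕ, G m →ₗ[k] FreeObj U G S.toSigmaModule (Fin m)}
  {α : ∀ m : ℕ, G m →ₗ[k] FreeObj U G R.toSigmaModule (Fin m)}
  (hαβ : ∀ m : ℕ, α m = mapRight U G ι (Fin m) ∘ₗ β m -
    homotopy U G (fun e _ => ι e ∘ₗ ψ.toFun e) ν (Fin m) ∘ₗ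
      induced (A.restrict ψ) G α (Fin m) ∘ₗ α m)

include hψι hψν hαβ in
-- $\psi$ annihilates the homotopy and splits $\iota$, so it sends the equation for $\alpha$ to
-- $\psi\alpha=\beta$.
theorem mapRight_eq_of_eq_sub_homotopy (m : ℕ) (g : G m) :
    mapRight U G ψ.toFun (Fin m) (α m g) = β m g := by
  rw [hαβ m, LinearMap.sub_apply, LinearMap.comp_apply, LinearMap.comp_apply, map_sub,
    mapRight_homotopy hψν, sub_zero, mapRight_mapRight]
  exact mapRight_eq_self hψι _

include hι_deg hι_d hν_deg hψι hν_d hψν hαβ in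
-- Inserting the equation for $\alpha$ into $d\alpha$ and $\alpha d$ leaves
-- $\omega=H(d\,\partial_\alpha\alpha-\partial_\alpha\alpha\,d)$. By `ext_curvature` the argument of
-- $H$ differs from the stated one by terms $\partial_\alpha d\alpha$ and
-- $\partial_\alpha\partial_\alpha\alpha$ that cancel.
theorem curvature_eq_homotopy
    (hα : ∀ (m : ℕ) (n : ℤ) (g : G m), g ∈ (G m).grading n →
      α m g ∈ grading U G R.toSigmaModule (Fin m) (n - 1))
    (hβ_d : ∀ (m : ℕ) (g : G m), d U G S.toSigmaModule (Fin m) (β m g) + β m ((G m).d g) = 0)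
    (hββ : ∀ (m : ℕ) (g : G m), induced A G β (Fin m) (β m g) = 0)
    {ω : ∀ m : ℕ, G m →ₗ[k] FreeObj U G R.toSigmaModule (Fin m)}
    (hω : ∀ m, ω m = d U G R.toSigmaModule (Fin m) ∘ₗ α m + α m ∘ₗ (G m).d +
      induced (A.restrict ψ) G α (Fin m) ∘ₗ α m) (m : ℕ) (g : G m) :
    ω m g = homotopy U G (fun e _ => ι e ∘ₗ ψ.toFun e) ν (Fin m)
      (ext (A.restrict ψ) G ω (Fin m) (α m g) -
        induced (A.restrict ψ) G α (Fin m) (ω m g)) := by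
  have hψα : (fun m => mapRight U G ψ.toFun (Fin m) ∘ₗ α m) = β := by
    funext m
    exact LinearMap.ext (mapRight_eq_of_eq_sub_homotopy hψι hψν A hαβ m)
  -- The error term $\iota\psi\,\partial_\alpha\alpha$ of the homotopy formula equals
  -- $\iota\,\partial_\beta\beta$, which is zero by the extra hypothesis on $\beta$.
  have hκ : mapRight U G (fun e _ => ι e ∘ₗ ψ.toFun e) (Fin m)
      (induced (A.restrict ψ) G α (Fin m) (α m g)) = 0 := by
    rw [← mapRight_mapRight, mapRight_induced, hψα,
      mapRight_eq_of_eq_sub_homotopy hψι hψν A hαβ, hββ, map_zero]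
  have hα_eq : ∀ g, α m g = mapRight U G ι (Fin m) (β m g) -
      homotopy U G (fun e _ => ι e ∘ₗ ψ.toFun e) ν (Fin m)
        (induced (A.restrict ψ) G α (Fin m) (α m g)) := fun g => LinearMap.congr_fun (hαβ m) g
  have hω_eq : ω m g = d U G R.toSigmaModule (Fin m) (α m g) + α m ((G m).d g) +
      induced (A.restrict ψ) G α (Fin m) (α m g) := LinearMap.congr_fun (hω m) g
  have hdH := d_homotopy_add (U := U) (G := G) (π := fun e _ => ι e ∘ₗ ψ.toFun e) (ν := ν)
    (fun e _ n x hx => hι_deg e n _ (ψ.toFun_mem e n x hx))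
    (fun e _ x => by rw [LinearMap.comp_apply, LinearMap.comp_apply, ψ.toFun_d, hι_d])
    hν_deg (fun e _ x => hν_d e x) (induced (A.restrict ψ) G α (Fin m) (α m g))
  rw [hκ, sub_zero] at hdH
  have hd := congrArg (d U G R.toSigmaModule (Fin m)) (hα_eq g)
  -- The hypothesis $d\beta+\beta d=0$ turns $d\iota\beta$ into $-\iota\beta d$, which cancels the
  -- leading part of $\alpha d$.
  rw [map_sub, ← d_mapRight ι hι_deg hι_d, eq_neg_of_add_eq_zero_left (hβ_d m g), map_neg] at hd
  rw [ext_curvature _ G hα hω, hω_eq, map_add, map_add, add_sub_add_right_eq_sub,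
    add_sub_add_left_of_comm, map_sub]
  exact add_add_eq_sub hd (hα_eq _) hdH.symm

include hι_deg hι_d hν_deg hψι hν_d hψν in
/-- Twisting cochains lift along a contractible `ψ`. -/
theorem exists_isTwistingCochain_lift (hG : ∀ m, (G m).IsNonneg)
    (hU : ∀ (e : Type) [Finite e], (U.obj e).IsNonneg)
    (hS : ∀ (e : Type) [Finite e], (S.obj e).IsNonneg)
    (hβ : ∀ (m : ℕ) (n : ℤ) (g : G m), g ∈ (G m).grading n →
      β m g ∈ grading U G S.toSigmaModule (Fin m) (n - 1))
    (hβ_d : ∀ (m : ℕ) (g : G m), d U G S.toSigmaModule (Fin m) (β m g) + β m ((G m).d g) = 0)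
    (hββ : ∀ (m : ℕ) (g : G m), induced A G β (Fin m) (β m g) = 0) :
    ∃ α : ∀ m : ℕ, G m →ₗ[k] FreeObj U G R.toSigmaModule (Fin m),
      IsTwistingCochain (A.restrict ψ) G α ∧
      ∀ m : ℕ, mapRight U G ψ.toFun (Fin m) ∘ₗ α m = β m := by
  have hH : ∀ (m : ℕ) (n c : ℤ) (z : FreeObj U G R.toSigmaModule (Fin m)),
      z ∈ filtration U G R.toSigmaModule (Fin m) n c →
      homotopy U G (fun e _ => ι e ∘ₗ ψ.toFun e) ν (Fin m) z ∈
        filtration U G R.toSigmaModule (Fin m) (n + 1) c := fun m n c z =>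
    homotopy_mem_filtration (fun e _ n x hx => hι_deg e n _ (ψ.toFun_mem e n x hx)) hν_deg
  obtain ⟨α, hα, hαβ⟩ := exists_eq_sub_homotopy (A.restrict ψ)
    (b := fun m => mapRight U G ι (Fin m) ∘ₗ β m)
    (fun m q g hg => mapRight_mem_filtration hι_deg (grading_le_filtration hU hS (hβ m q g hg)))
    hH hG
  have hα_deg := fun m q g hg => filtration_le_grading (hα m q g hg)
  obtain ⟨ω, hω⟩ := exists_curvature (A.restrict ψ) G α
  refine ⟨α, isTwistingCochain_of_curvature _ G hα_deg fun m => ?_, fun m => LinearMap.ext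
    (mapRight_eq_of_eq_sub_homotopy hψι hψν A hαβ m)⟩
  rw [← hω]
  -- A crude bound on the level of $\omega$ suffices to start the induction.
  refine eq_zero_of_eq_homotopy (A.restrict ψ) hH hG hα (fun m q g hg => ?_)
    (curvature_eq_homotopy hι_deg hι_d hν_deg hψι hν_d hψν A hαβ hα_deg hβ_d hββ hω) m
  have h1 := d_mem_filtration (hα m q g hg)
  have h2 := hα m _ _ ((G m).d_mem q g hg)
  have h3 := induced_mem_filtration (A.restrict ψ) hα (hα m q g hg)
  rw [show q - 1 - 1 = q - 2 by omega] at h1 h2 h3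
  rw [hω, LinearMap.add_apply, LinearMap.add_apply]
  exact add_mem (add_mem (filtration_mono (by omega) h1) (filtration_mono (by omega) h2))
    (filtration_mono (by omega) h3)

end Lift

end FreeObj

end OperadLifting

theorem mainTheorem4 {k : Type u} [CommRing k] (R S : Operad.{u, v} k)
    -- the retract
    (ψ : OperadHom R S)
    (ι : (e : Type) → [Finite e] → (S.obj e →ₗ[k] R.obj e))
    (ν : (e : Type) → [Finite e] → (R.obj e →ₗ[k] R.obj e))
    (hι_deg : ∀ (e : Type) [Finite e] (n : ℤ) (x : S.obj e),
      x ∈ (S.obj e).grading n → ι e x ∈ (R.obj e).grading n)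
    (hι_d : ∀ (e : Type) [Finite e] (x : S.obj e), ι e ((S.obj e).d x) = (R.obj e).d (ι e x))
    (hν_deg : ∀ (e : Type) [Finite e] (n : ℤ) (x : R.obj e),
      x ∈ (R.obj e).grading n → ν e x ∈ (R.obj e).grading (n + 1))
    (hψι : ∀ (e : Type) [Finite e] (x : S.obj e), ψ.toFun e (ι e x) = x)
    (hν_d : ∀ (e : Type) [Finite e] (x : R.obj e),
      (R.obj e).d (ν e x) + ν e ((R.obj e).d x) = x - ι e (ψ.toFun e x))
    (hψν : ∀ (e : Type) [Finite e] (x : R.obj e), ψ.toFun e (ν e x) = 0)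
    -- the algebra `U` in right `S`-modules, and `K = G ⊗ Σ_*`
    (U : SigmaModule.{u, v} k) (A : RightModuleAlgebra S U) (G : ℕ → DGModule.{u, v} k)
    (hG : ∀ m, (G m).IsNonneg)
    (hU : ∀ (e : Type) [Finite e], (U.obj e).IsNonneg)
    (hS : ∀ (e : Type) [Finite e], (S.obj e).IsNonneg)
    -- the twisting cochain `β`
    (β : ∀ m : ℕ, G m →ₗ[k] FreeObj U G S.toSigmaModule (Fin m))
    (hβ : FreeObj.IsTwistingCochain A G β)
    (hβ_d : ∀ (m : ℕ) (g : G m),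
      FreeObj.d U G S.toSigmaModule (Fin m) (β m g) + β m ((G m).d g) = 0)
    (hββ : ∀ (m : ℕ) (g : G m), FreeObj.induced A G β (Fin m) (β m g) = 0) :
    ∃ α : ∀ m : ℕ, G m →ₗ[k] FreeObj U G R.toSigmaModule (Fin m),
      FreeObj.IsTwistingCochain (A.restrict ψ) G α ∧
      ∀ (e : Type) [Finite e],
        FreeObj.mapRight U G ψ.toFun e ∘ₗ FreeObj.induced (A.restrict ψ) G α e =
          FreeObj.induced A G β e ∘ₗ FreeObj.mapRight U G ψ.toFun e := by
  obtain ⟨α, hα, h⟩ := FreeObj.exists_isTwistingCochain_lift hι_deg hι_d hν_deg hψι hν_d hψν A hG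
    hU hS hβ.1 hβ_d hββ
  refine ⟨α, hα, fun e _ => LinearMap.ext fun z => ?_⟩
  rw [LinearMap.comp_apply, FreeObj.mapRight_induced, funext h, LinearMap.comp_apply]
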